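/- Let $\mathcal M=(M;<,+,\ldots)$ be an o-minimal expansion of an ordered group; "definable" means definable in $\mathcal M$ with parameters. The affine topology on a subset of $M^k$ is the subspace topology induced by the product of the order topologies on $M$. A topology $\tau$ on a definable set $X\subseteq M^n$ is definable if it has a basis of the form $\{\varphi(X,\bar b):\bar b\in M^m\}$ for some $m$ and some formula $\varphi(\bar x,\bar y)$ (possibly with parameters); $(X,\tau)$ is definably connected if $X$ is not the union of two disjoint non-empty definable $\tau$-open subsets. **Theorem.** Let $X\subseteq M^{n}$ be a definable bounded set with $\dim X=1$ (o-minimal dimension), and let $\tau$ be a definable, Hausdorff, regular topology on $X$. If $(X,\tau)$ is definably connected, then $(X,\tau)$ is definably homeomorphic to a definable set with its affine topology; that is, there are $k\in\mathbb N$, a definable set $Y\subseteq M^{k}$, and a homeomorphism from $(X,\tau)$ onto $Y$ with its affine topology whose graph is definable. -/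

import Mathlib

open Set

/-- A subset `X` of `Mⁿ` is definable, with parameters from `M`, in the `L`-structure `M`. -/
def IsDef (L : FirstOrder.Language) {M α : Type*} [L.Structure M] (X : Set (α → M)) : Prop :=
  (univ : Set M).Definable L X

/-- Points and open intervals with endpoints in `M ∪ {-∞, +∞}`. -/
def IsPointOrInterval {M : Type*} [LinearOrder M] (I : Set M) : Prop :=
  (∃ a, I = {a}) ∨ (∃ a b, I = Ioo a b) ∨ (∃ a, I = Ioi a) ∨ (∃ b, I = Iio b) ∨ I = univ

/-- The `L`-structure `M` is an o-minimal expansion of the ordered group `(M; <, +)`: the order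
and the addition are definable in it, and every definable subset of `M` is a finite union of
points and open intervals. -/
structure IsOMinimalExpansion (L : FirstOrder.Language) (M : Type*) [L.Structure M]
    [AddGroup M] [LinearOrder M] : Prop where
  lt_definable : IsDef L {p : Fin 2 → M | p 0 < p 1}
  add_definable : IsDef L {p : Fin 3 → M | p 0 + p 1 = p 2}
  finite_union : ∀ A : Set M, IsDef L {p : Fin 1 → M | p 0 ∈ A} →
    ∃ S : Set (Set M), S.Finite ∧ (∀ I ∈ S, IsPointOrInterval I) ∧ A = ⋃₀ S

/-- Some projection of `X ⊆ Mⁿ` to `d` of the coordinates contains a nonempty open box of `Mᵈ`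
(over a dense order). -/
def DimAtLeast {M : Type*} [LinearOrder M] {n : ℕ} (X : Set (Fin n → M)) (d : ℕ) : Prop :=
  ∃ (ι : Fin d ↪ Fin n) (a b : Fin d → M), (∀ i, a i < b i) ∧
    {y : Fin d → M | ∀ i, y i ∈ Ioo (a i) (b i)} ⊆ (fun x i => x (ι i)) '' X

/-- The o-minimal dimension of the definable set `X` is `d`: `d` is the largest number such that
some projection of `X` to `d` of the coordinates has nonempty interior. -/
def HasDim {M : Type*} [LinearOrder M] {n : ℕ} (X : Set (Fin n → M)) (d : ℕ) : Prop :=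
  IsGreatest {e : ℕ | DimAtLeast X e} d

/-- `X ⊆ Mⁿ` is contained in a closed box with endpoints in `M`. -/
def IsBddSet {M : Type*} [LinearOrder M] {n : ℕ} (X : Set (Fin n → M)) : Prop :=
  ∃ a b : Fin n → M, ∀ x ∈ X, ∀ i, x i ∈ Icc (a i) (b i)

/-- `τ` is a definable topology on `X ⊆ Mⁿ`: the fibres over `Mᵐ` of some definable
`D ⊆ Mⁿ × Mᵐ`, intersected with `X`, form a basis of `τ`. -/
def IsDefinableTopology (L : FirstOrder.Language) {M : Type*} [L.Structure M] {n : ℕ}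
    (X : Set (Fin n → M)) (τ : TopologicalSpace X) : Prop :=
  ∃ (m : ℕ) (D : Set (Fin n ⊕ Fin m → M)), IsDef L D ∧
    @TopologicalSpace.IsTopologicalBasis X τ
      {U : Set X | ∃ b : Fin m → M, U = {x : X | Sum.elim x.1 b ∈ D}}

/-- `(X, τ)` is definably connected: `X` is not the union of two disjoint nonempty definable
`τ`-open subsets. -/
def IsDefinablyConnected (L : FirstOrder.Language) {M : Type*} [L.Structure M] {n : ℕ}
    (X : Set (Fin n → M)) (τ : TopologicalSpace X) : Prop :=
  ¬ ∃ U W : Set X, IsDef L (Subtype.val '' U) ∧ IsDef L (Subtype.val '' W) ∧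
    @IsOpen X τ U ∧ @IsOpen X τ W ∧ U.Nonempty ∧ W.Nonempty ∧ U ∩ W = ∅ ∧ U ∪ W = univ

/-- There is a homeomorphism from `(X, τ)` onto `(Y, σ)` whose graph is definable. -/
def DefinablyHomeomorphic (L : FirstOrder.Language) {M : Type*} [L.Structure M] {n k : ℕ}
    (X : Set (Fin n → M)) (τ : TopologicalSpace X)
    (Y : Set (Fin k → M)) (σ : TopologicalSpace Y) : Prop :=
  ∃ f : @Homeomorph X Y τ σ,
    IsDef L {z : Fin n ⊕ Fin k → M | ∃ x : X, z = Sum.elim x.1 (f.toEquiv x).1}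

/-- The affine topology on `Y ⊆ Mᵏ`: the subspace topology of the product topology of the order
topology on `M`. -/
abbrev affineTopology {M : Type*} [LinearOrder M] {k : ℕ} (Y : Set (Fin k → M)) :
    TopologicalSpace Y :=
  TopologicalSpace.induced Subtype.val
    (@Pi.topologicalSpace (Fin k) (fun _ => M) (fun _ => Preorder.topology M))

/-!
A bounded one-dimensional definable set `X` with a definable Hausdorff regular topology is, up to a
definable bijection, a bounded subset `E` of the line `M` with such a topology, and definable
connectedness forces this topology to be that of a finite graph, which embeds into some `Mᵏ`.

*Tools.* In a nontrivial o-minimal ordered group the order is dense and the addition commutative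
and divisible (`denselyOrdered_of_ominimal`, `add_comm_of_ominimal`, `exists_add_self_eq`). A
definable condition is decided along each germ, that is, along each one-sided punctured
neighbourhood filter of a point of `M` (`Def1.sd_or`). Bounded definable families are definably
compact: a downward directed one has a common point or a common germ (`exists_cluster`). The
monotonicity theorem (`DF1.finite_not_strictAt`), definable choice (`Def2.exists_choice`) and
uniform finiteness (`exists_ncard_le`) hold; they rest on `uniform_radius`, which finds a positive
constant below a definable family of radii on a subinterval.

*From `X` to the line.* A bounded plane set without interior is a finite union of definable sets on
which one coordinate determines the other (`exists_cover_of_thin`). Hence `X` is a finite union of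
definable sets on each of which a single coordinate is injective; moving them to disjoint places
gives a definable injection of `X` into `M` with bounded image `E`
(`exists_definable_injection`). The topology is transported to `E` (`defBasis_image`).

*Germs determine the topology.* `Lim E B s z a` says that the germ of `M` at `z` on the side `s`
converges to `a` in the given topology. Limits are unique, and by definable compactness a definable
set is a neighbourhood of its point `a` if it contains all the germs converging to `a`
(`DefBasis.exists_subset_of_lim`). The limit of the germ at `z` is a definable partial function of
`z`, continuous and strictly monotone at all but finitely many points, and regularity shows that at
the limit `c` of a generic germ one of the two germs of `M` converges to `c` itself
(`DefBasis.lim_self_of_strictAt`).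

*Finitely many exceptions.* The main point is that both germs at `c` converge to `c`, for all but
finitely many `c ∈ E` (`DefBasis.finite_not_lim_self`). If not, there is an interval of points `c`
of which only the germ on one fixed side converges to `c`, as in
the Sorgenfrey line or the split interval. A small closed subinterval in general position then
yields a proper nonempty definable set that is open and closed (`DefBasis.false_of_interval`).

*Embedding a graph.* Consequently there is a finite set `F` of vertices such that each point of
`E` outside `F` lies on an edge, an open interval between two neighbouring points of `F` with its
affine topology, and the germs at points of `F` either have no limit or have a limit in `F`. The
functions `tent`, which locate a point on an edge, and `vertexFun`, which detect the germs
converging to a given vertex, are finitely many definable functions which induce the topology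
(`DefBasis.exists_inducing`).
-/

set_option linter.unusedSectionVars false

open Filter Topology

/-! ### Definable predicates and functions -/

/-- A predicate on tuples is definable (with parameters) when the set of tuples satisfying it is.
The closure rules below are tagged `simp`, so that `simp` proves definability of an explicitly
written first-order condition. -/
def Dfp (L : FirstOrder.Language) {M α : Type*} [L.Structure M] (P : (α → M) → Prop) : Prop :=
  IsDef L {v | P v}

/-- A function from tuples to `M` is definable (with parameters) when its graph is. -/
def DF (L : FirstOrder.Language) {M α : Type*} [L.Structure M] (f : (α → M) → M) : Prop :=
  DefinableFun L univ f

/-- A definable predicate in one variable. -/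
def Def1 (L : FirstOrder.Language) {M : Type*} [L.Structure M] (P : M → Prop) : Prop :=
  Dfp L (fun v : Fin 1 → M => P (v 0))

/-- A definable relation in two variables. -/
def Def2 (L : FirstOrder.Language) {M : Type*} [L.Structure M] (R : M → M → Prop) : Prop :=
  Dfp L (fun v : Fin 2 → M => R (v 0) (v 1))

/-- A definable function in one variable. -/
def DF1 (L : FirstOrder.Language) {M : Type*} [L.Structure M] (f : M → M) : Prop :=
  DF L (fun v : Fin 1 → M => f (v 0))

section toolkit

variable {L : FirstOrder.Language} {M : Type*} [L.Structure M] {α β : Type*}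

@[simp] theorem Dfp.and {P Q : (α → M) → Prop} (hP : Dfp L P) (hQ : Dfp L Q) :
    Dfp L (fun v => P v ∧ Q v) := Definable.inter hP hQ

@[simp] theorem Dfp.or {P Q : (α → M) → Prop} (hP : Dfp L P) (hQ : Dfp L Q) :
    Dfp L (fun v => P v ∨ Q v) := Definable.union hP hQ

@[simp] theorem Dfp.not {P : (α → M) → Prop} (hP : Dfp L P) :
    Dfp L (fun v => ¬ P v) := Definable.compl hP

theorem Dfp.congr {P Q : (α → M) → Prop} (hP : Dfp L P) (h : ∀ v, Q v ↔ P v) : Dfp L Q := by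
  have : Q = P := funext fun v => propext (h v)
  rwa [this]

@[simp] theorem Dfp.imp {P Q : (α → M) → Prop} (hP : Dfp L P) (hQ : Dfp L Q) :
    Dfp L (fun v => P v → Q v) := (hP.not.or hQ).congr fun _ => imp_iff_not_or

@[simp] theorem Dfp.const (p : Prop) : Dfp L (fun _ : α → M => p) := by
  by_cases h : p
  · simp only [Dfp, h]; exact definable_univ
  · simp only [Dfp, h]; exact definable_empty

@[simp] theorem Dfp.ex [Finite α] {P : (α → M) → M → Prop}
    (h : Dfp L (fun w : Option α → M => P (fun i => w (some i)) (w none))) :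
    Dfp L (fun v => ∃ x, P v x) := by
  have := Definable.image_comp h (some : α → Option α)
  refine Dfp.congr this fun v => ⟨?_, ?_⟩
  · rintro ⟨x, hx⟩
    exact ⟨fun o => o.elim x v, hx, rfl⟩
  · rintro ⟨w, hw, rfl⟩
    exact ⟨_, hw⟩

@[simp] theorem Dfp.all [Finite α] {P : (α → M) → M → Prop}
    (h : Dfp L (fun w : Option α → M => P (fun i => w (some i)) (w none))) :
    Dfp L (fun v => ∀ x, P v x) :=
  (Dfp.ex (P := fun v x => ¬ P v x) h.not).not.congr fun v => by simp

/-- Quantification over tuples of elements of `M`. -/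
@[simp] theorem Dfp.exTuple [Finite β] {P : (α → M) → (β → M) → Prop}
    (h : Dfp L (fun w : α ⊕ β → M => P (fun i => w (.inl i)) (fun j => w (.inr j)))) :
    Dfp L (fun v => ∃ x : β → M, P v x) :=
  Definable.exists_of_finite h

@[simp] theorem Dfp.allTuple [Finite β] {P : (α → M) → (β → M) → Prop}
    (h : Dfp L (fun w : α ⊕ β → M => P (fun i => w (.inl i)) (fun j => w (.inr j)))) :
    Dfp L (fun v => ∀ x : β → M, P v x) :=
  Definable.forall_of_finite h

/-- Quantification over a finite index type. -/
theorem Dfp.allFin {ι : Type*} [Finite ι] {P : ι → (α → M) → Prop} (h : ∀ i, Dfp L (P i)) :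
    Dfp L (fun v => ∀ i, P i v) := by
  unfold Dfp IsDef
  rw [Set.ofPred_forall]
  exact definable_iInter_of_finite h

theorem Dfp.exFin {ι : Type*} [Finite ι] {P : ι → (α → M) → Prop} (h : ∀ i, Dfp L (P i)) :
    Dfp L (fun v => ∃ i, P i v) :=
  (Dfp.allFin (P := fun i v => ¬ P i v) fun i => (h i).not).not.congr fun v => by simp

@[simp] theorem DF.const (c : M) : DF L (fun _ : α → M => c) :=
  L.definableFun_const α (mem_univ _)

@[simp] theorem DF.var (i : α) : DF L (fun v : α → M => v i) :=
  DefinableFun.proj _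

@[simp] theorem Dfp.eq {f g : (α → M) → M} (hf : DF L f) (hg : DF L g) :
    Dfp L (fun v => f v = g v) :=
  hf.ofPred_eq hg

/-- Substitution of definable functions into a definable predicate. -/
theorem Dfp.subst [Finite β] {P : (β → M) → Prop} (hP : Dfp L P) {t : β → (α → M) → M}
    (ht : ∀ b, DF L (t b)) : Dfp L (fun v => P (fun b => t b v)) :=
  Definable.preimage_map (F := fun v b => t b v) ht hP

theorem DF.ite {p : (α → M) → Prop} [DecidablePred p] {f g : (α → M) → M} (hp : Dfp L p)
    (hf : DF L f) (hg : DF L g) : DF L (fun v => if p v then f v else g v) :=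
  DefinableFun.ite hp hf hg

/-- A function is definable as soon as the relation `f v = y` is. -/
theorem DF.of_graph {f : (α → M) → M}
    (h : Dfp L (fun w : Option α → M => f (fun i => w (some i)) = w none)) : DF L f := h

theorem Def1.app {P : M → Prop} (h : Def1 L P) {t : (α → M) → M} (ht : DF L t) :
    Dfp L (fun v => P (t v)) :=
  Dfp.subst (t := fun _ => t) h fun _ => ht

theorem Def2.app {R : M → M → Prop} (h : Def2 L R) {s t : (α → M) → M} (hs : DF L s)
    (ht : DF L t) : Dfp L (fun v => R (s v) (t v)) :=
  Dfp.subst (t := ![s, t]) h fun b => by fin_cases b <;> assumption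

theorem DF.subst [Finite β] {f : (β → M) → M} (hf : DF L f) {t : β → (α → M) → M}
    (ht : ∀ b, DF L (t b)) : DF L (fun v => f (fun b => t b v)) :=
  DefinableFun.comp (g := fun v b => t b v) ht hf

theorem DF1.app {f : M → M} (h : DF1 L f) {t : (α → M) → M} (ht : DF L t) :
    DF L (fun v => f (t v)) :=
  DF.subst (t := fun _ => t) h fun _ => ht

theorem DF1.of_def2 {f : M → M} (h : Def2 L (fun x y => f x = y)) : DF1 L f :=
  h.app (s := fun w : Option (Fin 1) → M => w (some 0)) (t := fun w => w none)
    (DF.var _) (DF.var _)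

end toolkit

section ordered

variable {L : FirstOrder.Language} {M : Type*} [L.Structure M] [AddGroup M] [LinearOrder M]
  [hM : Fact (IsOMinimalExpansion L M)] {α β : Type*}

@[simp] theorem Dfp.lt {f g : (α → M) → M} (hf : DF L f) (hg : DF L g) :
    Dfp L (fun v => f v < g v) :=
  Def2.app (R := fun x y => x < y) hM.out.lt_definable hf hg

@[simp] theorem Dfp.le {f g : (α → M) → M} (hf : DF L f) (hg : DF L g) :
    Dfp L (fun v => f v ≤ g v) :=
  (Dfp.lt hg hf).not.congr fun _ => not_lt.symm

@[simp] theorem DF.add {f g : (α → M) → M} (hf : DF L f) (hg : DF L g) :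
    DF L (fun v => f v + g v) := by
  have h2 : DF L (fun v : Fin 2 → M => v 0 + v 1) := by
    refine DF.of_graph ?_
    exact Dfp.subst (t := ![fun w : Option (Fin 2) → M => w (some 0), fun w => w (some 1),
      fun w => w none]) hM.out.add_definable fun b => by fin_cases b <;> exact DF.var _
  exact DF.subst (t := ![f, g]) h2 fun b => by fin_cases b <;> assumption

@[simp] theorem DF.neg [Finite α] {f : (α → M) → M} (hf : DF L f) : DF L (fun v => - f v) := by
  have h1 : DF1 L (fun x : M => - x) := by
    refine DF1.of_def2 ?_
    refine Dfp.congr (P := fun v : Fin 2 → M => v 0 + v 1 = 0) (by simp) fun v => ?_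
    exact neg_eq_iff_add_eq_zero
  exact h1.app hf

@[simp] theorem DF.sub [Finite α] {f g : (α → M) → M} (hf : DF L f) (hg : DF L g) :
    DF L (fun v => f v - g v) := by
  simpa only [sub_eq_add_neg] using hf.add hg.neg

@[simp] theorem DF.max {f g : (α → M) → M} (hf : DF L f) (hg : DF L g) :
    DF L (fun v => max (f v) (g v)) := by
  simpa only [max_def] using DF.ite (Dfp.le hf hg) hg hf

@[simp] theorem DF.min {f g : (α → M) → M} (hf : DF L f) (hg : DF L g) :
    DF L (fun v => min (f v) (g v)) := by
  simpa only [min_def] using DF.ite (Dfp.le hf hg) hf hg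

@[simp] theorem DF.abs [Finite α] {f : (α → M) → M} (hf : DF L f) : DF L (fun v => |f v|) :=
  DF.max hf hf.neg

end ordered

/-! ### First consequences of o-minimality -/

section basic

variable {L : FirstOrder.Language} {M : Type*} [L.Structure M] [AddGroup M] [LinearOrder M]
  [hM : Fact (IsOMinimalExpansion L M)]

variable [DenselyOrdered M] [NoMaxOrder M] [NoMinOrder M]

/-- An infinite definable subset of `M` contains an open interval. -/
theorem Def1.exists_Ioo {P : M → Prop} (hP : Def1 L P) (hinf : {x | P x}.Infinite) :
    ∃ a b, a < b ∧ ∀ x, a < x → x < b → P x := by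
  obtain ⟨S, hS, hI, hU⟩ := hM.out.finite_union {x | P x} hP
  have : ∃ I ∈ S, I.Infinite := by
    by_contra! h
    exact hinf (hU ▸ hS.sUnion fun I hI => h I hI)
  obtain ⟨I, hIS, hIinf⟩ := this
  have hsub : ∀ x ∈ I, P x := fun x hx => by
    have : x ∈ {x | P x} := hU ▸ ⟨I, hIS, hx⟩
    exact this
  rcases hI I hIS with ⟨a, rfl⟩ | ⟨a, b, rfl⟩ | ⟨a, rfl⟩ | ⟨b, rfl⟩ | rfl
  · exact absurd (finite_singleton a) hIinf
  · obtain ⟨x, hx⟩ := hIinf.nonempty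
    exact ⟨a, b, hx.1.trans hx.2, fun y h1 h2 => hsub y ⟨h1, h2⟩⟩
  · obtain ⟨b, hb⟩ := exists_gt a
    exact ⟨a, b, hb, fun y h1 _ => hsub y h1⟩
  · obtain ⟨a, ha⟩ := exists_lt b
    exact ⟨a, b, ha, fun y _ h1 => hsub y h1⟩
  · obtain ⟨x, hx⟩ := hIinf.nonempty
    obtain ⟨b, hb⟩ := exists_gt x
    exact ⟨x, b, hb, fun y _ _ => hsub y trivial⟩

theorem Def1.finite_of_forall {P : M → Prop} (hP : Def1 L P)
    (h : ∀ a b, a < b → ∃ x, a < x ∧ x < b ∧ ¬ P x) : {x | P x}.Finite := by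
  by_contra hinf
  obtain ⟨a, b, hab, hsub⟩ := hP.exists_Ioo hinf
  obtain ⟨x, h1, h2, h3⟩ := h a b hab
  exact h3 (hsub x h1 h2)

theorem infinite_of_interval {P : M → Prop} {a b : M} (hab : a < b)
    (h : ∀ x, a < x → x < b → P x) : {x | P x}.Infinite :=
  (Ioo_infinite hab).mono fun x hx => h x hx.1 hx.2

theorem Def1.exists_subinterval {P : M → Prop} (hP : Def1 L P) {a b : M}
    (hinf : {x | (a < x ∧ x < b) ∧ P x}.Infinite) :
    ∃ a' b', a ≤ a' ∧ a' < b' ∧ b' ≤ b ∧ ∀ x, a' < x → x < b' → P x := by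
  have hd : Def1 L (fun x => (a < x ∧ x < b) ∧ P x) := by
    unfold Def1; simp (maxDischargeDepth := 9) [hP.app]
  obtain ⟨a', b', h1, h2⟩ := hd.exists_Ioo hinf
  refine ⟨a', b', ?_, h1, ?_, fun x h3 h4 => (h2 x h3 h4).2⟩
  · by_contra! hlt
    obtain ⟨x, hx1, hx2⟩ := exists_between (lt_min h1 hlt)
    exact lt_asymm (h2 x hx1 (hx2.trans_le (min_le_left _ _))).1.1
      (hx2.trans_le (min_le_right _ _))
  · by_contra! hlt
    obtain ⟨x, hx1, hx2⟩ := exists_between (max_lt h1 hlt)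
    exact lt_asymm (h2 x ((le_max_left _ _).trans_lt hx1) hx2).1.2
      ((le_max_right _ _).trans_lt hx1)

/-- A definable predicate is decided on some subinterval of any interval. -/
theorem Def1.decide {P : M → Prop} (hP : Def1 L P) {a b : M} (hab : a < b) :
    ∃ a' b', a ≤ a' ∧ a' < b' ∧ b' ≤ b ∧
      ((∀ x, a' < x → x < b' → P x) ∨ (∀ x, a' < x → x < b' → ¬ P x)) := by
  by_cases hinf : {x | (a < x ∧ x < b) ∧ P x}.Infinite
  · obtain ⟨a', b', h1, h2, h3, h4⟩ := hP.exists_subinterval hinf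
    exact ⟨a', b', h1, h2, h3, .inl h4⟩
  · have : {x | (a < x ∧ x < b) ∧ ¬ P x}.Infinite := by
      intro hfin
      refine Ioo_infinite hab (((not_infinite.1 hinf).union hfin).subset fun x hx => ?_)
      by_cases h : P x
      · exact .inl ⟨hx, h⟩
      · exact .inr ⟨hx, h⟩
    have hP' : Def1 L (fun x => ¬ P x) := by unfold Def1; simp [hP.app]
    obtain ⟨a', b', h1, h2, h3, h4⟩ := hP'.exists_subinterval this
    exact ⟨a', b', h1, h2, h3, .inr h4⟩

/-- A nonempty bounded definable subset of `M` has a supremum. -/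
theorem Def1.exists_isLUB {P : M → Prop} (hP : Def1 L P) (hne : ∃ x, P x)
    (hbdd : ∃ c, ∀ x, P x → x ≤ c) : ∃ s, IsLUB {x | P x} s := by
  obtain ⟨S, hS, hI, hU⟩ := hM.out.finite_union {x | P x} hP
  have key : ∀ T : Set (Set M), T.Finite → (∀ I ∈ T, IsPointOrInterval I) →
      (⋃₀ T).Nonempty → BddAbove (⋃₀ T) → ∃ s, IsLUB (⋃₀ T) s := by
    intro T hT
    induction T, hT using Set.Finite.induction_on with
    | empty => intro _ h; simp at h
    | @insert I T _ _ ih =>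
      intro hI hne hbdd
      rw [sUnion_insert] at hne hbdd ⊢
      have h1 : I.Nonempty → ∃ s, IsLUB I s := by
        rintro ⟨x, hx⟩
        obtain ⟨c, hc⟩ := hbdd.mono subset_union_left
        rcases hI I (mem_insert _ _) with ⟨a, rfl⟩ | ⟨a, b, rfl⟩ | ⟨a, rfl⟩ | ⟨b, rfl⟩ | rfl
        · exact ⟨a, isLUB_singleton⟩
        · exact ⟨b, isLUB_Ioo (hx.1.trans hx.2)⟩
        · obtain ⟨d, hd⟩ := exists_gt (max c a)
          exact absurd (hc ((le_max_right c a).trans_lt hd)) ((le_max_left c a).trans_lt hd).not_ge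
        · exact ⟨b, isLUB_Iio⟩
        · obtain ⟨d, hd⟩ := exists_gt c
          exact absurd (hc (mem_univ d)) hd.not_ge
      have h2 : (⋃₀ T).Nonempty → ∃ s, IsLUB (⋃₀ T) s := fun h =>
        ih (fun J hJ => hI J (mem_insert_of_mem _ hJ)) h (hbdd.mono subset_union_right)
      rcases I.eq_empty_or_nonempty with rfl | hIne
      · rw [empty_union] at hne ⊢; exact h2 hne
      · rcases (⋃₀ T).eq_empty_or_nonempty with h0 | hTne
        · rw [h0, union_empty]; exact h1 hIne
        · obtain ⟨s, hs⟩ := h1 hIne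
          obtain ⟨t, ht⟩ := h2 hTne
          exact ⟨_, hs.union ht⟩
  rw [hU]
  obtain ⟨x, hx⟩ := hne
  obtain ⟨c, hc⟩ := hbdd
  exact key S hS hI (hU ▸ ⟨x, hx⟩) (hU ▸ ⟨c, fun y hy => hc y hy⟩)

theorem Def1.exists_isGLB {P : M → Prop} (hP : Def1 L P) (hne : ∃ x, P x)
    (hbdd : ∃ c, ∀ x, P x → c ≤ x) : ∃ s, IsGLB {x | P x} s := by
  have hd : Def1 L (fun c => ∀ x, P x → c ≤ x) := by
    unfold Def1; simp (maxDischargeDepth := 9) [hP.app]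
  obtain ⟨x, hx⟩ := hne
  obtain ⟨s, hs⟩ := hd.exists_isLUB hbdd ⟨x, fun c hc => hc x hx⟩
  exact ⟨s, isLUB_lowerBounds.1 hs⟩

variable [TopologicalSpace M] [OrderTopology M]

/-- The filter of right (`s = true`) or left (`s = false`) punctured neighbourhoods of `z`,
the germ of `M` at `z` on the side `s`. -/
def sd (s : Bool) (z : M) : Filter M := if s then 𝓝[>] z else 𝓝[<] z

theorem mem_sd_true {z : M} {A : Set M} :
    A ∈ sd true z ↔ ∃ b, z < b ∧ ∀ x, z < x → x < b → x ∈ A := by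
  obtain ⟨c, hc⟩ := exists_gt z
  simp only [sd, if_true, mem_nhdsGT_iff_exists_Ioo_subset' hc]
  exact ⟨fun ⟨b, h1, h2⟩ => ⟨b, h1, fun x h3 h4 => h2 ⟨h3, h4⟩⟩,
    fun ⟨b, h1, h2⟩ => ⟨b, h1, fun x h3 => h2 x h3.1 h3.2⟩⟩

theorem mem_sd_false {z : M} {A : Set M} :
    A ∈ sd false z ↔ ∃ a, a < z ∧ ∀ x, a < x → x < z → x ∈ A := by
  obtain ⟨c, hc⟩ := exists_lt z
  simp only [sd, Bool.false_eq_true, if_false, mem_nhdsLT_iff_exists_Ioo_subset' hc]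
  exact ⟨fun ⟨b, h1, h2⟩ => ⟨b, h1, fun x h3 h4 => h2 ⟨h3, h4⟩⟩,
    fun ⟨b, h1, h2⟩ => ⟨b, h1, fun x h3 => h2 x h3.1 h3.2⟩⟩

end basic

/-! ### Germs and definable compactness -/

section germs

variable {L : FirstOrder.Language} {M : Type*} [L.Structure M] [AddGroup M] [LinearOrder M]
  [hM : Fact (IsOMinimalExpansion L M)]
variable [DenselyOrdered M] [NoMaxOrder M] [NoMinOrder M] [TopologicalSpace M] [OrderTopology M]

theorem mem_nhds_iff_Ioo {z : M} {A : Set M} :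
    A ∈ 𝓝 z ↔ ∃ a b, a < z ∧ z < b ∧ ∀ x, a < x → x < b → x ∈ A := by
  rw [mem_nhds_iff_exists_Ioo_subset]
  exact ⟨fun ⟨a, b, h, h'⟩ => ⟨a, b, h.1, h.2, fun x h1 h2 => h' ⟨h1, h2⟩⟩,
    fun ⟨a, b, h1, h2, h'⟩ => ⟨a, b, ⟨h1, h2⟩, fun x hx => h' x hx.1 hx.2⟩⟩

instance sd_neBot (s : Bool) (z : M) : (sd s z).NeBot := by
  cases s
  · exact inferInstanceAs (𝓝[<] z).NeBot
  · exact inferInstanceAs (𝓝[>] z).NeBot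

theorem sd_le_nhds (s : Bool) (z : M) : sd s z ≤ 𝓝 z := by
  cases s <;> exact inf_le_left

theorem sd_ne (s : Bool) (z : M) : ∀ᶠ x in sd s z, x ≠ z := by
  cases s
  · exact (eventually_mem_nhdsWithin : ∀ᶠ x in 𝓝[<] z, x ∈ Iio z).mono fun x hx => ne_of_lt hx
  · exact (eventually_mem_nhdsWithin : ∀ᶠ x in 𝓝[>] z, x ∈ Ioi z).mono fun x hx => ne_of_gt hx

theorem eventually_nhds_of_sd {P : M → Prop} {z : M} (h0 : P z)
    (h : ∀ s, ∀ᶠ x in sd s z, P x) : ∀ᶠ x in 𝓝 z, P x := by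
  obtain ⟨b, hb, hb'⟩ := mem_sd_true.1 (h true)
  obtain ⟨a, ha, ha'⟩ := mem_sd_false.1 (h false)
  refine mem_nhds_iff_Ioo.2 ⟨a, b, ha, hb, fun x h1 h2 => ?_⟩
  rcases lt_trichotomy x z with h | rfl | h
  · exact ha' x h1 h
  · exact h0
  · exact hb' x h h2

/-- What holds along a germ holds near every point of the germ. -/
theorem sd_eventually_nhds {P : M → Prop} {s : Bool} {z : M} (h : ∀ᶠ x in sd s z, P x) :
    ∀ᶠ x in sd s z, ∀ᶠ y in 𝓝 x, P y := by
  cases s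
  · obtain ⟨a, ha, ha'⟩ := mem_sd_false.1 h
    exact mem_sd_false.2 ⟨a, ha, fun x h1 h2 => mem_nhds_iff_Ioo.2 ⟨a, z, h1, h2, ha'⟩⟩
  · obtain ⟨a, ha, ha'⟩ := mem_sd_true.1 h
    exact mem_sd_true.2 ⟨a, ha, fun x h1 h2 => mem_nhds_iff_Ioo.2 ⟨z, a, h1, h2, ha'⟩⟩

@[simp] theorem Dfp.sd {α : Type*} [Finite α] {P : (α → M) → M → Prop} {t : (α → M) → M}
    {s : Bool}
    (h : Dfp L (fun w : Option α → M => P (fun i => w (some i)) (w none))) (ht : DF L t) :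
    Dfp L (fun v => ∀ᶠ x in sd s (t v), P v x) := by
  have ht' : DF L (fun w : Option α → M => t (fun i => w (some i))) := DF.subst ht (by simp)
  have ht'' : DF L (fun w : Option (Option α) → M => t (fun i => w (some (some i)))) :=
    DF.subst ht (by simp)
  have h'' : Dfp L (fun w : Option (Option α) → M => P (fun i => w (some (some i))) (w none)) :=
    Dfp.subst (t := fun o : Option α => o.elim (fun w : Option (Option α) → M => w none)
      fun i w => w (some (some i))) h (by rintro (_ | _) <;> simp)
  cases s
  · refine Dfp.congr (P := fun v => ∃ a, a < t v ∧ ∀ x, a < x → x < t v → P v x) ?_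
      fun v => mem_sd_false
    exact .ex (.and (.lt (.var _) ht') (.all (.imp (.lt (.var _) (.var _))
      (.imp (.lt (.var _) ht'') h''))))
  · refine Dfp.congr (P := fun v => ∃ a, t v < a ∧ ∀ x, t v < x → x < a → P v x) ?_
      fun v => mem_sd_true
    exact .ex (.and (.lt ht' (.var _)) (.all (.imp (.lt ht'' (.var _))
      (.imp (.lt (.var _) (.var _)) h''))))

@[simp] theorem Dfp.nhds {α : Type*} [Finite α] {P : (α → M) → M → Prop} {t : (α → M) → M}
    (h : Dfp L (fun w : Option α → M => P (fun i => w (some i)) (w none))) (ht : DF L t) :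
    Dfp L (fun v => ∀ᶠ x in 𝓝 (t v), P v x) := by
  have hP : Dfp L (fun v => P v (t v)) :=
    Dfp.subst (t := fun o : Option α => o.elim t fun i w => w i) h (by rintro (_ | _) <;> simp [ht])
  refine ((hP.and (Dfp.sd (s := true) h ht)).and (Dfp.sd (s := false) h ht)).congr fun v => ?_
  refine ⟨fun h => ⟨⟨h.self_of_nhds, sd_le_nhds _ _ h⟩, sd_le_nhds _ _ h⟩, fun h => ?_⟩
  exact eventually_nhds_of_sd h.1.1 fun s => by cases s; exacts [h.2, h.1.2]

/-- A definable condition holds, or fails, all along a germ. -/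
theorem Def1.sd_or {P : M → Prop} (hP : Def1 L P) (s : Bool) (z : M) :
    (∀ᶠ x in sd s z, P x) ∨ ∀ᶠ x in sd s z, ¬ P x := by
  have hgt : ∀ a, (∀ᶠ x in sd s z, a < x) ∨ ∀ᶠ x in sd s z, ¬ a < x := by
    intro a
    cases s
    · rcases lt_or_ge a z with h | h
      · exact .inl (mem_sd_false.2 ⟨a, h, fun x h1 _ => h1⟩)
      · obtain ⟨c, hc⟩ := exists_lt z
        exact .inr (mem_sd_false.2 ⟨c, hc, fun x _ h2 => (h2.trans_le h).not_gt⟩)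
    · rcases lt_or_ge z a with h | h
      · exact .inr (mem_sd_true.2 ⟨a, h, fun x _ h2 => h2.not_gt⟩)
      · obtain ⟨c, hc⟩ := exists_gt z
        exact .inl (mem_sd_true.2 ⟨c, hc, fun x h1 _ => h.trans_lt h1⟩)
  have hlt : ∀ a, (∀ᶠ x in sd s z, x < a) ∨ ∀ᶠ x in sd s z, ¬ x < a := by
    intro a
    cases s
    · rcases lt_or_ge a z with h | h
      · exact .inr (mem_sd_false.2 ⟨a, h, fun x h1 _ => h1.not_gt⟩)
      · obtain ⟨c, hc⟩ := exists_lt z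
        exact .inl (mem_sd_false.2 ⟨c, hc, fun x _ h2 => h2.trans_le h⟩)
    · rcases lt_or_ge z a with h | h
      · exact .inl (mem_sd_true.2 ⟨a, h, fun x _ h2 => h2⟩)
      · obtain ⟨c, hc⟩ := exists_gt z
        exact .inr (mem_sd_true.2 ⟨c, hc, fun x h1 _ => (h.trans_lt h1).not_gt⟩)
  have hI : ∀ I : Set M, IsPointOrInterval I →
      (∀ᶠ x in sd s z, x ∈ I) ∨ ∀ᶠ x in sd s z, x ∉ I := by
    rintro I (⟨a, rfl⟩ | ⟨a, b, rfl⟩ | ⟨a, rfl⟩ | ⟨b, rfl⟩ | rfl)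
    · rcases hgt a with h | h
      · exact .inr (h.mono fun x hx => ne_of_gt hx)
      · rcases hlt a with h' | h'
        · exact .inr (h'.mono fun x hx => ne_of_lt hx)
        · exact .inl ((h.and h').mono fun x hx => le_antisymm (not_lt.1 hx.1) (not_lt.1 hx.2))
    · rcases hgt a with h | h
      · rcases hlt b with h' | h'
        · exact .inl (h.and h')
        · exact .inr (h'.mono fun x hx hx' => hx hx'.2)
      · exact .inr (h.mono fun x hx hx' => hx hx'.1)
    · exact hgt a
    · exact hlt b
    · exact .inl (Eventually.of_forall fun _ => trivial)
  obtain ⟨S, hS, hSI, hU⟩ := hM.out.finite_union {x | P x} hP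
  by_cases h : ∃ I ∈ S, ∀ᶠ x in sd s z, x ∈ I
  · obtain ⟨I, hIS, h⟩ := h
    refine .inl (h.mono fun x hx => ?_)
    have : x ∈ {x | P x} := hU ▸ ⟨I, hIS, hx⟩
    exact this
  · have h' : ∀ I ∈ S, ∀ᶠ x in sd s z, x ∉ I := fun I hIS =>
      (hI I (hSI I hIS)).resolve_left fun hh => h ⟨I, hIS, hh⟩
    refine .inr (((eventually_all_finite hS).2 h').mono fun x hx hPx => ?_)
    have : x ∈ ⋃₀ S := hU ▸ hPx
    obtain ⟨I, hIS, hxI⟩ := this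
    exact hx I hIS hxI

theorem Def1.sd_of_frequently {P : M → Prop} (hP : Def1 L P) {s : Bool} {z : M}
    (h : ∃ᶠ x in sd s z, P x) : ∀ᶠ x in sd s z, P x :=
  (hP.sd_or s z).resolve_right h

theorem Def1.of_frequently_nhds {P : M → Prop} (hP : Def1 L P) {z : M}
    (h : ∃ᶠ x in 𝓝 z, P x) : P z ∨ ∃ s, ∀ᶠ x in sd s z, P x := by
  by_contra hc
  rw [not_or, not_exists] at hc
  refine h (eventually_nhds_of_sd (P := fun x => ¬ P x) hc.1 fun s => ?_)
  exact (hP.sd_or s z).resolve_left (hc.2 s)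

/-- Intervals are definably connected. -/
theorem Def1.connected {P : M → Prop} (hP : Def1 L P) {x y : M} (hxy : x ≤ y)
    (h1 : ∀ z, x ≤ z → z ≤ y → P z → ∀ᶠ w in 𝓝 z, P w)
    (h2 : ∀ z, x ≤ z → z ≤ y → ¬ P z → ∀ᶠ w in 𝓝 z, ¬ P w) (hx : P x) : P y := by
  have hS : Def1 L (fun z => (x ≤ z ∧ z ≤ y) ∧ ∀ w, x ≤ w → w ≤ z → P w) := by
    unfold Def1; simp (maxDischargeDepth := 9) [hP.app]
  obtain ⟨s, hs⟩ := hS.exists_isLUB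
    ⟨x, ⟨le_rfl, hxy⟩, fun w h h' => by rwa [le_antisymm h' h]⟩ ⟨y, fun z hz => hz.1.2⟩
  have hxs : x ≤ s := hs.1 ⟨⟨le_rfl, hxy⟩, fun w h h' => by rwa [le_antisymm h' h]⟩
  have hsy : s ≤ y := hs.2 fun z hz => hz.1.2
  have hlt : ∀ w, x ≤ w → w < s → P w := by
    intro w hw hws
    obtain ⟨z, hz, hwz, _⟩ := hs.exists_between hws
    exact hz.2 w hw hwz.le
  have hPs : P s := by
    by_contra hn
    obtain ⟨a, b, ha, hb, hab⟩ := mem_nhds_iff_Ioo.1 (h2 s hxs hsy hn)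
    rcases hxs.eq_or_lt with rfl | hlt'
    · exact hn hx
    · obtain ⟨w, hw, hw'⟩ := exists_between (max_lt ha hlt')
      exact hab w ((le_max_left _ _).trans_lt hw) (hw'.trans hb)
        (hlt w ((le_max_right _ _).trans hw.le) hw')
  rcases hsy.eq_or_lt with rfl | hlt'
  · exact hPs
  · obtain ⟨a, b, ha, hb, hab⟩ := mem_nhds_iff_Ioo.1 (h1 s hxs hsy hPs)
    obtain ⟨w, hw, hw'⟩ := exists_between (lt_min hb hlt')
    refine absurd (show w ≤ s from hs.1 ⟨⟨hxs.trans hw.le, hw'.le.trans (min_le_right _ _)⟩,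
      fun u hu hu' => ?_⟩) hw.not_ge
    rcases lt_or_ge u s with h | h
    · exact hlt u hu h
    · exact hab u (ha.trans_le h) (hu'.trans_lt (hw'.trans_le (min_le_left _ _)))

/-- Definable compactness of closed bounded intervals, for definable downward directed families:
either some point lies in all members, or some germ lies in all of them. -/
theorem exists_cluster {β : Type*} [Finite β] {Λ : (β → M) → Prop} {S : (β → M) → M → Prop}
    (hΛ : Dfp L Λ) (hS : Dfp L (fun w : Option β → M => S (fun i => w (some i)) (w none)))
    {lo hi : M} (hb : ∀ b, Λ b → ∀ x, S b x → lo ≤ x ∧ x ≤ hi) (hne : ∃ b, Λ b)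
    (hne' : ∀ b, Λ b → ∃ x, S b x)
    (hdir : ∀ b b', Λ b → Λ b' → ∃ b'', Λ b'' ∧ ∀ x, S b'' x → S b x ∧ S b' x) :
    ∃ z, lo ≤ z ∧ z ≤ hi ∧ ((∀ b, Λ b → S b z) ∨ ∃ s, ∀ b, Λ b → ∀ᶠ x in sd s z, S b x) := by
  have hS1 : ∀ b, Def1 L (S b) := fun b =>
    Dfp.subst (t := fun o : Option β => o.elim (fun w : Fin 1 → M => w 0) fun i _ => b i) hS
      (by rintro (_ | _) <;> simp)
  -- the supremum of the numbers lying below some member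
  have hI : Def1 L (fun c => ∃ b, Λ b ∧ ∀ x, S b x → c ≤ x) := by
    refine Dfp.exTuple (.and ?_ (.all (.imp ?_ (by simp))))
    · exact Dfp.subst hΛ (by simp)
    · exact Dfp.subst (t := fun o : Option β => o.elim (fun w : Option (Fin 1 ⊕ β) → M => w none)
        fun i w => w (some (.inr i))) hS (by rintro (_ | _) <;> simp)
  obtain ⟨z, hz⟩ := hI.exists_isLUB
    (hne.imp' (fun _ => lo) fun b h => ⟨b, h, fun x hx => (hb b h x hx).1⟩)
    ⟨hi, fun c ⟨b, h, hc⟩ => by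
      obtain ⟨x, hx⟩ := hne' b h
      exact (hc x hx).trans (hb b h x hx).2⟩
  -- every member has points arbitrarily close to this supremum
  have hfreq : ∀ b, Λ b → ∃ᶠ x in 𝓝 z, S b x := by
    intro b h
    rw [frequently_iff]
    intro U hU
    obtain ⟨p, q, hp, hq, hpq⟩ := mem_nhds_iff_Ioo.1 hU
    obtain ⟨c, ⟨b', h', hc⟩, hpc, _⟩ := hz.exists_between hp
    obtain ⟨b'', h'', hsub⟩ := hdir b b' h h'
    -- otherwise `q` would lie below the refined member
    by_contra! hno
    refine absurd (show q ≤ z from hz.1 ⟨b'', h'', fun x hx => ?_⟩) hq.not_ge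
    by_contra! hxq
    exact hno x (hpq x (hpc.trans_le (hc x (hsub x hx).2)) hxq) (hsub x hx).1
  obtain ⟨b0, h0⟩ := hne
  have hlo : lo ≤ z := hz.1 ⟨b0, h0, fun x hx => (hb b0 h0 x hx).1⟩
  have hhi : z ≤ hi := hz.2 fun c ⟨b, h, hc⟩ => by
      obtain ⟨x, hx⟩ := hne' b h
      exact (hc x hx).trans (hb b h x hx).2
  refine ⟨z, hlo, hhi, ?_⟩
  by_contra hc
  simp only [not_or, not_exists, not_forall] at hc
  obtain ⟨⟨b1, h1, hn1⟩, hc⟩ := hc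
  obtain ⟨b2, h2, hn2⟩ := hc true
  obtain ⟨b3, h3, hn3⟩ := hc false
  obtain ⟨b4, h4, hs4⟩ := hdir b1 b2 h1 h2
  obtain ⟨b5, h5, hs5⟩ := hdir b4 b3 h4 h3
  rcases (hS1 b5).of_frequently_nhds (hfreq b5 h5) with h | ⟨s, h⟩
  · exact hn1 (hs4 _ (hs5 _ h).1).1
  · cases s
    · exact hn3 (h.mono fun x hx => (hs5 x hx).2)
    · exact hn2 (h.mono fun x hx => (hs4 x (hs5 x hx).1).2)

end germs

/-! ### The ordered group is dense, commutative and divisible -/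

section group

variable {L : FirstOrder.Language} {M : Type*} [L.Structure M] [AddGroup M] [LinearOrder M]
  [AddLeftMono M] [AddRightMono M] [hM : Fact (IsOMinimalExpansion L M)]

theorem noMaxOrder_of_nontrivial [Nontrivial M] : NoMaxOrder M := by
  obtain ⟨c, hc⟩ : ∃ c : M, 0 < c := by
    obtain ⟨c, hc⟩ := exists_ne (0 : M)
    rcases hc.lt_or_gt with h | h
    · exact ⟨-c, by simpa using h⟩
    · exact ⟨c, h⟩
  exact ⟨fun a => ⟨a + c, by simpa using hc⟩⟩

theorem noMinOrder_of_nontrivial [Nontrivial M] : NoMinOrder M := by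
  have := noMaxOrder_of_nontrivial (M := M)
  obtain ⟨c, hc⟩ := exists_gt (0 : M)
  exact ⟨fun a => ⟨a - c, by simpa using hc⟩⟩

variable (L) in
include hM in
/-- If `c` were the least positive element, an interval of even elements could not contain two
consecutive ones. -/
theorem denselyOrdered_of_ominimal [Nontrivial M] : DenselyOrdered M := by
  have := noMaxOrder_of_nontrivial (M := M)
  have := noMinOrder_of_nontrivial (M := M)
  by_contra hnd
  obtain ⟨a, b, hab, hno⟩ : ∃ a b : M, a < b ∧ ∀ x, a < x → b ≤ x := by
    by_contra! h
    exact hnd ⟨fun a b hab => (h a b hab).imp fun _ h => h⟩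
  set c := -a + b with hc
  have hc0 : 0 < c := by simpa [hc, lt_neg_add_iff_add_lt] using hab
  have hmin : ∀ x y : M, x < y → x + c ≤ y := by
    intro x y hxy
    have h1 : a < a + (-x + y) := by simpa [lt_neg_add_iff_add_lt] using hxy
    have h2 := hno _ h1
    have h3 : c ≤ -x + y := by rw [hc]; exact neg_add_le_iff_le_add.2 h2
    exact le_neg_add_iff_add_le.1 h3
  have hD : Def1 L (fun x : M => ∃ y, x = y + y) := by unfold Def1; simp (maxDischargeDepth := 9)
  -- `x ↦ x + c` is the successor function, and there are infinitely many even elements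
  have hmono : StrictMono (fun y : M => y + y) := fun x y h => add_lt_add h h
  have hinf : {x : M | ∃ y, x = y + y}.Infinite := by
    refine (infinite_range_of_injective hmono.injective).mono ?_
    rintro _ ⟨y, rfl⟩
    exact ⟨y, rfl⟩
  obtain ⟨S, hS, hSI, hU⟩ := hM.out.finite_union {x : M | ∃ y, x = y + y} hD
  obtain ⟨I, hIS, hIinf⟩ : ∃ I ∈ S, I.Infinite := by
    by_contra! h
    exact hinf (hU ▸ hS.sUnion fun I hI => h I hI)
  have hsub : ∀ x ∈ I, ∃ y, x = y + y := fun x hx => by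
    have : x ∈ {x : M | ∃ y, x = y + y} := hU ▸ ⟨I, hIS, hx⟩
    exact this
  have hconv : I.OrdConnected := by
    rcases hSI I hIS with ⟨a, rfl⟩ | ⟨a, b, rfl⟩ | ⟨a, rfl⟩ | ⟨b, rfl⟩ | rfl
    exacts [ordConnected_singleton, ordConnected_Ioo, ordConnected_Ioi, ordConnected_Iio,
      ordConnected_univ]
  obtain ⟨x, hx, x', hx', hne⟩ := hIinf.nontrivial
  wlog hlt : x < x' generalizing x x'
  · exact this x' hx' x hx hne.symm (lt_of_le_of_ne (not_lt.1 hlt) hne.symm)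
  have hxc : x + c ∈ I := hconv.out hx hx' ⟨by simpa using hc0.le, hmin x x' hlt⟩
  obtain ⟨y, rfl⟩ := hsub x hx
  obtain ⟨z, hz⟩ := hsub _ hxc
  have hyz : y < z := by
    by_contra! h
    have := add_le_add h h
    rw [← hz] at this
    exact absurd this (by simpa using hc0)
  have h1 := add_le_add (hmin y z hyz) (hmin y z hyz)
  rw [← hz] at h1
  have h2 : y + y < y + (c + y) := by simpa using hc0
  have h3 : y + y + c < y + c + (y + c) := by
    simpa [add_assoc] using add_lt_add_left h2 c
  exact absurd h1 h3.not_ge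

variable [DenselyOrdered M] [Nontrivial M]

/-- A nontrivial definable subgroup is open, hence everything. -/
theorem definable_subgroup_eq_top {H : AddSubgroup M} (hH : Def1 L (· ∈ H)) {c : M} (hc : c ∈ H)
    (hc0 : c ≠ 0) (x : M) : x ∈ H := by
  have := noMaxOrder_of_nontrivial (M := M)
  have := noMinOrder_of_nontrivial (M := M)
  let _ : TopologicalSpace M := Preorder.topology M
  have : OrderTopology M := ⟨rfl⟩
  have hinf : {x | x ∈ H}.Infinite := by
    have : ∀ d ∈ H, 0 < d → {x | x ∈ H}.Infinite := fun d hd hd0 => by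
      have hm : StrictMono (fun n : ℕ => n • d) := nsmul_left_strictMono hd0
      refine (infinite_range_of_injective hm.injective).mono ?_
      rintro _ ⟨n, rfl⟩
      exact H.nsmul_mem hd n
    rcases hc0.lt_or_gt with h | h
    · exact this _ (H.neg_mem hc) (by simpa using h)
    · exact this _ hc h
  obtain ⟨a, b, hab, hsub⟩ := hH.exists_Ioo hinf
  obtain ⟨u, hau, hub⟩ := exists_between hab
  have hnhds : ∀ z, ∀ᶠ w in 𝓝 z, w - z ∈ H := by
    intro z
    refine mem_nhds_iff_Ioo.2 ⟨a - u + z, b - u + z, ?_, ?_, fun w h1 h2 => ?_⟩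
    · simpa using hau
    · simpa using hub
    · have : w - z + u ∈ H := by
        refine hsub _ ?_ ?_
        · rwa [← sub_lt_iff_lt_add, lt_sub_iff_add_lt]
        · rwa [← lt_sub_iff_add_lt, sub_lt_iff_lt_add]
      simpa using H.sub_mem this (hsub u hau hub)
  have h1 : ∀ z, z ∈ H → ∀ᶠ w in 𝓝 z, w ∈ H := fun z hz =>
    (hnhds z).mono fun w hw => by simpa using H.add_mem hw hz
  have h2 : ∀ z, z ∉ H → ∀ᶠ w in 𝓝 z, w ∉ H := fun z hz =>
    (hnhds z).mono fun w hw hw' => hz (by simpa using H.add_mem (H.neg_mem hw) hw')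
  have hpos : ∀ x, 0 ≤ x → x ∈ H := fun x hx =>
    hH.connected hx (fun z _ _ => h1 z) (fun z _ _ => h2 z) H.zero_mem
  rcases le_total 0 x with h | h
  · exact hpos x h
  · simpa using H.neg_mem (hpos (-x) (by simpa using h))

variable (L) in
include hM in
/-- The centralizer of an element is a definable subgroup. -/
theorem add_comm_of_ominimal (x y : M) : x + y = y + x := by
  rcases eq_or_ne x 0 with rfl | hx
  · simp
  have hd : Def1 L (· ∈ AddSubgroup.centralizer {x}) := by
    refine Dfp.congr (P := fun v : Fin 1 → M => x + v 0 = v 0 + x) (by simp) fun v => ?_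
    simp [AddSubgroup.mem_centralizer_iff]
  have := definable_subgroup_eq_top hd (c := x) (by simp [AddSubgroup.mem_centralizer_iff]) hx y
  simpa [AddSubgroup.mem_centralizer_iff] using this

end group

/-- The elements of the form `y + y` form a definable subgroup. -/
theorem exists_add_self_eq (L : FirstOrder.Language) {M : Type*} [L.Structure M] [AddCommGroup M]
    [LinearOrder M] [IsOrderedAddMonoid M] [hM : Fact (IsOMinimalExpansion L M)]
    [DenselyOrdered M] [Nontrivial M] (x : M) : ∃ y, y + y = x := by
  have hd : Def1 L (· ∈ (nsmulAddMonoidHom (α := M) 2).range) := by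
    refine Dfp.congr (P := fun v : Fin 1 → M => ∃ y, y + y = v 0)
      (by simp (maxDischargeDepth := 9)) fun v => ?_
    simp [two_nsmul]
  obtain ⟨c, hc⟩ := exists_ne (0 : M)
  have := definable_subgroup_eq_top hd (c := c + c) ⟨c, by simp [two_nsmul]⟩
    (by
      rcases hc.lt_or_gt with h | h
      · exact (add_neg h h).ne
      · exact (add_pos h h).ne') x
  obtain ⟨y, hy⟩ := this
  exact ⟨y, by simpa [two_nsmul] using hy⟩

/-! ### Monotonicity and continuity of definable functions -/

section monotone

variable {L : FirstOrder.Language} {M : Type*} [L.Structure M] [AddCommGroup M] [LinearOrder M]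
  [IsOrderedAddMonoid M] [hM : Fact (IsOMinimalExpansion L M)] [DenselyOrdered M] [Nontrivial M]
  [TopologicalSpace M] [OrderTopology M]

theorem exists_add_self_le {ε : M} (hε : 0 < ε) : ∃ η, 0 < η ∧ η + η ≤ ε := by
  obtain ⟨δ, h0, h1⟩ := exists_between hε
  refine ⟨min δ (ε - δ), lt_min h0 (sub_pos.2 h1), ?_⟩
  calc min δ (ε - δ) + min δ (ε - δ) ≤ δ + (ε - δ) :=
        add_le_add (min_le_left _ _) (min_le_right _ _)
    _ = ε := by abel

/-- A definable family of positive radii is bounded below by a positive constant on some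
subinterval. Otherwise only finitely many points have radius at least `ε`, for every `ε > 0`,
which is impossible: the set of all radii would be infinite, hence contain an interval `(p, q)`,
and infinitely many points would have radius greater than a point of it. -/
theorem uniform_radius {R : M → M → Prop} (hR : Def2 L R)
    (hmono : ∀ x ε ε', 0 < ε' → ε' ≤ ε → R x ε → R x ε') {a b : M} (hab : a < b)
    (h : ∀ x, a < x → x < b → ∃ ε, 0 < ε ∧ R x ε) :
    ∃ a' b' ε, a ≤ a' ∧ a' < b' ∧ b' ≤ b ∧ 0 < ε ∧ b' ≤ a' + ε ∧
      ∀ x, a' < x → x < b' → R x ε := by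
  have hRε : ∀ ε, Def1 L (fun x => R x ε) := fun ε => by unfold Def1; simp [hR.app]
  suffices hex : ∃ ε, 0 < ε ∧ {x | (a < x ∧ x < b) ∧ R x ε}.Infinite by
    obtain ⟨ε, hε, hinf⟩ := hex
    obtain ⟨a', b', h1, h2, h3, h4⟩ := (hRε ε).exists_subinterval hinf
    refine ⟨a', min b' (a' + ε), ε, h1, lt_min h2 (by simpa using hε),
      (min_le_left _ _).trans h3, hε, min_le_right _ _, fun x h5 h6 => ?_⟩
    exact h4 x h5 (h6.trans_le (min_le_left _ _))
  by_contra! hfin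
  -- `Q x y` says that `y` is the supremum of the radii at `x`
  let Q : M → M → Prop := fun x y => (a < x ∧ x < b) ∧ 0 < y ∧ (∀ ε, 0 < ε → ε < y → R x ε) ∧
    ∀ ε, y < ε → ¬ R x ε
  have hQu : ∀ x y y', Q x y → Q x y' → y ≤ y' := by
    intro x y y' hy hy'
    by_contra! hlt
    obtain ⟨ε, h1, h2⟩ := exists_between hlt
    exact hy'.2.2.2 ε h1 (hy.2.2.1 ε (hy'.2.1.trans h1) h2)
  have hS : Def1 L (fun y => ∃ x, Q x y) := by
    unfold Def1; simp (maxDischargeDepth := 15) [Q, hR.app]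
  have hQex : ∀ x, a < x → x < b → (∀ ε, 0 < ε → R x ε) ∨ ∃ y, Q x y := by
    intro x hx1 hx2
    by_cases hall : ∀ ε, 0 < ε → R x ε
    · exact .inl hall
    push Not at hall
    obtain ⟨ε0, h0, hn⟩ := hall
    have hD : Def1 L (fun ε => 0 < ε ∧ R x ε) := by unfold Def1; simp [hR.app]
    have hub : ∀ ε, 0 < ε ∧ R x ε → ε ≤ ε0 := fun ε h => by
      by_contra! hlt
      exact hn (hmono x ε ε0 h0 hlt.le h.2)
    obtain ⟨y, hy⟩ := hD.exists_isLUB (h x hx1 hx2) ⟨ε0, hub⟩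
    refine .inr ⟨y, ⟨hx1, hx2⟩, ?_, fun ε h1 h2 => ?_, fun ε h1 h2 => ?_⟩
    · obtain ⟨ε, hε⟩ := h x hx1 hx2
      exact hε.1.trans_le (hy.1 hε)
    · obtain ⟨ε', h3, h4, _⟩ := hy.exists_between h2
      exact hmono x ε' ε h1 h4.le h3.2
    · have hy0 : 0 ≤ y := by
        obtain ⟨ε, hε⟩ := h x hx1 hx2
        exact hε.1.le.trans (hy.1 hε)
      exact absurd (hy.1 ⟨hy0.trans_lt h1, h2⟩) h1.not_ge
  by_cases hinf : {y | ∃ x, Q x y}.Infinite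
  · obtain ⟨p, q, hpq, hsub⟩ := hS.exists_Ioo hinf
    obtain ⟨p', h1, h2⟩ := exists_between hpq
    have hp' : 0 < p' := by
      obtain ⟨x, hx⟩ := hsub p' h1 h2
      exact hx.2.1
    choose! g hg using fun y (hy : y ∈ Ioo p' q) => hsub y (h1.trans hy.1) hy.2
    refine Ioo_infinite h2 (Finite.of_injOn (f := g) (fun y hy => ?_) ?_ (hfin p' hp'))
    · exact ⟨(hg y hy).1, (hg y hy).2.2.1 p' hp' hy.1⟩
    · intro y hy y' hy' heq
      have h3 := hg y hy
      have h4 := hg y' hy'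
      rw [← heq] at h4
      exact le_antisymm (hQu _ _ _ h3 h4) (hQu _ _ _ h4 h3)
  · obtain ⟨μ, hμ, hlow⟩ : ∃ μ, 0 < μ ∧ ∀ y, (∃ x, Q x y) → μ < y := by
      have hfin' := not_infinite.1 hinf
      by_cases hne : {y | ∃ x, Q x y}.Nonempty
      · obtain ⟨y0, hy0, hmin⟩ := hfin'.exists_minimal hne
        obtain ⟨x, hx⟩ := hy0
        obtain ⟨μ, h1, h2⟩ := exists_between hx.2.1
        refine ⟨μ, h1, fun y hy => h2.trans_le ?_⟩
        rcases le_total y0 y with h | h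
        · exact h
        · exact hmin hy h
      · obtain ⟨μ, hμ⟩ := exists_gt (0 : M)
        exact ⟨μ, hμ, fun y hy => absurd ⟨y, hy⟩ hne⟩
    refine Ioo_infinite hab ((hfin μ hμ).subset fun x hx => ⟨hx, ?_⟩)
    rcases hQex x hx.1 hx.2 with h | ⟨y, hy⟩
    · exact h μ hμ
    · exact hy.2.2.1 μ hμ (hlow y ⟨x, hy⟩)

/-- If each `x` is related to the points of its right germ, then on some subinterval each `x` is
related to all larger points. -/
theorem uniform_right {Q : M → M → Prop} (hQ : Def2 L Q) {a b : M} (hab : a < b)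
    (h : ∀ x, a < x → x < b → ∀ᶠ y in sd true x, Q x y) :
    ∃ a' b', a ≤ a' ∧ a' < b' ∧ b' ≤ b ∧ ∀ x y, a' < x → x < y → y < b' → Q x y := by
  obtain ⟨a', b', ε, h1, h2, h3, _, h5, h6⟩ := uniform_radius
    (R := fun x ε => ∀ y, x < y → y < x + ε → Q x y) (L := L)
    (by unfold Def2; simp (maxDischargeDepth := 9) [hQ.app])
    (fun x ε ε' _ hle hR y hy hy' => hR y hy (hy'.trans_le (by simpa using hle))) hab
    (fun x hx hx' => by
      obtain ⟨c, hc, hc'⟩ := mem_sd_true.1 (h x hx hx')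
      exact ⟨c - x, sub_pos.2 hc, fun y hy hy' => hc' y hy (by simpa using hy')⟩)
  exact ⟨a', b', h1, h2, h3, fun x y hx hxy hy => h6 x hx (hxy.trans hy) y hxy
    (hy.trans_le (h5.trans (by simpa using hx.le)))⟩

/-- A definable function is constant or strictly monotone on some subinterval. -/
theorem DF1.exists_strictMonoOn {f : M → M} (hf : DF1 L f) {a b : M} (hab : a < b) :
    ∃ a' b', a ≤ a' ∧ a' < b' ∧ b' ≤ b ∧ ((∃ c, ∀ x, a' < x → x < b' → f x = c) ∨
      StrictMonoOn f (Ioo a' b') ∨ StrictAntiOn f (Ioo a' b')) := by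
  by_cases hc : ∃ c, {x | (a < x ∧ x < b) ∧ f x = c}.Infinite
  · obtain ⟨c, hc⟩ := hc
    have hd : Def1 L (fun x => f x = c) := by unfold Def1; simp [hf.app]
    obtain ⟨a', b', h1, h2, h3, h4⟩ := hd.exists_subinterval hc
    exact ⟨a', b', h1, h2, h3, .inl ⟨c, h4⟩⟩
  push Not at hc
  -- infinitely many points are the least in their fibres, since the fibres are finite
  have hK : Def1 L (fun x => ∀ y, a < y → y < b → f y = f x → x ≤ y) := by
    unfold Def1; simp (maxDischargeDepth := 9) [hf.app]
  have hinf : {x | (a < x ∧ x < b) ∧ ∀ y, a < y → y < b → f y = f x → x ≤ y}.Infinite := by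
    intro hfin
    refine Ioo_infinite hab ((hfin.biUnion fun k _ => hc (f k)).subset fun x hx => ?_)
    obtain ⟨k, hk, hmin⟩ := (hc (f x)).exists_minimal ⟨x, hx, rfl⟩
    refine mem_biUnion (x := k) ⟨hk.1, fun y hy hy' hyx => ?_⟩ ⟨hx, hk.2.symm⟩
    rcases le_total k y with h | h
    · exact h
    · exact hmin ⟨⟨hy, hy'⟩, hyx.trans hk.2⟩ h
  obtain ⟨a1, b1, h1, h2, h3, h4⟩ := hK.exists_subinterval hinf
  have hinj : ∀ x y, a1 < x → x < b1 → a1 < y → y < b1 → f x = f y → x = y :=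
    fun x y hx hx' hy hy' hxy => le_antisymm
      (h4 x hx hx' y (h1.trans_lt hy) (hy'.trans_le h3) hxy.symm)
      (h4 y hy hy' x (h1.trans_lt hx) (hx'.trans_le h3) hxy)
  have hP : Def1 L (fun x => ∀ᶠ y in sd true x, f x < f y) := by
    unfold Def1; simp (maxDischargeDepth := 9) [hf.app]
  obtain ⟨a2, b2, h5, h6, h7, h8⟩ := hP.decide h2
  rcases h8 with h8 | h8
  · obtain ⟨a3, b3, h9, h10, h11, h12⟩ := uniform_right (Q := fun x y => f x < f y) (L := L)
      (by unfold Def2; simp [hf.app]) h6 h8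
    exact ⟨a3, b3, h1.trans (h5.trans h9), h10, (h11.trans h7).trans h3,
      .inr (.inl fun x hx y hy hxy => h12 x y hx.1 hxy hy.2)⟩
  · obtain ⟨a3, b3, h9, h10, h11, h12⟩ := uniform_right (Q := fun x y => f y < f x) (L := L)
      (by unfold Def2; simp [hf.app]) h6 (fun x hx hx' => by
        have hd : Def1 L (fun y => f x < f y) := by unfold Def1; simp [hf.app]
        have hnb : ∀ᶠ y in sd true x, x < y ∧ y < b2 :=
          mem_sd_true.2 ⟨b2, hx', fun y hy hy' => ⟨hy, hy'⟩⟩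
        filter_upwards [(hd.sd_or true x).resolve_left (h8 x hx hx'), hnb] with y hy hyb
        refine lt_of_le_of_ne (not_lt.1 hy) fun he => hyb.1.ne ?_
        exact hinj x y (h5.trans_lt hx) (hx'.trans_le h7) (h5.trans_lt (hx.trans hyb.1))
          (hyb.2.trans_le h7) he.symm)
    exact ⟨a3, b3, h1.trans (h5.trans h9), h10, (h11.trans h7).trans h3,
      .inr (.inr fun x hx y hy hxy => h12 x y hx.1 hxy hy.2)⟩

/-- A strictly monotone function whose image contains an interval is continuous at some point. -/
theorem DF1.exists_continuousAt {f : M → M} (hf : DF1 L f) {a b : M} (hab : a < b) :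
    ∃ x, a < x ∧ x < b ∧ ContinuousAt f x := by
  have himg : ∀ {f : M → M}, DF1 L f → ∀ {a b : M}, a < b → StrictMonoOn f (Ioo a b) →
      ∃ x, a < x ∧ x < b ∧ ContinuousAt f x := by
    intro f hf a b hab hmono
    have hd : Def1 L (fun y => ∃ x, (a < x ∧ x < b) ∧ f x = y) := by
      unfold Def1; simp (maxDischargeDepth := 9) [hf.app]
    have hinf : {y | ∃ x, (a < x ∧ x < b) ∧ f x = y}.Infinite :=
      (Ioo_infinite hab).image hmono.injOn
    obtain ⟨p, q, hpq, hsub⟩ := hd.exists_Ioo hinf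
    obtain ⟨y, hpy, hyq⟩ := exists_between hpq
    obtain ⟨x, hx, rfl⟩ := hsub y hpy hyq
    refine ⟨x, hx.1, hx.2, hmono.continuousAt_of_image_mem_nhds (Ioo_mem_nhds hx.1 hx.2) ?_⟩
    exact mem_of_superset (Ioo_mem_nhds hpy hyq) fun y hy => hsub y hy.1 hy.2
  obtain ⟨a', b', h1, h2, h3, h4⟩ := hf.exists_strictMonoOn hab
  have hout : (∃ x, a' < x ∧ x < b' ∧ ContinuousAt f x) → ∃ x, a < x ∧ x < b ∧ ContinuousAt f x :=
    fun ⟨x, hx, hx', hc⟩ => ⟨x, h1.trans_lt hx, hx'.trans_le h3, hc⟩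
  rcases h4 with ⟨c, hc⟩ | h4 | h4
  · obtain ⟨x, hx, hx'⟩ := exists_between h2
    refine hout ⟨x, hx, hx', ?_⟩
    refine continuousAt_const (y := c) |>.congr ?_
    exact mem_of_superset (Ioo_mem_nhds hx hx') fun y hy => (hc y hy.1 hy.2).symm
  · exact hout (himg hf h2 h4)
  · have hneg : DF1 L (fun x => - f x) := by unfold DF1; simp [hf.app]
    obtain ⟨x, hx, hx', hc⟩ := himg hneg h2 fun x hx y hy hxy => by simpa using h4 hx hy hxy
    exact hout ⟨x, hx, hx', hc.neg.congr (Eventually.of_forall fun y => neg_neg (f y))⟩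

/-- At `z` the function `f` is continuous and locally strictly monotone, increasing for
`r = false` and decreasing for `r = true`: it maps germs at `z` to germs at `f z`. -/
def StrictAt (f : M → M) (r : Bool) (z : M) : Prop :=
  ∀ t, Tendsto f (sd t z) (sd (t ^^ r) (f z))

theorem DF1.finite_not_continuousAt {f : M → M} (hf : DF1 L f) :
    {z | ¬ ContinuousAt f z}.Finite := by
  have hiff : ∀ z, ContinuousAt f z ↔
      ∀ p q, p < f z → f z < q → ∀ᶠ x in 𝓝 z, p < f x ∧ f x < q := by
    intro z
    refine ⟨fun h p q hp hq => h.eventually (Ioo_mem_nhds hp hq), fun h => ?_⟩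
    refine fun U hU => ?_
    obtain ⟨p, q, hp, hq, hpq⟩ := mem_nhds_iff_Ioo.1 hU
    exact (h p q hp hq).mono fun x hx => hpq _ hx.1 hx.2
  have hd : Def1 L (fun z => ¬ ContinuousAt f z) := by
    simp only [hiff]
    unfold Def1; simp (maxDischargeDepth := 15) [hf.app, -not_forall]
  refine hd.finite_of_forall fun a b hab => ?_
  obtain ⟨x, h1, h2, h3⟩ := hf.exists_continuousAt hab
  exact ⟨x, h1, h2, not_not.2 h3⟩

/-- Monotonicity theorem: away from finitely many points, a definable function is locally constant
or continuous and locally strictly monotone. -/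
theorem DF1.finite_not_strictAt {f : M → M} (hf : DF1 L f) :
    {z | ¬ ((∀ᶠ x in 𝓝 z, f x = f z) ∨ ∃ r, StrictAt f r z)}.Finite := by
  let A : M → Prop := fun z => (∀ᶠ x in 𝓝 z, f x = f z) ∨
    ((∀ᶠ x in sd true z, f z < f x) ∧ ∀ᶠ x in sd false z, f x < f z) ∨
    ((∀ᶠ x in sd true z, f x < f z) ∧ ∀ᶠ x in sd false z, f z < f x)
  have hd : Def1 L (fun z => ¬ A z) := by
    unfold Def1; simp (maxDischargeDepth := 15) [hf.app, A, -not_or, -not_and]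
  have hfin : {z | ¬ A z}.Finite := by
    refine hd.finite_of_forall fun a b hab => ?_
    obtain ⟨a', b', h1, h2, h3, h4⟩ := hf.exists_strictMonoOn hab
    obtain ⟨x, hx, hx'⟩ := exists_between h2
    refine ⟨x, h1.trans_lt hx, hx'.trans_le h3, not_not.2 ?_⟩
    have hr : ∀ᶠ y in sd true x, x < y ∧ y < b' := mem_sd_true.2 ⟨b', hx', fun y h h' => ⟨h, h'⟩⟩
    have hl : ∀ᶠ y in sd false x, a' < y ∧ y < x := mem_sd_false.2 ⟨a', hx, fun y h h' => ⟨h, h'⟩⟩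
    rcases h4 with ⟨c, hc⟩ | h4 | h4
    · refine .inl (mem_of_superset (Ioo_mem_nhds hx hx') fun y hy => ?_)
      exact (hc y hy.1 hy.2).trans (hc x hx hx').symm
    · exact .inr (.inl ⟨hr.mono fun y hy => h4 ⟨hx, hx'⟩ ⟨hx.trans hy.1, hy.2⟩ hy.1,
        hl.mono fun y hy => h4 ⟨hy.1, hy.2.trans hx'⟩ ⟨hx, hx'⟩ hy.2⟩)
    · exact .inr (.inr ⟨hr.mono fun y hy => h4 ⟨hx, hx'⟩ ⟨hx.trans hy.1, hy.2⟩ hy.1,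
        hl.mono fun y hy => h4 ⟨hy.1, hy.2.trans hx'⟩ ⟨hx, hx'⟩ hy.2⟩)
  refine (hfin.union hf.finite_not_continuousAt).subset fun z hz => ?_
  by_contra hcon
  simp only [mem_union, mem_ofPred_eq, not_or, not_not] at hcon
  obtain ⟨hA, hcont⟩ := hcon
  refine hz ?_
  rcases hA with h | ⟨h, h'⟩ | ⟨h, h'⟩
  · exact .inl h
  · refine .inr ⟨false, fun t => ?_⟩
    cases t
    · exact tendsto_nhdsWithin_iff.2 ⟨hcont.mono_left (sd_le_nhds false z), h'⟩
    · exact tendsto_nhdsWithin_iff.2 ⟨hcont.mono_left (sd_le_nhds true z), h⟩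
  · refine .inr ⟨true, fun t => ?_⟩
    cases t
    · exact tendsto_nhdsWithin_iff.2 ⟨hcont.mono_left (sd_le_nhds false z), h'⟩
    · exact tendsto_nhdsWithin_iff.2 ⟨hcont.mono_left (sd_le_nhds true z), h⟩

end monotone

/-! ### Definable choice and the fibres of plane sets -/

section choice

variable {L : FirstOrder.Language} {M : Type*} [L.Structure M] [AddCommGroup M] [LinearOrder M]
  [IsOrderedAddMonoid M] [hM : Fact (IsOMinimalExpansion L M)] [DenselyOrdered M] [Nontrivial M]
  [TopologicalSpace M] [OrderTopology M]

/-- A definable functional relation is the graph, on its domain, of a total definable function. -/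
theorem Def2.exists_function {Q : M → M → Prop} (hQ : Def2 L Q)
    (hu : ∀ x y y', Q x y → Q x y' → y = y') :
    ∃ g, DF1 L g ∧ ∀ x, (∃ y, Q x y) → Q x (g x) := by
  classical
  let g : M → M := fun x => if h : ∃ y, Q x y then h.choose else 0
  have hg : ∀ x, (∃ y, Q x y) → Q x (g x) := fun x h => by
    simp only [g, dif_pos h]
    exact h.choose_spec
  refine ⟨g, DF1.of_def2 (Dfp.congr
    (P := fun v : Fin 2 → M => Q (v 0) (v 1) ∨ ((¬ ∃ y, Q (v 0) y) ∧ v 1 = 0))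
    (by simp (maxDischargeDepth := 9) [hQ.app]) fun v => ?_), hg⟩
  by_cases h : ∃ y, Q (v 0) y
  · simp only [h, not_true_eq_false, false_and, or_false]
    exact ⟨fun he => he ▸ hg _ h, fun he => hu _ _ _ (hg _ h) he⟩
  · have h' : ¬ Q (v 0) (v 1) := fun hq => h ⟨_, hq⟩
    simp only [h, h', g, dif_neg, not_false_eq_true, true_and, false_or]
    exact eq_comm

/-- Definable choice for bounded families: choose the least element if there is one, and the
midpoint of the first interval otherwise. -/
theorem Def2.exists_choice {R : M → M → Prop} (hR : Def2 L R) {lo up : M}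
    (hb : ∀ x y, R x y → lo ≤ y ∧ y ≤ up) :
    ∃ g, DF1 L g ∧ ∀ x, (∃ y, R x y) → R x (g x) := by
  -- `i` is the infimum of the fibre over `x`, and `j` the right end of its interval starting at `i`
  let G : M → M → Prop := fun x i => (∀ y, R x y → i ≤ y) ∧ ∀ c, (∀ y, R x y → c ≤ y) → c ≤ i
  let K : M → M → M → Prop := fun x i k => i < k ∧ ∀ y, i < y → y < k → R x y
  let H : M → M → M → Prop := fun x i j =>
    (∀ k, K x i k → k ≤ j) ∧ ∀ c, (∀ k, K x i k → k ≤ c) → j ≤ c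
  let Q : M → M → Prop := fun x y => (R x y ∧ ∀ y', R x y' → y ≤ y') ∨
    ((¬ ∃ y, R x y ∧ ∀ y', R x y' → y ≤ y') ∧ ∃ i j, G x i ∧ H x i j ∧ y + y = i + j)
  have hQ : Def2 L Q := by
    unfold Def2
    simp (maxDischargeDepth := 20) [Q, G, H, K, hR.app, -not_exists, -not_and]
  have hG : ∀ x i i', G x i → G x i' → i = i' := fun x i i' h h' =>
    le_antisymm (h'.2 _ h.1) (h.2 _ h'.1)
  have hH : ∀ x i j j', H x i j → H x i j' → j = j' := fun x i j j' h h' =>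
    le_antisymm (h.2 _ h'.1) (h'.2 _ h.1)
  have hhalf : ∀ y y' : M, y + y = y' + y' → y = y' := fun y y' h => by
    rcases lt_trichotomy y y' with h' | h' | h'
    · exact absurd h (add_lt_add h' h').ne
    · exact h'
    · exact absurd h (add_lt_add h' h').ne'
  obtain ⟨g, hg, hgQ⟩ := hQ.exists_function (by
    rintro x y y' (⟨h, hm⟩ | ⟨hn, i, j, hi, hj, hy⟩) (⟨h', hm'⟩ | ⟨hn', i', j', hi', hj', hy'⟩)
    · exact le_antisymm (hm _ h') (hm' _ h)
    · exact absurd ⟨y, h, hm⟩ hn'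
    · exact absurd ⟨y', h', hm'⟩ hn
    · obtain rfl := hG x i i' hi hi'
      obtain rfl := hH x i j j' hj hj'
      exact hhalf y y' (hy.trans hy'.symm))
  refine ⟨g, hg, fun x hx => ?_⟩
  have hR1 : Def1 L (R x) := by unfold Def1; simp [hR.app]
  obtain ⟨i, hi⟩ := hR1.exists_isGLB hx ⟨lo, fun y hy => (hb x y hy).1⟩
  by_cases hmin : ∃ y, R x y ∧ ∀ y', R x y' → y ≤ y'
  · rcases hgQ x (hmin.imp fun y hy => .inl hy) with h | h
    · exact h.1
    · exact absurd hmin h.1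
  have hni : ¬ R x i := fun h => hmin ⟨i, h, fun y hy => hi.1 hy⟩
  obtain ⟨b, hib, hb'⟩ : ∃ b, K x i b := by
    refine mem_sd_true.1 (hR1.sd_of_frequently ?_)
    rw [frequently_iff]
    intro U hU
    obtain ⟨c, hc, hc'⟩ := mem_sd_true.1 hU
    obtain ⟨y, hy, hiy, hyc⟩ := hi.exists_between hc
    exact ⟨y, hc' y (hiy.lt_of_ne fun h => hni (h ▸ hy)) hyc, hy⟩
  have hKd : Def1 L (K x i) := by
    unfold Def1; simp (maxDischargeDepth := 9) [K, hR.app]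
  have hKup : ∀ k, K x i k → k ≤ up := fun k hk => by
    by_contra! hlt
    obtain ⟨y, hy, hy'⟩ := exists_between (max_lt hk.1 hlt)
    exact absurd (hb x y (hk.2 y ((le_max_left _ _).trans_lt hy) hy')).2
      ((le_max_right _ _).trans_lt hy).not_ge
  obtain ⟨j, hj⟩ := hKd.exists_isLUB ⟨b, hib, hb'⟩ ⟨up, hKup⟩
  have hij : i < j := hib.trans_le (hj.1 ⟨hib, hb'⟩)
  obtain ⟨m, hm⟩ := exists_add_self_eq L (i + j)
  rcases hgQ x ⟨m, .inr ⟨hmin, i, j, ⟨fun y hy => hi.1 hy, fun c hc => hi.2 hc⟩,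
    ⟨fun k hk => hj.1 hk, fun c hc => hj.2 hc⟩, hm⟩⟩ with h | ⟨_, i', j', hi', hj', hm'⟩
  · exact h.1
  · obtain rfl := hG x i i' ⟨fun y hy => hi.1 hy, fun c hc => hi.2 hc⟩ hi'
    obtain rfl := hH x i j j' ⟨fun k hk => hj.1 hk, fun c hc => hj.2 hc⟩ hj'
    have h1 : i < g x := by
      by_contra! h
      exact absurd hm' (add_lt_add_of_le_of_lt h (h.trans_lt hij)).ne
    have h2 : g x < j := by
      by_contra! h
      exact absurd hm' (add_lt_add_of_lt_of_le (hij.trans_le h) h).ne'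
    obtain ⟨k, hk, hgk, _⟩ := hj.exists_between h2
    exact hk.2 _ h1 hgk

theorem eventually_nhds_iff_abs {P : M → Prop} {z : M} :
    (∀ᶠ x in 𝓝 z, P x) ↔ ∃ δ, 0 < δ ∧ ∀ x, |x - z| < δ → P x :=
  (nhds_basis_abs_sub_lt z).eventually_iff

theorem infinite_iff_exists_Ioo {P : M → Prop} (hP : Def1 L P) :
    {x | P x}.Infinite ↔ ∃ a b, a < b ∧ ∀ x, a < x → x < b → P x :=
  ⟨hP.exists_Ioo, fun ⟨_, _, hab, h⟩ => infinite_of_interval hab h⟩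

/-- A bounded definable subset of the plane that contains no box has only finitely many infinite
fibres: otherwise definably chosen intervals in the fibres vary continuously near some point, and
thus fill a box. -/
theorem finite_infinite_fibres {A : M → M → Prop} (hA : Def2 L A) {lo hi : M}
    (hb : ∀ x y, A x y → lo ≤ y ∧ y ≤ hi)
    (hthin : ∀ a b p q, a < b → p < q → ∃ x y, (a < x ∧ x < b) ∧ (p < y ∧ y < q) ∧ ¬ A x y) :
    {x | {y | A x y}.Infinite}.Finite := by
  have hA1 : ∀ x, Def1 L (A x) := fun x => by unfold Def1; simp [hA.app]
  have hIoo : ∀ {x p q}, p < q → (∀ y, p < y → y < q → A x y) → lo ≤ p ∧ q ≤ hi := by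
    intro x p q hpq h
    constructor
    · by_contra! hlt
      obtain ⟨y, hy, hy'⟩ := exists_between (lt_min hpq hlt)
      exact absurd (hb x y (h y hy (hy'.trans_le (min_le_left _ _)))).1
        (hy'.trans_le (min_le_right _ _)).not_ge
    · by_contra! hlt
      obtain ⟨y, hy, hy'⟩ := exists_between (max_lt hpq hlt)
      exact absurd (hb x y (h y ((le_max_left _ _).trans_lt hy) hy')).2
        ((le_max_right _ _).trans_lt hy).not_ge
  simp only [fun x => infinite_iff_exists_Ioo (hA1 x)]
  refine Def1.finite_of_forall (L := L) (P := fun x => ∃ p q, p < q ∧ ∀ y, p < y → y < q → A x y)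
    (by unfold Def1; simp (maxDischargeDepth := 9) [hA.app]) fun a b hab => ?_
  by_contra! hcon
  obtain ⟨g, hg, hgR⟩ := Def2.exists_choice (L := L) (lo := lo) (up := hi)
    (R := fun x p => ∃ q, p < q ∧ ∀ y, p < y → y < q → A x y)
    (by unfold Def2; simp (maxDischargeDepth := 9) [hA.app])
    fun x p ⟨q, hpq, h⟩ => ⟨(hIoo hpq h).1, hpq.le.trans (hIoo hpq h).2⟩
  obtain ⟨k, hk, hkR⟩ := Def2.exists_choice (L := L) (lo := lo) (up := hi)
    (R := fun x q => g x < q ∧ ∀ y, g x < y → y < q → A x y)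
    (by unfold Def2; simp (maxDischargeDepth := 9) [hA.app, hg.app])
    fun x q ⟨hpq, h⟩ => ⟨(hIoo hpq h).1.trans hpq.le, (hIoo hpq h).2⟩
  obtain ⟨x, hx, hx'⟩ := ((Ioo_infinite hab).sdiff
    (hg.finite_not_continuousAt.union hk.finite_not_continuousAt)).nonempty
  simp only [mem_union, mem_ofPred_eq, not_or, not_not] at hx'
  have hgk : ∀ x, a < x → x < b → g x < k x ∧ ∀ y, g x < y → y < k x → A x y :=
    fun x h h' => hkR x (hgR x (hcon x h h'))
  obtain ⟨p, hp, hp'⟩ := exists_between (hgk x hx.1 hx.2).1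
  obtain ⟨q, hpq, hq⟩ := exists_between hp'
  have hev : ∀ᶠ w in 𝓝 x, (g w < p ∧ q < k w) ∧ a < w ∧ w < b :=
    ((hx'.1.eventually (Iio_mem_nhds hp)).and (hx'.2.eventually (Ioi_mem_nhds hq))).and
      (Ioo_mem_nhds hx.1 hx.2)
  obtain ⟨a', b', h1, h2, h3⟩ := mem_nhds_iff_Ioo.1 hev
  obtain ⟨w, y, hw, hy, hn⟩ := hthin a' b' p q (h1.trans h2) hpq
  obtain ⟨h4, h5⟩ := h3 w hw.1 hw.2
  exact hn ((hgk w h5.1 h5.2).2 y (h4.1.trans hy.1) (hy.2.trans h4.2))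

theorem exists_isolating_radius {s : Set M} (hs : s.Finite) (c : M) :
    ∃ ε, 0 < ε ∧ ∀ y ∈ s, |y - c| < ε → y = c := by
  have : ∀ᶠ y in 𝓝 c, y ∉ s \ {c} :=
    (hs.subset sdiff_subset).isClosed.isOpen_compl.mem_nhds fun h => h.2 rfl
  obtain ⟨ε, hε, h⟩ := eventually_nhds_iff_abs.1 this
  exact ⟨ε, hε, fun y hy hyc => by_contra fun hne => h y hyc ⟨hy, hne⟩⟩

/-- Near `(x, y)`, the set `A` is empty if `(x, y) ∉ A`, and is a continuous section through
`(x, y)` if `(x, y) ∈ A`. -/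
def NormalAt (A : M → M → Prop) (x y : M) : Prop :=
  ∃ η, 0 < η ∧ ∀ ε, 0 < ε → ε ≤ η → ∀ᶠ x' in 𝓝 x,
    (A x y ∧ ∃ y', (|y' - y| < ε ∧ A x' y') ∧ ∀ y'', |y'' - y| < ε → A x' y'' → y'' = y') ∨
    (¬ A x y ∧ ∀ y', |y' - y| < ε → ¬ A x' y')

/-- Otherwise choose a point `(x, β x)` at which `A` is not normal, for all `x` in an interval. At a
point of continuity of `β`, a uniform lower bound on the distance from `β x` to the rest of the
fibre makes `A` normal. -/
theorem finite_not_normal {A : M → M → Prop} (hA : Def2 L A) (hfin : ∀ x, {y | A x y}.Finite)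
    (lo hi : M) : {x | ∃ y, (lo ≤ y ∧ y ≤ hi) ∧ ¬ NormalAt A x y}.Finite := by
  have hN : Def2 L (fun x y => (lo ≤ y ∧ y ≤ hi) ∧ ¬ NormalAt A x y) := by
    unfold Def2 NormalAt
    simp (maxDischargeDepth := 20) [hA.app, -not_exists, -not_and, -not_or, -not_forall]
  refine Def1.finite_of_forall (L := L) (P := fun x => ∃ y, (lo ≤ y ∧ y ≤ hi) ∧ ¬ NormalAt A x y)
    (by unfold Def1; exact Dfp.ex (hN.app (by simp) (by simp))) fun a b hab => ?_
  by_contra! hcon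
  obtain ⟨β, hβ, hβR⟩ := hN.exists_choice fun x y h => h.1
  have hbad : ∀ x, a < x → x < b → ¬ NormalAt A x (β x) := fun x h h' => (hβR x (hcon x h h')).2
  have hD : Def1 L (fun x => A x (β x)) := by unfold Def1; exact hA.app (by simp) (hβ.app (by simp))
  obtain ⟨a1, b1, h1, h2, h3, h4⟩ := hD.decide hab
  -- on a subinterval, the other points of the fibre stay away from `β x` by a constant `ε`
  obtain ⟨a2, b2, ε, h5, h6, h7, hε, _, h8⟩ := uniform_radius (L := L) (a := a1) (b := b1)
    (R := fun x ε => ∀ y, |y - β x| < ε → A x y → y = β x)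
    (by unfold Def2; simp (maxDischargeDepth := 9) [hA.app, hβ.app])
    (fun x ε ε' _ hle h y hy => h y (hy.trans_le hle)) h2
    (fun x _ _ => by
      obtain ⟨ε, hε, h⟩ := exists_isolating_radius (hfin x) (β x)
      exact ⟨ε, hε, fun y hy hAy => h y hAy hy⟩)
  obtain ⟨x, hx, hx'⟩ := ((Ioo_infinite h6).sdiff hβ.finite_not_continuousAt).nonempty
  have hc : ContinuousAt β x := not_not.1 hx'
  have hin : ∀ᶠ w in 𝓝 x, a2 < w ∧ w < b2 := Ioo_mem_nhds hx.1 hx.2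
  refine hbad x (h1.trans_lt (h5.trans_lt hx.1)) (hx.2.trans_le (h7.trans h3)) ?_
  obtain ⟨η, hη, hηε⟩ := exists_add_self_le hε
  refine ⟨η, hη, fun ε1 hε1 hle => ?_⟩
  have hclose : ∀ᶠ w in 𝓝 x, |β w - β x| < ε1 :=
    hc.eventually (eventually_nhds_iff_abs.2 ⟨ε1, hε1, fun _ h => h⟩)
  have huniq : ∀ᶠ w in 𝓝 x, ∀ y, |y - β x| < ε1 → A w y → y = β w := by
    filter_upwards [hin, hclose] with w hw hw' y hy hAy
    refine h8 w hw.1 hw.2 y ?_ hAy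
    calc |y - β w| ≤ |y - β x| + |β x - β w| := abs_sub_le _ _ _
      _ < ε1 + ε1 := add_lt_add hy (by rwa [abs_sub_comm])
      _ ≤ ε := (add_le_add hle hle).trans hηε
  rcases h4 with h4 | h4
  · filter_upwards [hin, hclose, huniq] with w hw hw' hw''
    exact .inl ⟨h4 x (h5.trans_lt hx.1) (hx.2.trans_le h7), β w,
      ⟨hw', h4 w (h5.trans_lt hw.1) (hw.2.trans_le h7)⟩, hw''⟩
  · filter_upwards [hin, huniq] with w hw hw''
    refine .inr ⟨h4 x (h5.trans_lt hx.1) (hx.2.trans_le h7), fun y hy hAy => ?_⟩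
    exact h4 w (h5.trans_lt hw.1) (hw.2.trans_le h7) (hw'' y hy hAy ▸ hAy)

end choice

/-! ### Uniform finiteness -/

section count

variable {L : FirstOrder.Language} {M : Type*} [L.Structure M] [AddCommGroup M] [LinearOrder M]
  [IsOrderedAddMonoid M] [hM : Fact (IsOMinimalExpansion L M)] [DenselyOrdered M] [Nontrivial M]
  [TopologicalSpace M] [OrderTopology M]

/-- If all points over `x` are normal, the nearby fibres are bijective to the fibre over `x`. -/
theorem eventually_ncard_eq {A : M → M → Prop} (hA : Def2 L A) (hfin : ∀ x, {y | A x y}.Finite)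
    {lo hi : M} (hb : ∀ x y, A x y → lo ≤ y ∧ y ≤ hi) {x : M}
    (hx : ∀ y, lo ≤ y → y ≤ hi → NormalAt A x y) :
    ∀ᶠ x' in 𝓝 x, {y | A x' y}.ncard = {y | A x y}.ncard := by
  -- a radius `ε` that fits all points of the fibre and separates them
  have hrad : ∀ y, A x y → ∃ ε, 0 < ε ∧ (∀ z, A x z → |z - y| < ε → z = y) ∧
      ∀ ε', 0 < ε' → ε' ≤ ε → ∀ᶠ x' in 𝓝 x,
        ∃ y', (|y' - y| < ε' ∧ A x' y') ∧ ∀ y'', |y'' - y| < ε' → A x' y'' → y'' = y' := by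
    intro y hy
    obtain ⟨η, hη, h⟩ := hx y (hb x y hy).1 (hb x y hy).2
    obtain ⟨ε, hε, h'⟩ := exists_isolating_radius (hfin x) y
    refine ⟨min ε η, lt_min hε hη, fun z hz hzy => h' z hz (hzy.trans_le (min_le_left _ _)),
      fun ε' h0 hle => (h ε' h0 (hle.trans (min_le_right _ _))).mono fun w hw => ?_⟩
    exact (hw.resolve_right fun hn => hn.1 hy).2
  choose! r hr0 hr1 hr2 using hrad
  obtain ⟨ρ, hρ, hρr⟩ : ∃ ρ, 0 < ρ ∧ ∀ y, A x y → ρ ≤ r y := by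
    by_cases hne : {y | A x y}.Nonempty
    · obtain ⟨y0, hy0, hmin⟩ := (hfin x).exists_minimalFor r _ hne
      exact ⟨r y0, hr0 y0 hy0, fun y hy => (le_total (r y0) (r y)).elim id fun h => hmin hy h⟩
    · obtain ⟨ρ, hρ⟩ := exists_gt (0 : M)
      exact ⟨ρ, hρ, fun y hy => absurd ⟨y, hy⟩ hne⟩
  obtain ⟨ε, hε, hερ⟩ := exists_add_self_le hρ
  have hερ' : ε ≤ ρ := le_trans (by simpa using hε.le) hερ
  have h1 : ∀ᶠ x' in 𝓝 x, ∀ y ∈ {y | A x y}, ∃ y', (|y' - y| < ε ∧ A x' y') ∧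
      ∀ y'', |y'' - y| < ε → A x' y'' → y'' = y' :=
    (eventually_all_finite (hfin x)).2 fun y hy => hr2 y hy ε hε (hερ'.trans (hρr y hy))
  -- by definable compactness, no other points appear in the nearby fibres
  have h2 : ∀ᶠ x' in 𝓝 x, ∀ y', A x' y' → ∃ y, A x y ∧ |y' - y| < ε := by
    by_contra hcon
    rw [eventually_nhds_iff_abs] at hcon
    push Not at hcon
    let S : (Fin 1 → M) → M → Prop := fun b y' =>
      ∃ x', |x' - x| < b 0 ∧ A x' y' ∧ ∀ y, A x y → ε ≤ |y' - y|
    obtain ⟨z, hz1, hz2, hz⟩ := exists_cluster (L := L) (Λ := fun b : Fin 1 → M => 0 < b 0) (S := S)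
      (lo := lo) (hi := hi) (by simp)
      (by simp (maxDischargeDepth := 15) [S, hA.app])
      (fun b _ y ⟨x', _, h, _⟩ => hb x' y h)
      ⟨fun _ => ε, hε⟩
      (fun b hb' => by
        obtain ⟨x', h, y', h', h''⟩ := hcon (b 0) hb'
        exact ⟨y', x', h, h', h''⟩)
      (fun b b' h h' => ⟨fun _ => min (b 0) (b' 0), lt_min h h', fun y ⟨x', h1, h2⟩ =>
        ⟨⟨x', h1.trans_le (min_le_left _ _), h2⟩, ⟨x', h1.trans_le (min_le_right _ _), h2⟩⟩⟩)
    have hfreq : ∀ δ, 0 < δ → ∀ η, 0 < η → ∃ y', |y' - z| < η ∧ S (fun _ => δ) y' := by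
      intro δ hδ η hη
      have hnear : ∀ᶠ y in 𝓝 z, |y - z| < η := eventually_nhds_iff_abs.2 ⟨η, hη, fun _ h => h⟩
      rcases hz with h | ⟨s, h⟩
      · exact ⟨z, by simpa using hη, h (fun _ => δ) hδ⟩
      · exact ((hnear.filter_mono (sd_le_nhds s z)).and (h (fun _ => δ) hδ)).exists
    by_cases hAz : A x z
    · obtain ⟨y', h3, _, _, _, h4⟩ := hfreq ε hε ε hε
      exact absurd h3 (h4 z hAz).not_gt
    · obtain ⟨η, hη, h⟩ := hx z hz1 hz2
      obtain ⟨δ, hδ, h'⟩ := eventually_nhds_iff_abs.1 (h η hη le_rfl)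
      obtain ⟨y', h3, x', h4, h5, _⟩ := hfreq δ hδ η hη
      exact ((h' x' h4).resolve_left fun hh => hAz hh.1).2 y' h3 h5
  filter_upwards [h1, h2] with x' h1 h2
  choose! g hg hgu using h1
  refine (ncard_congr (fun y _ => g y) (fun y hy => (hg y hy).2) ?_ ?_).symm
  · intro y y' hy hy' heq
    refine hr1 y' hy' y hy (lt_of_lt_of_le ?_ (hρr y' hy'))
    calc |y - y'| ≤ |y - g y| + |g y - y'| := abs_sub_le _ _ _
      _ < ε + ε := add_lt_add (by rw [abs_sub_comm]; exact (hg y hy).1)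
          (by rw [heq]; exact (hg y' hy').1)
      _ ≤ ρ := hερ
  · intro y' hy'
    obtain ⟨y, hy, hyy⟩ := h2 y' hy'
    exact ⟨y, hy, (hgu y hy y' hyy hy').symm⟩

theorem lt_ncard_iff {s : Set M} (hs : s.Finite) (n : ℕ) :
    n < s.ncard ↔ ∃ t : Fin (n + 1) → M, (∀ i j, t i = t j → i = j) ∧ ∀ i, t i ∈ s := by
  constructor
  · intro h
    obtain ⟨u, hus, hu⟩ := exists_subset_card_eq (Nat.succ_le_of_lt h)
    have : Finite u := hs.subset hus
    have e := (Finite.equivFinOfCardEq (n := n + 1) (α := u) hu).symm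
    exact ⟨fun i => e i, fun i j hij => e.injective (Subtype.ext hij), fun i => hus (e i).2⟩
  · rintro ⟨t, ht, hts⟩
    have h1 : (range t).ncard = n + 1 := by
      rw [← image_univ, ncard_image_of_injective _ fun i j => ht i j]
      simp
    have h2 := ncard_le_ncard (range_subset_iff.2 hts) hs
    omega

theorem def1_ncard_le {A : M → M → Prop} (hA : Def2 L A) (hfin : ∀ x, {y | A x y}.Finite)
    (n : ℕ) : Def1 L (fun x => {y | A x y}.ncard ≤ n) := by
  refine Dfp.congr (P := fun v : Fin 1 → M => ¬ ∃ t : Fin (n + 1) → M,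
    (∀ i j, t i = t j → i = j) ∧ ∀ i, A (v 0) (t i)) ?_ fun v => ?_
  · refine .not (.exTuple (.and (.allFin fun i => .allFin fun j => ?_) (.allFin fun i => ?_)))
    · simp
    · exact hA.app (.var _) (.var _)
  · exact not_lt.symm.trans (not_congr (lt_ncard_iff (hfin (v 0)) n))

/-- Uniform finiteness: off the finitely many points over which `A` is not normal, the cardinality
of the fibre is locally constant, hence depends only on the position relative to these points. -/
theorem exists_ncard_le {A : M → M → Prop} (hA : Def2 L A) (hfin : ∀ x, {y | A x y}.Finite)
    {lo hi : M} (hb : ∀ x y, A x y → lo ≤ y ∧ y ≤ hi) : ∃ N, ∀ x, {y | A x y}.ncard ≤ N := by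
  set F := {x | ∃ y, (lo ≤ y ∧ y ≤ hi) ∧ ¬ NormalAt A x y} with hF
  have hFfin : F.Finite := finite_not_normal hA hfin lo hi
  have hloc : ∀ z, z ∉ F → ∀ᶠ w in 𝓝 z, {y | A w y}.ncard = {y | A z y}.ncard := fun z hz =>
    eventually_ncard_eq hA hfin hb fun y h1 h2 => by
      by_contra h
      exact hz ⟨y, ⟨h1, h2⟩, h⟩
  -- the count is constant on intervals disjoint from `F`
  have hconst : ∀ x x', x ≤ x' → (∀ z, x ≤ z → z ≤ x' → z ∉ F) →
      {y | A x y}.ncard = {y | A x' y}.ncard := by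
    intro x x' hxx hz
    have hle := fun n => def1_ncard_le hA hfin n
    apply le_antisymm
    · by_contra hn
      refine absurd ((show Def1 L (fun w => ¬ {y | A w y}.ncard ≤ {y | A x' y}.ncard) by
        unfold Def1; exact .not ((hle _).app (DF.var _))).connected hxx ?_ ?_ hn) (not_not.2 le_rfl)
      · exact fun z h1 h2 h3 => (hloc z (hz z h1 h2)).mono fun w hw => by rwa [hw]
      · exact fun z h1 h2 h3 => (hloc z (hz z h1 h2)).mono fun w hw => by rwa [hw]
    · refine (hle _).connected hxx ?_ ?_ le_rfl
      · exact fun z h1 h2 h3 => (hloc z (hz z h1 h2)).mono fun w hw => by rwa [hw]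
      · exact fun z h1 h2 h3 => (hloc z (hz z h1 h2)).mono fun w hw => by rwa [hw]
  have hdep : ∀ x x', x ∉ F → x' ∉ F → F ∩ Iio x = F ∩ Iio x' →
      {y | A x y}.ncard = {y | A x' y}.ncard := by
    intro x x' hx hx' heq
    wlog hle : x ≤ x' generalizing x x'
    · exact (this x' x hx' hx heq.symm (le_of_not_ge hle)).symm
    refine hconst x x' hle fun z h1 h2 hzF => ?_
    have h3 : z ∈ F ∩ Iio x' := ⟨hzF, lt_of_le_of_ne h2 fun h => hx' (h ▸ hzF)⟩
    rw [← heq] at h3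
    exact absurd h3.2 h1.not_gt
  classical
  let φ : Set M → ℕ := fun T =>
    if h : ∃ x, x ∉ F ∧ F ∩ Iio x = T then {y | A h.choose y}.ncard else 0
  obtain ⟨N1, hN1⟩ := (hFfin.finite_subsets.image φ).bddAbove
  obtain ⟨N2, hN2⟩ := (hFfin.image fun x => {y | A x y}.ncard).bddAbove
  refine ⟨max N1 N2, fun x => ?_⟩
  by_cases hx : x ∈ F
  · exact (hN2 ⟨x, hx, rfl⟩).trans (le_max_right _ _)
  · refine le_trans ?_ (le_max_left _ _)
    refine hN1 ⟨F ∩ Iio x, inter_subset_left, ?_⟩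
    have h : ∃ x', x' ∉ F ∧ F ∩ Iio x' = F ∩ Iio x := ⟨x, hx, rfl⟩
    simp only [φ, dif_pos h]
    exact hdep _ _ h.choose_spec.1 hx h.choose_spec.2

end count

/-! ### One-dimensional sets embed into the line -/

section curve

variable {L : FirstOrder.Language} {M : Type*} [L.Structure M] [AddCommGroup M] [LinearOrder M]
  [IsOrderedAddMonoid M] [hM : Fact (IsOMinimalExpansion L M)] [DenselyOrdered M] [Nontrivial M]
  [TopologicalSpace M] [OrderTopology M]

/-- A definable relation with boundedly many values is a finite union of graphs of functions. -/
theorem exists_graph_cover (N : ℕ) : ∀ {A : M → M → Prop}, Def2 L A →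
    (∀ x, {y | A x y}.Finite) → (∀ x, {y | A x y}.ncard ≤ N) →
    ∃ (ι : Type) (_ : Finite ι) (C : ι → M → M → Prop), (∀ i, Def2 L (C i)) ∧
      (∀ x y, A x y → ∃ i, C i x y) ∧ ∀ i x y y', C i x y → C i x y' → y = y' := by
  induction N with
  | zero =>
    intro A hA hfin hN
    refine ⟨Empty, inferInstance, fun _ _ _ => False, nofun, fun x y hxy => ?_, nofun⟩
    have := (ncard_eq_zero (hfin x)).1 (Nat.le_zero.1 (hN x))
    have h : y ∈ {y | A x y} := hxy
    simp [this] at h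
  | succ N ih =>
    intro A hA hfin hN
    let C0 : M → M → Prop := fun x y => A x y ∧ ∀ y', A x y' → y ≤ y'
    have hC0 : Def2 L C0 := by unfold Def2; simp (maxDischargeDepth := 9) [C0, hA.app]
    obtain ⟨ι, hι, C, hC, hcov, hfun⟩ := ih (A := fun x y => A x y ∧ ¬ C0 x y)
      (by unfold Def2; exact .and (hA.app (.var _) (.var _)) (.not (hC0.app (.var _) (.var _))))
      (fun x => (hfin x).subset fun y hy => hy.1)
      (fun x => by
        by_cases hne : {y | A x y}.Nonempty
        · obtain ⟨m, hm, hmin⟩ := (hfin x).exists_minimal hne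
          have hm0 : C0 x m := ⟨hm, fun y hy => (le_total m y).elim id fun h => hmin hy h⟩
          have : {y | A x y ∧ ¬ C0 x y} ⊂ {y | A x y} :=
            ⟨fun y hy => hy.1, fun hsub => (hsub hm).2 hm0⟩
          have := ncard_lt_ncard this (hfin x)
          have := hN x
          omega
        · have : {y | A x y ∧ ¬ C0 x y} = ∅ :=
            eq_empty_of_forall_notMem fun y hy => hne ⟨y, hy.1⟩
          simp [this])
    refine ⟨Option ι, inferInstance, fun o => o.elim C0 C, ?_, fun x y hxy => ?_, ?_⟩
    · rintro (_ | i)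
      exacts [hC0, hC i]
    · by_cases h : C0 x y
      · exact ⟨none, h⟩
      · obtain ⟨i, hi⟩ := hcov x y ⟨hxy, h⟩
        exact ⟨some i, hi⟩
    · rintro (_ | i) x y y' h h'
      · exact le_antisymm (h.2 y' h'.1) (h'.2 y h.1)
      · exact hfun i x y y' h h'

/-- A bounded definable plane set without interior is a finite union of definable sets on each of
which one of the two coordinates determines the other: the finitely many infinite fibres, and the
graphs covering the remaining fibres. -/
theorem exists_cover_of_thin {A : M → M → Prop} (hA : Def2 L A) {lo hi : M}
    (hb : ∀ x y, A x y → lo ≤ y ∧ y ≤ hi)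
    (hthin : ∀ a b p q, a < b → p < q → ∃ x y, (a < x ∧ x < b) ∧ (p < y ∧ y < q) ∧ ¬ A x y) :
    ∃ (ι : Type) (_ : Finite ι) (C : ι → M → M → Prop), (∀ i, Def2 L (C i)) ∧
      (∀ x y, A x y → ∃ i, C i x y) ∧ ∀ i, (∀ x y y', C i x y → C i x y' → y = y') ∨
        ∀ x x' y, C i x y → C i x' y → x = x' := by
  have hF := finite_infinite_fibres hA hb hthin
  set F := {x | {y | A x y}.Infinite}
  have hA1 : ∀ x, Def1 L (A x) := fun x => by unfold Def1; simp [hA.app]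
  have hFd : Def1 L (· ∈ F) := by
    refine Dfp.congr (P := fun v : Fin 1 → M => ∃ p q, p < q ∧ ∀ y, p < y → y < q → A (v 0) y)
      (by simp (maxDischargeDepth := 9) [hA.app]) fun v => infinite_iff_exists_Ioo (hA1 _)
  have hA' : Def2 L (fun x y => A x y ∧ x ∉ F) := by
    unfold Def2; exact .and (hA.app (.var _) (.var _)) (.not (hFd.app (.var _)))
  have hfin : ∀ x, {y | A x y ∧ x ∉ F}.Finite := fun x => by
    by_cases hx : x ∈ F
    · simp [hx]
    · exact (not_infinite.1 hx).subset fun y hy => hy.1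
  obtain ⟨N, hN⟩ := exists_ncard_le hA' hfin fun x y h => hb x y h.1
  obtain ⟨ι, hι, C, hC, hcov, hfun⟩ := exists_graph_cover N hA' hfin hN
  obtain ⟨n, e, he⟩ : ∃ (n : ℕ) (e : Fin n → M), ∀ x ∈ F, ∃ i, e i = x := by
    have := hF.fin_param
    obtain ⟨n, e, _, he⟩ := this
    exact ⟨n, e, fun x hx => by rw [← he] at hx; exact hx⟩
  refine ⟨ι ⊕ Fin n, inferInstance, Sum.elim C fun k x y => A x y ∧ x = e k, ?_, ?_, ?_⟩
  · rintro (i | k)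
    · exact hC i
    · show Def2 L fun x y => A x y ∧ x = e k
      unfold Def2; simp [hA.app]
  · intro x y hxy
    by_cases hx : x ∈ F
    · obtain ⟨k, hk⟩ := he x hx
      exact ⟨.inr k, hxy, hk.symm⟩
    · obtain ⟨i, hi⟩ := hcov x y ⟨hxy, hx⟩
      exact ⟨.inl i, hi⟩
  · rintro (i | k)
    · exact .inl (hfun i)
    · exact .inr fun x x' y h h' => h.2.trans h'.2.symm

end curve

section embed

variable {L : FirstOrder.Language} {M : Type*} [L.Structure M] [AddCommGroup M] [LinearOrder M]
  [IsOrderedAddMonoid M] [hM : Fact (IsOMinimalExpansion L M)] [DenselyOrdered M] [Nontrivial M]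
  [TopologicalSpace M] [OrderTopology M]

/-- A one-dimensional bounded definable set is a finite union of definable sets on each of which
one coordinate determines the first `k` coordinates. To pass from `k` to `k + 1`, the projection to
this coordinate and the next one is covered by `exists_cover_of_thin`. -/
theorem exists_coordinate_cover {n : ℕ} (hn : 0 < n) {X : Set (Fin n → M)} (hX : IsDef L X)
    {lo hi : M} (hb : ∀ v ∈ X, ∀ i, lo ≤ v i ∧ v i ≤ hi) (hdim : ¬ DimAtLeast X 2) (k : ℕ) :
    k ≤ n → ∃ (ι : Type) (_ : Finite ι) (Y : ι → Set (Fin n → M)) (idx : ι → Fin n),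
      (∀ j, Dfp L (· ∈ Y j)) ∧ (∀ j, Y j ⊆ X) ∧ (∀ v ∈ X, ∃ j, v ∈ Y j) ∧
      ∀ j, ∀ u ∈ Y j, ∀ v ∈ Y j, u (idx j) = v (idx j) → ∀ l : Fin n, (l : ℕ) < k → u l = v l := by
  induction k with
  | zero =>
    exact fun _ => ⟨Unit, inferInstance, fun _ => X, fun _ => ⟨0, hn⟩, fun _ => hX,
      fun _ => subset_rfl, fun v hv => ⟨(), hv⟩, fun j u _ v _ _ l hl => absurd hl (by omega)⟩
  | succ k ih =>
    intro hk
    obtain ⟨ι, hι, Y, idx, hY, hYX, hcov, hdet⟩ := ih (by omega)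
    let c : Fin n := ⟨k, hk⟩
    let A : ι → M → M → Prop := fun j x y => ∃ v : Fin n → M, v ∈ X ∧ v (idx j) = x ∧ v c = y
    have hA : ∀ j, Def2 L (A j) := fun j => by
      refine Dfp.exTuple (.and ?_ (.and (by simp) (by simp)))
      exact Dfp.subst (t := fun i (w : Fin 2 ⊕ Fin n → M) => w (.inr i)) hX fun i => .var _
    have hthin : ∀ j a b p q, a < b → p < q →
        ∃ x y, (a < x ∧ x < b) ∧ (p < y ∧ y < q) ∧ ¬ A j x y := by
      intro j a b p q hab hpq
      by_cases hjc : idx j = c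
      · obtain ⟨x, hx⟩ := exists_between hab
        obtain ⟨y, hy, hyx⟩ := ((Ioo_infinite hpq).sdiff (finite_singleton x)).nonempty
        refine ⟨x, y, hx, hy, ?_⟩
        rintro ⟨v, _, h1, h2⟩
        rw [hjc] at h1
        exact hyx (h2.symm.trans h1)
      · by_contra! hbox
        refine hdim ⟨⟨![idx j, c], ?_⟩, ![a, p], ![b, q], ?_, ?_⟩
        · intro s t hst
          fin_cases s <;> fin_cases t <;> simp_all [eq_comm]
        · intro i
          fin_cases i <;> assumption
        · intro y hy
          obtain ⟨v, hv, h1, h2⟩ := hbox (y 0) (y 1) (hy 0) (hy 1)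
          refine ⟨v, hv, ?_⟩
          ext i
          fin_cases i <;> assumption
    choose κ hκ C hC hCcov hCfun using fun j => exists_cover_of_thin (hA j)
      (fun x y ⟨v, hv, _, h2⟩ => h2 ▸ hb v hv c) (hthin j)
    classical
    refine ⟨Σ j, κ j, inferInstance, fun s => {v | v ∈ Y s.1 ∧ C s.1 s.2 (v (idx s.1)) (v c)},
      fun s => if ∀ x y y', C s.1 s.2 x y → C s.1 s.2 x y' → y = y' then idx s.1 else c,
      fun s => ?_, fun s v hv => hYX _ hv.1, fun v hv => ?_, ?_⟩
    · exact (hY s.1).and ((hC s.1 s.2).app (.var _) (.var _))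
    · obtain ⟨j, hj⟩ := hcov v hv
      obtain ⟨i, hi⟩ := hCcov j _ _ ⟨v, hv, rfl, rfl⟩
      exact ⟨⟨j, i⟩, hj, hi⟩
    · rintro ⟨j, i⟩ u ⟨hu, huC⟩ v ⟨hv, hvC⟩ huv l hl
      have hcase : u (idx j) = v (idx j) ∧ u c = v c := by
        simp only at huv huC hvC
        split_ifs at huv with h
        · exact ⟨huv, h _ _ _ huC (huv ▸ hvC)⟩
        · exact ⟨(hCfun j i).resolve_left h _ _ _ huC (huv ▸ hvC), huv⟩
      rcases Nat.lt_succ_iff_lt_or_eq.1 hl with h | h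
      · exact hdet j u hu v hv hcase.1 l h
      · rw [show l = c from Fin.ext h]
        exact hcase.2

/-- A bounded definable set of dimension at most one has a bounded definable injection into `M`:
the pieces on which a coordinate is injective are moved to disjoint places by translations. -/
theorem exists_definable_injection {n : ℕ} (hn : 0 < n) {X : Set (Fin n → M)} (hX : IsDef L X)
    (hbdd : IsBddSet X) (hdim : ¬ DimAtLeast X 2) :
    ∃ e : (Fin n → M) → M, DF L e ∧ InjOn e X ∧ ∃ lo hi, ∀ v ∈ X, lo ≤ e v ∧ e v ≤ hi := by
  obtain ⟨a, b, hab⟩ := hbdd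
  obtain ⟨lo, hlo⟩ := Finite.exists_ge a
  obtain ⟨hi, hhi⟩ := Finite.exists_le b
  have hb : ∀ v ∈ X, ∀ i, lo ≤ v i ∧ v i ≤ hi := fun v hv i =>
    ⟨(hlo i).trans (hab v hv i).1, (hab v hv i).2.trans (hhi i)⟩
  obtain ⟨ι, hι, Y, idx, hY, hYX, hcov, hdet⟩ := exists_coordinate_cover hn hX hb hdim n le_rfl
  obtain ⟨c, hc⟩ := exists_gt (0 : M)
  have key : ∀ s : Set ι, s.Finite → ∃ e : (Fin n → M) → M, DF L e ∧
      InjOn e {v | ∃ j ∈ s, v ∈ Y j} ∧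
      ∃ lo' hi', ∀ v, (∃ j ∈ s, v ∈ Y j) → lo' ≤ e v ∧ e v ≤ hi' := by
    intro s hs
    induction s, hs using Set.Finite.induction_on with
    | empty => exact ⟨fun _ => 0, .const _, by rintro v ⟨j, hj, _⟩; exact absurd hj (by simp),
        0, 0, by simp⟩
    | @insert j s _ _ ih =>
      obtain ⟨e, he, hinj, lo', hi', hb'⟩ := ih
      classical
      -- translation by `d` moves the image of the union so far above `hi`
      set d := hi - lo' + c with hd
      have hgt : ∀ v, (∃ j ∈ s, v ∈ Y j) → hi < e v + d := fun v hv => by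
        have h1 : hi < hi + c := by simpa using hc
        calc hi < hi + c := h1
          _ = lo' + d := by rw [hd]; abel
          _ ≤ e v + d := by simpa using (hb' v hv).1
      refine ⟨fun v => if v ∈ Y j then v (idx j) else e v + d,
        .ite (hY j) (.var _) (.add he (.const _)), ?_, min lo (lo' + d), max hi (hi' + d), ?_⟩
      · have hrest : ∀ v, (∃ i ∈ insert j s, v ∈ Y i) → v ∉ Y j → ∃ i ∈ s, v ∈ Y i := by
          rintro v ⟨i, rfl | hi, hv⟩ h
          · exact absurd hv h
          · exact ⟨i, hi, hv⟩
        intro u hu v hv huv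
        simp only at huv
        split_ifs at huv with h1 h2 h2
        · exact funext fun l => hdet j u h1 v h2 huv l l.2
        · exact absurd (huv ▸ (hb u (hYX j h1) (idx j)).2) (hgt v (hrest v hv h2)).not_ge
        · exact absurd (huv ▸ (hb v (hYX j h2) (idx j)).2) (hgt u (hrest u hu h1)).not_ge
        · exact hinj (hrest u hu h1) (hrest v hv h2) (add_right_cancel huv)
      · rintro v ⟨i, rfl | hi, hv⟩ <;> beta_reduce
        · rw [if_pos hv]
          exact ⟨(min_le_left _ _).trans (hb v (hYX i hv) _).1,
            (hb v (hYX i hv) _).2.trans (le_max_left _ _)⟩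
        · split_ifs with h
          · exact ⟨(min_le_left _ _).trans (hb v (hYX j h) _).1,
              (hb v (hYX j h) _).2.trans (le_max_left _ _)⟩
          · have := hb' v ⟨i, hi, hv⟩
            exact ⟨(min_le_right _ _).trans (by simpa using this.1),
              le_trans (by simpa using this.2) (le_max_right _ _)⟩
  obtain ⟨e, he, hinj, lo', hi', h⟩ := key univ finite_univ
  have hsub : ∀ v ∈ X, ∃ j ∈ univ, v ∈ Y j := fun v hv => by
    obtain ⟨j, hj⟩ := hcov v hv
    exact ⟨j, trivial, hj⟩
  exact ⟨e, he, hinj.mono hsub, lo', hi', fun v hv => h v (hsub v hv)⟩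

end embed

/-! ### Definable topologies on subsets of the line -/

/-- The family `B` of subsets of `E ⊆ M` is a definable basis of a Hausdorff, regular and definably
connected topology on the infinite bounded definable set `E`. The members of the family are indexed
by tuples `b`, and `a ∈ B b` is a definable condition on `(a, b)`, where the coordinate `none`
stands for `a`. The last two axioms quantify over neighbourhoods given by members of the basis. -/
structure DefBasis (L : FirstOrder.Language) {M β : Type*} [L.Structure M] [LinearOrder M]
    (E : Set M) (B : (β → M) → Set M) : Prop where
  def_E : Def1 L (· ∈ E)
  def_B : Dfp L (fun w : Option β → M => w none ∈ B (fun i => w (some i)))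
  bdd : ∃ lo hi, ∀ x ∈ E, lo ≤ x ∧ x ≤ hi
  inf : E.Infinite
  sub : ∀ b, B b ⊆ E
  cover : ∀ a ∈ E, ∃ b, a ∈ B b
  inter : ∀ a b b', a ∈ B b → a ∈ B b' → ∃ b'', a ∈ B b'' ∧ ∀ x ∈ B b'', x ∈ B b ∧ x ∈ B b'
  t2 : ∀ a ∈ E, ∀ a' ∈ E, a ≠ a' → ∃ b b', a ∈ B b ∧ a' ∈ B b' ∧ ∀ x ∈ B b, x ∉ B b'
  reg : ∀ a b, a ∈ B b → ∃ b', a ∈ B b' ∧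
    ∀ x ∈ E, x ∉ B b → ∃ b'', x ∈ B b'' ∧ ∀ y ∈ B b'', y ∉ B b'
  conn : ∀ W : Set M, Def1 L (· ∈ W) → W ⊆ E → (∀ a ∈ W, ∃ b, a ∈ B b ∧ B b ⊆ W) →
    (∀ a ∈ E, a ∉ W → ∃ b, a ∈ B b ∧ ∀ x ∈ B b, x ∉ W) → W.Nonempty → W = E

/-- The germ of `M` at `z` on the side `s` converges to the point `a` of `E` in the topology with
basis `B`. -/
def Lim {M β : Type*} [LinearOrder M] [TopologicalSpace M] (E : Set M) (B : (β → M) → Set M)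
    (s : Bool) (z a : M) : Prop :=
  a ∈ E ∧ ∀ b, a ∈ B b → ∀ᶠ x in sd s z, x ∈ B b

section core

variable {L : FirstOrder.Language} {M : Type*} [L.Structure M] [AddCommGroup M] [LinearOrder M]
  [IsOrderedAddMonoid M] [hM : Fact (IsOMinimalExpansion L M)] [DenselyOrdered M] [Nontrivial M]
  [TopologicalSpace M] [OrderTopology M]

theorem eventually_sd_notMem {K : Set M} (hK : K.Finite) (s : Bool) (z : M) :
    ∀ᶠ x in sd s z, x ∉ K := by
  have : ∀ᶠ y in 𝓝 z, y ∉ K \ {z} :=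
    (hK.subset sdiff_subset).isClosed.isOpen_compl.mem_nhds fun h => h.2 rfl
  filter_upwards [this.filter_mono (sd_le_nhds s z), sd_ne s z] with x h1 h2 h3
  exact h1 ⟨h3, h2⟩

/-- A definable condition holding on some germ at each point of a germ holds along this germ. -/
theorem Def1.sd_of_sd {P : M → Prop} (hP : Def1 L P) {s t : Bool} {z : M}
    (h : ∀ᶠ v in sd t z, ∀ᶠ x in sd s v, P x) : ∀ᶠ x in sd t z, P x := by
  refine (hP.sd_or t z).resolve_right fun hn => ?_
  obtain ⟨v, h1, h2⟩ := (h.and (sd_eventually_nhds hn)).exists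
  obtain ⟨x, h3, h4⟩ := (h1.and (h2.filter_mono (sd_le_nhds s v))).exists
  exact h4 h3

theorem Def1.finite_not_locally {P : M → Prop} (hP : Def1 L P) :
    {z | ¬ ((∀ᶠ w in 𝓝 z, P w) ∨ ∀ᶠ w in 𝓝 z, ¬ P w)}.Finite := by
  refine Def1.finite_of_forall (L := L) ?_ fun a b hab => ?_
  · unfold Def1
    simp (maxDischargeDepth := 9) [hP.app, -not_or, -not_eventually]
  · obtain ⟨a', b', h1, h2, h3, h4⟩ := hP.decide hab
    obtain ⟨x, hx, hx'⟩ := exists_between h2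
    refine ⟨x, h1.trans_lt hx, hx'.trans_le h3, not_not.2 ?_⟩
    have hIoo : ∀ᶠ w in 𝓝 x, a' < w ∧ w < b' := Ioo_mem_nhds hx hx'
    exact h4.imp (fun h => hIoo.mono fun w hw => h w hw.1 hw.2)
      fun h => hIoo.mono fun w hw => h w hw.1 hw.2

/-- A definable function takes only finitely many values at points where it is locally constant. -/
theorem DF1.finite_image_locally_const {f : M → M} (hf : DF1 L f) :
    (f '' {z | ∀ᶠ x in 𝓝 z, f x = f z}).Finite := by
  have hd : Def1 L (fun z => ∀ᶠ x in 𝓝 z, f x = f z) := by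
    unfold Def1; simp (maxDischargeDepth := 9) [hf.app]
  obtain ⟨S, hS, hSI, hU⟩ := hM.out.finite_union {z | ∀ᶠ x in 𝓝 z, f x = f z} hd
  rw [hU, image_sUnion]
  refine (hS.image _).sUnion ?_
  rintro _ ⟨I, hI, rfl⟩
  have hconv : I.OrdConnected := by
    rcases hSI I hI with ⟨a, rfl⟩ | ⟨a, b, rfl⟩ | ⟨a, rfl⟩ | ⟨b, rfl⟩ | rfl
    exacts [ordConnected_singleton, ordConnected_Ioo, ordConnected_Ioi, ordConnected_Iio,
      ordConnected_univ]
  have hloc : ∀ z ∈ I, ∀ᶠ x in 𝓝 z, f x = f z := fun z hz => by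
    have : z ∈ {z | ∀ᶠ x in 𝓝 z, f x = f z} := hU ▸ ⟨I, hI, hz⟩
    exact this
  refine Set.Subsingleton.finite ?_
  rintro _ ⟨x, hx, rfl⟩ _ ⟨y, hy, rfl⟩
  wlog hxy : x ≤ y generalizing x y
  · exact (this y hy x hx (le_of_not_ge hxy)).symm
  have hd' : Def1 L (fun w => f w = f x) := by unfold Def1; simp [hf.app]
  refine (hd'.connected hxy (fun z h1 h2 h3 => ?_) (fun z h1 h2 h3 => ?_) rfl).symm
  · exact (hloc z (hconv.out hx hy ⟨h1, h2⟩)).mono fun w hw => hw.trans h3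
  · exact (hloc z (hconv.out hx hy ⟨h1, h2⟩)).mono fun w hw hw' => h3 (hw.symm.trans hw')

theorem StrictAt.continuousAt {f : M → M} {r : Bool} {z : M} (h : StrictAt f r z) :
    ContinuousAt f z := by
  intro U hU
  exact eventually_nhds_of_sd (P := fun x => f x ∈ U) (mem_of_mem_nhds hU) fun s =>
    (h s).eventually (sd_le_nhds _ _ hU)

variable {β : Type*} [Finite β] {E : Set M} {B : (β → M) → Set M}

theorem DefBasis.def1_B (hD : DefBasis L E B) (b : β → M) : Def1 L (· ∈ B b) :=
  Dfp.subst (t := fun o : Option β => o.elim (fun w : Fin 1 → M => w 0) fun i _ => b i) hD.def_B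
    (by rintro (_ | _) <;> simp)

theorem DefBasis.dfp_mem (hD : DefBasis L E B) {α : Type*} {t : (α → M) → M} {c : β → (α → M) → M}
    (ht : DF L t) (hc : ∀ i, DF L (c i)) : Dfp L (fun v => t v ∈ B (fun i => c i v)) :=
  Dfp.subst (t := fun o : Option β => o.elim t c) hD.def_B (by rintro (_ | _) <;> simp [ht, hc])

theorem DefBasis.def2_lim (hD : DefBasis L E B) (s : Bool) : Def2 L (Lim E B s) := by
  refine .and (hD.def_E.app (.var _)) (.allTuple (.imp ?_ (.sd ?_ (.var _))))
  · exact hD.dfp_mem (.var _) fun i => .var _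
  · exact hD.dfp_mem (.var _) fun i => .var _

theorem DefBasis.lim_unique (hD : DefBasis L E B) {s : Bool} {z a a' : M} (h : Lim E B s z a)
    (h' : Lim E B s z a') : a = a' := by
  by_contra hne
  obtain ⟨b, b', hb, hb', hdis⟩ := hD.t2 a h.1 a' h'.1 hne
  obtain ⟨x, hx, hx'⟩ := ((h.2 b hb).and (h'.2 b' hb')).exists
  exact hdis x hx hx'

/-- A definable set is a neighbourhood of its point `a` if it contains all germs converging
to `a`. -/
theorem DefBasis.exists_subset_of_lim (hD : DefBasis L E B) {W : Set M} (hW : Def1 L (· ∈ W))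
    {a : M} (haE : a ∈ E) (haW : a ∈ W)
    (h : ∀ s z, Lim E B s z a → ∀ᶠ x in sd s z, x ∈ W) : ∃ b, a ∈ B b ∧ B b ⊆ W := by
  by_contra! hcon
  obtain ⟨lo, hi, hlh⟩ := hD.bdd
  obtain ⟨z, _, _, hz⟩ := exists_cluster (L := L) (Λ := fun b => a ∈ B b)
    (S := fun b x => x ∈ B b ∧ x ∉ W) (lo := lo) (hi := hi)
    (hD.dfp_mem (.const _) fun i => .var i)
    (.and (hD.dfp_mem (.var _) fun i => .var _) (.not (hW.app (.var _))))
    (fun b _ x hx => hlh x (hD.sub b hx.1)) (hD.cover a haE)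
    (fun b hb => not_subset.1 (hcon b hb))
    (fun b b' hb hb' => by
      obtain ⟨b'', h1, h2⟩ := hD.inter a b b' hb hb'
      exact ⟨b'', h1, fun x hx => ⟨⟨(h2 x hx.1).1, hx.2⟩, ⟨(h2 x hx.1).2, hx.2⟩⟩⟩)
  rcases hz with hz | ⟨s, hz⟩
  · obtain ⟨b0, hb0⟩ := hD.cover a haE
    have hza : a ≠ z := fun h => (hz b0 hb0).2 (h ▸ haW)
    obtain ⟨b, b', hb, hb', hdis⟩ := hD.t2 a haE z (hD.sub b0 (hz b0 hb0).1) hza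
    exact hdis z (hz b hb).1 hb'
  · have hlim : Lim E B s z a := ⟨haE, fun b hb => (hz b hb).mono fun x hx => hx.1⟩
    obtain ⟨b0, hb0⟩ := hD.cover a haE
    obtain ⟨x, hx, hx'⟩ := ((h s z hlim).and (hz b0 hb0)).exists
    exact hx'.2 hx

/-- By definable connectedness there are no isolated points, so every point is the limit of a
germ. -/
theorem DefBasis.exists_lim (hD : DefBasis L E B) {a : M} (ha : a ∈ E) : ∃ s z, Lim E B s z a := by
  by_contra! hcon
  have hd : Def1 L (· ∈ ({a} : Set M)) := by unfold Def1; simp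
  have := hD.conn {a} hd (by simpa using ha)
    (fun a' ha' => by
      obtain rfl : a' = a := ha'
      exact hD.exists_subset_of_lim hd ha rfl fun s z h => absurd h (hcon s z))
    (fun a' ha' hne => by
      obtain ⟨b, b', hb, hb', hdis⟩ := hD.t2 a' ha' a ha hne
      exact ⟨b, hb, fun x hx hxa => hdis x hx (hxa ▸ hb')⟩)
    ⟨a, rfl⟩
  exact hD.inf (this ▸ finite_singleton a)

/-- The limits of the germs on each side are given by a definable function, with junk values where
the limit does not exist. -/
theorem DefBasis.exists_limFun (hD : DefBasis L E B) : ∃ f : Bool → M → M, (∀ s, DF1 L (f s)) ∧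
    ∀ s z a, Lim E B s z a → f s z = a := by
  choose f hf hfl using fun s => (hD.def2_lim s).exists_function fun x y y' => hD.lim_unique
  exact ⟨f, hf, fun s z a h => hD.lim_unique (hfl s z ⟨a, h⟩) h⟩

/-- By regularity, the limits of the germs at points approaching `z` from the side `s` converge to
the limit `f z` of the germ at `z`. If these limits form a germ at `f z`, that germ converges to
`f z`. -/
theorem DefBasis.lim_self_of_strictAt (hD : DefBasis L E B) {f : M → M} {s r : Bool} {z : M}
    (hz : Lim E B s z (f z)) (hev : ∀ᶠ w in sd s z, Lim E B s w (f w)) (hr : StrictAt f r z) :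
    Lim E B (s ^^ r) (f z) (f z) := by
  refine ⟨hz.1, fun b hb => ?_⟩
  obtain ⟨b', hb', hsep⟩ := hD.reg _ b hb
  have h1 : ∀ᶠ w in sd s z, f w ∈ B b := by
    filter_upwards [hev, sd_eventually_nhds (hz.2 b' hb')] with w hw hw'
    by_contra hn
    obtain ⟨b'', h2, h3⟩ := hsep _ hw.1 hn
    obtain ⟨x, hx, hx'⟩ := ((hw.2 b'' h2).and (hw'.filter_mono (sd_le_nhds s w))).exists
    exact h3 x hx hx'
  exact (hD.def1_B b).sd_of_frequently ((hr s).frequently h1.frequently)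

/-- The generic behaviour of the germs at a point `z`, outside a finite set `F`: `z` lies in the
interior of `E` or of its complement, and the limit of the germ on either side either does not
exist near `z`, or exists near `z` and is continuous and strictly monotone there. -/
def GenericOff (E : Set M) (B : (β → M) → Set M) (f : Bool → M → M) (F : Set M) : Prop :=
  ∀ z ∉ F, ((∀ᶠ w in 𝓝 z, w ∈ E) ∨ ∀ᶠ w in 𝓝 z, w ∉ E) ∧
    ∀ s, (∀ᶠ w in 𝓝 z, ∀ a, ¬ Lim E B s w a) ∨
      ((∀ᶠ w in 𝓝 z, Lim E B s w (f s w)) ∧ ∃ r, StrictAt (f s) r z)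

/-- All but finitely many points `z` are generic, and a point `c` of `E` is the limit of one of its
own germs, except for finitely many `c`. No limit function is constant on an interval: some
point `c` of it, other than the constant, is the limit of one of its own germs, while every
neighbourhood of the constant meets this germ arbitrarily close to `c`. -/
theorem DefBasis.exists_genericOff (hD : DefBasis L E B) {f : Bool → M → M}
    (hf : ∀ s, DF1 L (f s)) (hfl : ∀ s z a, Lim E B s z a → f s z = a) :
    ∃ F : Set M, F.Finite ∧ GenericOff E B f F ∧ ∀ c ∈ E, c ∉ F → ∃ r, Lim E B r c c := by
  have hdl : ∀ s, Def1 L (fun w => ∃ a, Lim E B s w a) := fun s =>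
    .ex ((hD.def2_lim s).app (.var _) (.var _))
  have hspec : ∀ s w, (∃ a, Lim E B s w a) → Lim E B s w (f s w) := fun s w ⟨a, ha⟩ => by
    rwa [hfl s w a ha]
  -- the points where the germs do not behave uniformly
  let F0 : Set M := {z | ¬ ((∀ᶠ w in 𝓝 z, w ∈ E) ∨ ∀ᶠ w in 𝓝 z, w ∉ E)} ∪
    ⋃ s, ({z | ¬ ((∀ᶠ w in 𝓝 z, ∃ a, Lim E B s w a) ∨ ∀ᶠ w in 𝓝 z, ¬ ∃ a, Lim E B s w a)} ∪
      {z | ¬ ((∀ᶠ x in 𝓝 z, f s x = f s z) ∨ ∃ r, StrictAt (f s) r z)})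
  have hF0 : F0.Finite := hD.def_E.finite_not_locally.union
    (finite_iUnion fun s => (hdl s).finite_not_locally.union (hf s).finite_not_strictAt)
  have hF0E : ∀ z ∉ F0, (∀ᶠ w in 𝓝 z, w ∈ E) ∨ ∀ᶠ w in 𝓝 z, w ∉ E := fun z hz => by
    by_contra h
    exact hz (.inl h)
  have hF0l : ∀ z ∉ F0, ∀ s, (∀ᶠ w in 𝓝 z, ∃ a, Lim E B s w a) ∨
      ∀ᶠ w in 𝓝 z, ¬ ∃ a, Lim E B s w a := fun z hz s => by
    by_contra h
    exact hz (.inr (mem_iUnion.2 ⟨s, .inl h⟩))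
  have hF0s : ∀ z ∉ F0, ∀ s, (∀ᶠ x in 𝓝 z, f s x = f s z) ∨ ∃ r, StrictAt (f s) r z :=
    fun z hz s => by
    by_contra h
    exact hz (.inr (mem_iUnion.2 ⟨s, .inr h⟩))
  let C : Set M := ⋃ s, (f s '' F0 ∪ f s '' {z | ∀ᶠ x in 𝓝 z, f s x = f s z})
  have hC : C.Finite := finite_iUnion fun s =>
    (hF0.image _).union (hf s).finite_image_locally_const
  have hCl : ∀ c ∈ E, c ∉ C → ∃ r, Lim E B r c c := by
    intro c hc hcC
    obtain ⟨s, z, hz⟩ := hD.exists_lim hc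
    have hfz := hfl s z c hz
    have hzF : z ∉ F0 := fun h => hcC (mem_iUnion.2 ⟨s, .inl ⟨z, h, hfz⟩⟩)
    rcases hF0s z hzF s with h | ⟨r, h⟩
    · exact absurd (mem_iUnion.2 ⟨s, .inr ⟨z, h, hfz⟩⟩) hcC
    · refine ⟨s ^^ r, ?_⟩
      have hev : ∀ᶠ w in 𝓝 z, ∃ a, Lim E B s w a :=
        (hF0l z hzF s).resolve_right fun h => h.self_of_nhds ⟨c, hz⟩
      have := hD.lim_self_of_strictAt (f := f s) (s := s) (hfz ▸ hz)
        ((hev.filter_mono (sd_le_nhds s z)).mono fun w hw => hspec s w hw) h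
      rwa [hfz] at this
  -- no point attracts all germs on one side at the points of an interval
  let K : Bool → Set M := fun s => {z | (∃ a, Lim E B s z a) ∧ ∀ᶠ x in 𝓝 z, f s x = f s z}
  have hK : ∀ s, (K s).Finite := by
    intro s
    refine Def1.finite_of_forall (L := L)
      (P := fun z => (∃ a, Lim E B s z a) ∧ ∀ᶠ x in 𝓝 z, f s x = f s z) ?_ fun a b hab => ?_
    · exact .and ((hdl s).app (.var _)) (by simp (maxDischargeDepth := 9) [(hf s).app])
    by_contra! hcon
    obtain ⟨x0, hx0, hx0'⟩ := exists_between hab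
    have hev : ∀ᶠ w in 𝓝 x0, (a < w ∧ w < b) ∧ f s w = f s x0 :=
      (show ∀ᶠ w in 𝓝 x0, a < w ∧ w < b from Ioo_mem_nhds hx0 hx0').and (hcon x0 hx0 hx0').2
    obtain ⟨a1, b1, h1, h2, h3⟩ := mem_nhds_iff_Ioo.1 hev
    set c0 := f s x0
    have hlim : ∀ w, a1 < w → w < b1 → Lim E B s w c0 := fun w hw hw' => by
      obtain ⟨hwab, hwc⟩ := h3 w hw hw'
      rw [← show f s w = c0 from hwc]
      exact hspec s w (hcon w hwab.1 hwab.2).1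
    obtain ⟨a2, b2, h4, h5, h6, h7⟩ := hD.def_E.decide (h1.trans h2)
    have hE : ∀ w, a2 < w → w < b2 → w ∈ E := by
      rcases h7 with h7 | h7
      · exact h7
      · obtain ⟨w, hw, hw'⟩ := exists_between h5
        have hl := hlim w (h4.trans_lt hw) (hw'.trans_le h6)
        obtain ⟨b, hb⟩ := hD.cover c0 hl.1
        have hin : ∀ᶠ x in 𝓝 w, a2 < x ∧ x < b2 := Ioo_mem_nhds hw hw'
        obtain ⟨x, hx, hx'⟩ := ((hl.2 b hb).and (hin.filter_mono (sd_le_nhds s w))).exists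
        exact absurd (hD.sub b hx) (h7 x hx'.1 hx'.2)
    obtain ⟨c, hc, hc'⟩ := ((Ioo_infinite h5).sdiff (hC.union (finite_singleton c0))).nonempty
    obtain ⟨r, hr⟩ := hCl c (hE c hc.1 hc.2) fun h => hc' (.inl h)
    obtain ⟨b, b', hb, hb', hdis⟩ := hD.t2 c hr.1 c0
      (hlim c (h4.trans_lt hc.1) (hc.2.trans_le h6)).1
      fun h => hc' (.inr h)
    have hin : ∀ᶠ x in 𝓝 c, a2 < x ∧ x < b2 := Ioo_mem_nhds hc.1 hc.2
    obtain ⟨w, hw, hw'⟩ := ((sd_eventually_nhds (hr.2 b hb)).and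
      (hin.filter_mono (sd_le_nhds r c))).exists
    obtain ⟨x, hx, hx'⟩ := ((hw.filter_mono (sd_le_nhds s w)).and
      ((hlim w (h4.trans_lt hw'.1) (hw'.2.trans_le h6)).2 b' hb')).exists
    exact hdis x hx hx'
  refine ⟨F0 ∪ ⋃ s, K s ∪ C, hF0.union (finite_iUnion fun s => (hK s).union hC), ?_, ?_⟩
  · intro z hz
    have hzF : z ∉ F0 := fun h => hz (.inl h)
    refine ⟨hF0E z hzF, fun s => ?_⟩
    rcases hF0l z hzF s with h | h
    · refine .inr ⟨h.mono fun w hw => hspec s w hw, (hF0s z hzF s).resolve_left fun hc => ?_⟩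
      exact hz (.inr (mem_iUnion.2 ⟨s, .inl ⟨h.self_of_nhds, hc⟩⟩))
    · exact .inl (h.mono fun w hw a ha => hw ⟨a, ha⟩)
  · intro c hc hcF
    exact hCl c hc fun h => hcF (.inr (mem_iUnion.2 ⟨true, .inr h⟩))

end core

/-! ### The topology is affine away from a finite set -/

section clopen

variable {L : FirstOrder.Language} {M : Type*} [L.Structure M] [AddCommGroup M] [LinearOrder M]
  [IsOrderedAddMonoid M] [hM : Fact (IsOMinimalExpansion L M)] [DenselyOrdered M] [Nontrivial M]
  [TopologicalSpace M] [OrderTopology M]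

variable {β : Type*} [Finite β] {E : Set M} {B : (β → M) → Set M} {f : Bool → M → M} {F : Set M}

theorem GenericOff.of_lim (hG : GenericOff E B f F) (hfl : ∀ s z a, Lim E B s z a → f s z = a)
    {s : Bool} {z a : M} (hz : z ∉ F) (h : Lim E B s z a) :
    f s z = a ∧ (∀ᶠ w in 𝓝 z, Lim E B s w (f s w)) ∧ ∃ r, StrictAt (f s) r z := by
  rcases (hG z hz).2 s with h' | h'
  · exact absurd h (h'.self_of_nhds a)
  · exact ⟨hfl s z a h, h'⟩

/-- If a generic germ at `w` converges to `c`, then one of the germs at `c` converges to `c`, and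
the limit of the other one, if it exists, is the limit of the other germ at `w`. -/
theorem DefBasis.lim_chain (hD : DefBasis L E B) (hfl : ∀ s z a, Lim E B s z a → f s z = a)
    (hG : GenericOff E B f F) {s : Bool} {w c : M} (hw : w ∉ F) (h : Lim E B s w c) :
    ∃ r, Lim E B r c c ∧ Tendsto (f s) (sd s w) (sd r c) ∧
      Tendsto (f s) (sd (!s) w) (sd (!r) c) ∧ ∀ c', Lim E B (!r) c c' → Lim E B (!s) w c' := by
  obtain ⟨rfl, hev, r, hr⟩ := hG.of_lim hfl hw h
  have h2 := hr (!s)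
  rw [show (!s ^^ r) = !(s ^^ r) by cases s <;> cases r <;> rfl] at h2
  refine ⟨s ^^ r, hD.lim_self_of_strictAt h (hev.filter_mono (sd_le_nhds _ _)) hr, hr s, h2,
    fun c' hc' => ⟨hc'.1, fun b hb => (hD.def1_B b).sd_of_sd (s := s) ?_⟩⟩
  filter_upwards [h2.eventually (hc'.2 b hb), hev.filter_mono (sd_le_nhds _ _)] with v hv hv'
  exact hv'.2 b hv

theorem StrictAt.infinite_image {f : M → M} {r : Bool} {z p q : M} (h : StrictAt f r z)
    (hp : p < z) (hq : z < q) {K : Set M} (hK : K.Finite) :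
    {x | ∃ c, (p < c ∧ c < q) ∧ c ∉ K ∧ f c = x}.Infinite := by
  intro hfin
  have h1 := (h true).eventually (eventually_sd_notMem hfin _ _)
  have hin : ∀ᶠ x in 𝓝 z, p < x ∧ x < q := Ioo_mem_nhds hp hq
  obtain ⟨x, hx, hx', hxK⟩ := (h1.and ((hin.filter_mono (sd_le_nhds true z)).and
    (eventually_sd_notMem hK _ _))).exists
  exact hx ⟨x, hx', hxK, rfl⟩

/-- If infinitely many points of `E` are not the limits of both their germs, then there is an
interval of points `c` such that only the germ on the side `r` converges to `c`, and such that
whenever the other germ converges to some `x`, a germ at `x` converges to `c`. -/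
theorem DefBasis.exists_interval (hD : DefBasis L E B)
    (hfl : ∀ s z a, Lim E B s z a → f s z = a) (hF : F.Finite) (hG : GenericOff E B f F)
    (hFl : ∀ c ∈ E, c ∉ F → ∃ r, Lim E B r c c)
    (hinf : {c | c ∈ E ∧ ¬ ∀ s, Lim E B s c c}.Infinite) :
    ∃ r p q, p < q ∧ ∀ c, p < c → c < q → Lim E B r c c ∧ ¬ Lim E B (!r) c c ∧
      ∀ x, Lim E B (!r) c x → ∃ s, Lim E B s x c := by
  have hdl := hD.def2_lim
  have hself : ∀ r, Def1 L (fun c => Lim E B r c c ∧ ¬ Lim E B (!r) c c) := fun r =>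
    .and ((hdl r).app (.var _) (.var _)) (.not ((hdl _).app (.var _) (.var _)))
  obtain ⟨r, hr⟩ : ∃ r, {c | Lim E B r c c ∧ ¬ Lim E B (!r) c c}.Infinite := by
    by_contra! hcon
    refine hinf ((hF.union (finite_iUnion hcon)).subset fun c hc => ?_)
    by_cases hcF : c ∈ F
    · exact .inl hcF
    · obtain ⟨r, hr⟩ := hFl c hc.1 hcF
      refine .inr (mem_iUnion.2 ⟨r, hr, fun h => hc.2 fun s => ?_⟩)
      rcases Bool.eq_or_eq_not s r with rfl | rfl
      · exact hr
      · exact h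
  obtain ⟨p, q, hpq, hI⟩ := (hself r).exists_Ioo hr
  have hGd : Def1 L (fun c => ∀ x, Lim E B (!r) c x → ∃ s, Lim E B s x c) :=
    .all (.imp ((hdl _).app (.var _) (.var _))
      (.exFin fun s => (hdl s).app (.var _) (.var _)))
  obtain ⟨p1, q1, h1, h2, h3, h4⟩ := hGd.decide hpq
  rcases h4 with h4 | h4
  · refine ⟨r, p1, q1, h2, fun c hc hc' => ?_⟩
    have := hI c (h1.trans_lt hc) (hc'.trans_le h3)
    exact ⟨this.1, this.2, h4 c hc hc'⟩
  -- otherwise the limits of the germs on the side `!r` are points with only one convergent germ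
  have h4' : ∀ c, p1 < c → c < q1 → Lim E B (!r) c (f (!r) c) ∧ ∀ s, ¬ Lim E B s (f (!r) c) c := by
    intro c hc hc'
    have := h4 c hc hc'
    push Not at this
    obtain ⟨x, hx, hxs⟩ := this
    rw [hfl _ _ _ hx]
    exact ⟨hx, hxs⟩
  have hFd : Def1 L (· ∈ F) := by
    obtain ⟨n, e, _, he⟩ := hF.fin_param
    refine Dfp.congr (P := fun v : Fin 1 → M => ∃ i, e i = v 0) (.exFin fun i => by simp)
      fun v => ?_
    rw [← he]; rfl
  obtain ⟨c0, hc0, hc0F⟩ := ((Ioo_infinite h2).sdiff hF).nonempty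
  obtain ⟨_, _, ρ, hρ⟩ := hG.of_lim hfl hc0F (h4' c0 hc0.1 hc0.2).1
  have hKinf := hρ.infinite_image hc0.1 hc0.2 hF
  have hcover : {x | ∃ c, (p1 < c ∧ c < q1) ∧ c ∉ F ∧ f (!r) c = x} ⊆
      ⋃ r, {x | Lim E B r x x ∧ ∀ y, ¬ Lim E B (!r) x y} ∪ F := by
    rintro x ⟨c, ⟨hc, hc'⟩, hcF, rfl⟩
    obtain ⟨hcx, hno⟩ := h4' c hc hc'
    by_cases hxF : f (!r) c ∈ F
    · exact mem_iUnion.2 ⟨true, .inr hxF⟩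
    obtain ⟨r', hr', _, _, hchain⟩ := hD.lim_chain hfl hG hcF hcx
    refine mem_iUnion.2 ⟨r', .inl ⟨hr', fun y hy => ?_⟩⟩
    have := hchain y hy
    rw [Bool.not_not] at this
    have hcc := (hI c (h1.trans_lt hc) (hc'.trans_le h3)).1
    rw [hD.lim_unique this hcc] at hy
    exact hno _ hy
  obtain ⟨r', hr'⟩ : ∃ r', {x | Lim E B r' x x ∧ ∀ y, ¬ Lim E B (!r') x y}.Infinite := by
    by_contra! hcon
    exact hKinf ((finite_iUnion fun r => (hcon r).union hF).subset hcover)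
  obtain ⟨p2, q2, h5, h6⟩ := Def1.exists_Ioo (L := L)
    (P := fun x => Lim E B r' x x ∧ ∀ y, ¬ Lim E B (!r') x y)
    (.and ((hdl _).app (.var _) (.var _)) (.all (.not ((hdl _).app (.var _) (.var _))))) hr'
  exact ⟨r', p2, q2, h5, fun c hc hc' => ⟨(h6 c hc hc').1, (h6 c hc hc').2 c,
    fun x hx => absurd hx ((h6 c hc hc').2 x)⟩⟩

/-- Every interval contains a closed interval that contains none of the germs of finitely many
functions along proper filters. -/
theorem exists_Icc_avoiding {T : Set (Filter M × (M → M))} (hT : T.Finite)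
    (hne : ∀ t ∈ T, t.1.NeBot) {p q : M} (hpq : p < q) :
    ∃ d e, p < d ∧ d < e ∧ e < q ∧ ∀ t ∈ T, ¬ ∀ᶠ w in t.1, d ≤ t.2 w ∧ t.2 w ≤ e := by
  induction T, hT using Set.Finite.induction_on with
  | empty =>
    obtain ⟨d, h1, h2⟩ := exists_between hpq
    obtain ⟨e, h3, h4⟩ := exists_between h2
    exact ⟨d, e, h1, h3, h4, by simp⟩
  | @insert t T _ _ ih =>
    obtain ⟨d, e, h1, h2, h3, h4⟩ := ih fun t ht => hne t (.inr ht)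
    obtain ⟨u, h5, h6⟩ := exists_between h2
    obtain ⟨v, h7, h8⟩ := exists_between h6
    have := hne t (.inl rfl)
    have hmono : ∀ t' ∈ T, ∀ d' e', d ≤ d' → e' ≤ e → ¬ ∀ᶠ w in t'.1, d' ≤ t'.2 w ∧ t'.2 w ≤ e' :=
      fun t' ht' d' e' hd he h => h4 t' ht' (h.mono fun w hw => ⟨hd.trans hw.1, hw.2.trans he⟩)
    by_cases h : ∀ᶠ w in t.1, d ≤ t.2 w ∧ t.2 w ≤ u
    · refine ⟨v, e, h1.trans (h5.trans h7), h8, h3, ?_⟩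
      rintro t' (rfl | ht')
      · intro h'
        obtain ⟨w, hw, hw'⟩ := (h.and h').exists
        exact absurd (hw'.1.trans hw.2) h7.not_ge
      · exact hmono t' ht' _ _ (h5.trans h7).le le_rfl
    · refine ⟨d, u, h1, h5, h6.trans h3, ?_⟩
      rintro t' (rfl | ht')
      · exact h
      · exact hmono t' ht' _ _ le_rfl h6.le

theorem le_of_eventually_sd {d e : M} {t : Bool} {x : M}
    (h : ∀ᶠ w in sd t x, d ≤ w ∧ w ≤ e) : d ≤ x ∧ x ≤ e := by
  have hlim : Tendsto id (sd t x) (𝓝 x) := sd_le_nhds t x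
  exact ⟨ge_of_tendsto hlim (h.mono fun w hw => hw.1), le_of_tendsto hlim (h.mono fun w hw => hw.2)⟩

variable (L) in
include hM in
theorem eventually_Ioo_of_Icc {d e : M} {t : Bool} {x : M}
    (h : ∃ᶠ w in sd t x, d ≤ w ∧ w ≤ e) : ∀ᶠ w in sd t x, d < w ∧ w < e := by
  have hd : Def1 L (fun w : M => d ≤ w ∧ w ≤ e) := by unfold Def1; simp
  filter_upwards [hd.sd_of_frequently h, eventually_sd_notMem (toFinite {d, e}) t x] with w hw hw'
  simp only [mem_insert_iff, mem_singleton_iff, not_or] at hw'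
  exact ⟨lt_of_le_of_ne hw.1 (Ne.symm hw'.1), lt_of_le_of_ne hw.2 hw'.2⟩

/-- The configuration of `DefBasis.exists_interval`, in general position with respect to the finite
set `F`, contradicts definable connectedness. Let `[d, e]` be a subinterval and `T t` the set of
points whose germ on the side `t` lies in `(d, e)`: this is a half-open interval. Then `T r`,
together with the points outside `[d, e]` one of whose germs converges to a point of `T (!r)`, is
open and closed. The hypotheses `hgen` and `havoid` express general position: a germ converging into
`[d, e]`, and any germ converging to the base point of such a germ, has base point outside `F`, and
no function `f s'` maps a germ at a point of `F` into `[d, e]`. -/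
theorem DefBasis.false_of_interval (hD : DefBasis L E B)
    (hfl : ∀ s z a, Lim E B s z a → f s z = a) (hG : GenericOff E B f F)
    (hFl : ∀ c ∈ E, c ∉ F → ∃ r, Lim E B r c c) {r : Bool} {p d e q : M} (hpd : p < d)
    (hde : d < e) (heq : e < q)
    (hI : ∀ c, p < c → c < q → Lim E B r c c ∧ ¬ Lim E B (!r) c c ∧
      ∀ x, Lim E B (!r) c x → (∃ s, Lim E B s x c) ∧ ¬ (p < x ∧ x < q))
    (hgen : ∀ x, d ≤ x → x ≤ e → ∀ s w, Lim E B s w x → w ∉ F ∧ ∀ s' v, Lim E B s' v w → v ∉ F)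
    (havoid : ∀ z ∈ F, ∀ s s', ¬ ∀ᶠ w in sd s z, d ≤ f s' w ∧ f s' w ≤ e) : False := by
  have hdl := hD.def2_lim
  let T : Bool → M → Prop := fun t x => ∀ᶠ w in sd t x, d < w ∧ w < e
  have hT : ∀ t, Def1 L (T t) := fun t => by unfold Def1; simp (maxDischargeDepth := 9) [T]
  have hTle : ∀ {t x}, T t x → d ≤ x ∧ x ≤ e := fun h =>
    le_of_eventually_sd (h.mono fun w hw => ⟨hw.1.le, hw.2.le⟩)
  have hTlt : ∀ {t x}, d < x → x < e → T t x := fun {t x} h h' =>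
    (show ∀ᶠ w in 𝓝 x, d < w ∧ w < e from Ioo_mem_nhds h h').filter_mono (sd_le_nhds t x)
  have hIc : ∀ {c}, d ≤ c → c ≤ e → p < c ∧ c < q := fun h h' =>
    ⟨hpd.trans_le h, h'.trans_lt heq⟩
  -- the germs at the points of the interval
  have hIr : ∀ {c s a}, p < c → c < q → Lim E B s c a →
      s = r ∧ a = c ∨ s = (!r) ∧ (∃ s', Lim E B s' a c) ∧ ¬ (p < a ∧ a < q) := by
    intro c s a hc hc' h
    obtain ⟨h1, _, h3⟩ := hI c hc hc'
    rcases Bool.eq_or_eq_not s r with rfl | rfl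
    · exact .inl ⟨rfl, hD.lim_unique h h1⟩
    · exact .inr ⟨rfl, h3 a h⟩
  have hr : ∀ {c t}, d ≤ c → c ≤ e → Lim E B t c c → t = r := fun {c t} h h' hl => by
    rcases hIr (hIc h h').1 (hIc h h').2 hl with h'' | h''
    · exact h''.1
    · exact absurd (hIc h h') h''.2.2
  have hout : ∀ {z : M}, ¬ (d ≤ z ∧ z ≤ e) → ∀ s, ∀ᶠ w in sd s z, ¬ (d ≤ w ∧ w ≤ e) :=
    fun {z} hz s => (isClosed_Icc.isOpen_compl.mem_nhds (show z ∈ (Icc d e)ᶜ from hz)) |>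
      sd_le_nhds s z
  have hEv : ∀ {s z a}, Lim E B s z a → ∀ᶠ w in sd s z, w ∈ E := fun {s z a} h => by
    obtain ⟨b, hb⟩ := hD.cover a h.1
    exact (h.2 b hb).mono fun w hw => hD.sub b hw
  let W : M → Prop := fun x =>
    x ∈ E ∧ (T r x ∨ ¬ (d ≤ x ∧ x ≤ e) ∧ ∃ s, ∃ c, T (!r) c ∧ Lim E B s x c)
  have hW : Def1 L W := by
    refine .and (hD.def_E.app (.var _)) (.or ((hT _).app (.var _)) (.and (by simp) ?_))
    exact .exFin fun s => .ex (.and ((hT _).app (.var _)) ((hdl s).app (.var _) (.var _)))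
  have hWlt : ∀ {x}, d < x → x < e → W x := fun h h' =>
    ⟨(hI _ (hpd.trans h) (h'.trans heq)).1.1, .inl (hTlt h h')⟩
  -- `W` contains all germs converging to its points
  have hopen : ∀ a, W a → ∀ s z, Lim E B s z a → ∀ᶠ w in sd s z, W w := by
    rintro a ⟨haE, ha⟩ s z hz
    rcases ha with ha | ⟨hade, s0, c, hc, hac⟩
    · have ha' := hTle ha
      by_cases hzde : d ≤ z ∧ z ≤ e
      · have hz' := hIc hzde.1 hzde.2
        rcases hIr hz'.1 hz'.2 hz with ⟨rfl, rfl⟩ | ⟨_, _, h⟩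
        · exact ha.mono fun w hw => hWlt hw.1 hw.2
        · exact absurd (hIc ha'.1 ha'.2) h
      · -- the limits of the germs at points near `z` lie on the germ at `a` that is in `(d, e)`
        have hzF := (hgen a ha'.1 ha'.2 s z hz).1
        obtain ⟨_, hev, _⟩ := hG.of_lim hfl hzF hz
        obtain ⟨t, ht, htend, _⟩ := hD.lim_chain hfl hG hzF hz
        obtain rfl := hr ha'.1 ha'.2 ht
        filter_upwards [htend.eventually ha, hout hzde s, hEv hz,
          hev.filter_mono (sd_le_nhds _ _)] with w h1 h2 h3 h4
        exact ⟨h3, .inr ⟨h2, s, f s w, hTlt h1.1 h1.2, h4⟩⟩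
    · have hc' := hTle hc
      obtain ⟨haF, hgen'⟩ := hgen c hc'.1 hc'.2 s0 a hac
      have hcne : c ≠ a := fun h => hade (h ▸ hc')
      obtain ⟨σ, hσ⟩ := hFl a haE haF
      obtain rfl : σ = !s0 := by
        rcases Bool.eq_or_eq_not σ s0 with rfl | h
        · exact absurd (hD.lim_unique hac hσ) hcne
        · exact h
      obtain ⟨t, ht, _, htend, _⟩ := hD.lim_chain hfl hG haF hac
      obtain rfl := hr hc'.1 hc'.2 ht
      obtain ⟨_, hev, _⟩ := hG.of_lim hfl haF hac
      by_cases hza : z = a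
      · subst hza
        obtain rfl : s = !s0 := by
          rcases Bool.eq_or_eq_not s s0 with rfl | h
          · exact absurd (hD.lim_unique hac hz) hcne
          · exact h
        filter_upwards [htend.eventually hc, hout hade (!s0), hEv hz,
          hev.filter_mono (sd_le_nhds _ _)] with w h1 h2 h3 h4
        exact ⟨h3, .inr ⟨h2, s0, f s0 w, hTlt h1.1 h1.2, h4⟩⟩
      · -- here `z → a → c` and `a → a`, which forces `z = c`
        have hzF := hgen' s z hz
        obtain ⟨t', ht', _, _, hchain⟩ := hD.lim_chain hfl hG hzF hz
        have hs0 : s0 = !t' := by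
          rcases Bool.eq_or_eq_not s0 t' with rfl | h
          · exact absurd (hD.lim_unique hac ht') hcne
          · exact h
        have hzc := hchain c (hs0 ▸ hac)
        have hzE : z ∈ E := by
          rcases (hG z hzF).1 with h | h
          · exact h.self_of_nhds
          · obtain ⟨w, h1, h2⟩ := ((h.filter_mono (sd_le_nhds s z)).and (hEv hz)).exists
            exact absurd h2 h1
        obtain ⟨σ, hσ⟩ := hFl z hzE hzF
        have hzc' : z = c := by
          rcases Bool.eq_or_eq_not σ s with rfl | rfl
          · exact absurd (hD.lim_unique hσ hz) hza
          · exact hD.lim_unique hσ hzc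
        subst hzc'
        have hzI := hIc hc'.1 hc'.2
        rcases hIr hzI.1 hzI.2 hz with ⟨_, h⟩ | ⟨rfl, _⟩
        · exact absurd h.symm hza
        · exact hc.mono fun w hw => hWlt hw.1 hw.2
  -- `W` contains the limits of the germs in it
  have hclosed : ∀ s z a, Lim E B s z a → (∀ᶠ w in sd s z, W w) → W a := by
    intro s z a hz hWw
    have hTd : Def1 L (T r) := hT r
    rcases hTd.sd_or s z with h | h
    · have hTz : ∀ᶠ w in sd s z, d < w ∧ w < e :=
        eventually_Ioo_of_Icc L (h.mono fun w hw => hTle hw).frequently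
      have hzde := hTle (t := s) hTz
      have hzI := hIc hzde.1 hzde.2
      rcases hIr hzI.1 hzI.2 hz with ⟨rfl, rfl⟩ | ⟨rfl, ⟨s', hs'⟩, hn⟩
      · exact ⟨hz.1, .inl hTz⟩
      · exact ⟨hz.1, .inr ⟨fun h => hn (hIc h.1 h.2), s', z, hTz, hs'⟩⟩
    · -- the germ lies outside `[d, e]`, and its points have germs on a side `s'` converging into
      -- `[d, e]`; hence so has `z`, by general position
      have hZ : ∀ᶠ w in sd s z, ¬ (d ≤ w ∧ w ≤ e) ∧ ∃ s', ∃ c, T (!r) c ∧ Lim E B s' w c :=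
        (hWw.and h).mono fun w hw => hw.1.2.resolve_left hw.2
      obtain ⟨s', hs'⟩ : ∃ s', ∀ᶠ w in sd s z, ∃ c, T (!r) c ∧ Lim E B s' w c := by
        have hd : ∀ s', Def1 L (fun w => ∃ c, T (!r) c ∧ Lim E B s' w c) := fun s' =>
          .ex (.and ((hT _).app (.var _)) ((hdl _).app (.var _) (.var _)))
        by_contra hcon
        rw [not_exists] at hcon
        have h1 := ((hd true).sd_or s z).resolve_left (hcon true)
        have h2 := ((hd false).sd_or s z).resolve_left (hcon false)
        obtain ⟨w, ⟨_, s', hw⟩, h1, h2⟩ := (hZ.and (h1.and h2)).exists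
        cases s'
        exacts [h2 hw, h1 hw]
      have hfw : ∀ᶠ w in sd s z, ¬ (d ≤ w ∧ w ≤ e) ∧ Lim E B s' w (f s' w) ∧
          d ≤ f s' w ∧ f s' w ≤ e := by
        filter_upwards [hs', hZ] with w ⟨c, hc, hwc⟩ hw
        rw [hfl _ _ _ hwc]
        exact ⟨hw.1, hwc, hTle hc⟩
      have hzF : z ∉ F := fun hzF => havoid z hzF s s' (hfw.mono fun w hw => hw.2.2)
      have hev : ∀ᶠ w in 𝓝 z, Lim E B s' w (f s' w) := by
        rcases (hG z hzF).2 s' with h' | h'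
        · obtain ⟨w, h1, h2⟩ := ((h'.filter_mono (sd_le_nhds s z)).and hfw).exists
          exact absurd h2.2.1 (h1 _)
        · exact h'.1
      have hzc := hev.self_of_nhds
      obtain ⟨_, _, ρ, hρ⟩ := hG.of_lim hfl hzF hzc
      have hcde : d ≤ f s' z ∧ f s' z ≤ e := by
        have hlim := hρ.continuousAt.mono_left (sd_le_nhds s z)
        exact ⟨ge_of_tendsto hlim (hfw.mono fun w hw => hw.2.2.1),
          le_of_tendsto hlim (hfw.mono fun w hw => hw.2.2.2)⟩
      have hzde : ¬ (d ≤ z ∧ z ≤ e) := by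
        intro hzde
        have hzI := hIc hzde.1 hzde.2
        have hin : ∀ᶠ w in 𝓝 z, p < w ∧ w < q := Ioo_mem_nhds hzI.1 hzI.2
        obtain ⟨w, hw, hw'⟩ := ((hin.filter_mono (sd_le_nhds s z)).and hfw).exists
        rcases hIr hw.1 hw.2 hw'.2.1 with ⟨_, h⟩ | ⟨_, _, h⟩
        · exact hw'.1 (h ▸ hw'.2.2)
        · exact h (hIc hw'.2.2.1 hw'.2.2.2)
      have hzE : z ∈ E := by
        rcases (hG z hzF).1 with h | h
        · exact h.self_of_nhds
        · obtain ⟨w, h1, h2⟩ := ((h.filter_mono (sd_le_nhds s z)).and (hEv hz)).exists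
          exact absurd h2 h1
      obtain ⟨t, ht, htend, htend', _⟩ := hD.lim_chain hfl hG hzF hzc
      obtain rfl := hr hcde.1 hcde.2 ht
      obtain ⟨σ, hσ⟩ := hFl z hzE hzF
      rcases Bool.eq_or_eq_not s s' with rfl | rfl
      · obtain rfl := hD.lim_unique hz hzc
        exact ⟨hz.1, .inl (eventually_Ioo_of_Icc L
          (htend.frequently (hfw.mono fun w hw => hw.2.2).frequently))⟩
      · have hσs : σ = !s' := by
          rcases Bool.eq_or_eq_not σ s' with rfl | h
          · exact absurd (hD.lim_unique hσ hzc ▸ hcde) hzde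
          · exact h
        obtain rfl := hD.lim_unique hz (hσs ▸ hσ)
        exact ⟨hz.1, .inr ⟨hzde, s', f s' a, eventually_Ioo_of_Icc L
          (htend'.frequently (hfw.mono fun w hw => hw.2.2).frequently), hzc⟩⟩
  have hWE : {x | W x} = E := by
    refine hD.conn {x | W x} hW (fun x hx => hx.1) ?_ ?_ ?_
    · exact fun a ha => hD.exists_subset_of_lim hW ha.1 ha (hopen a ha)
    · intro a ha haW
      have hW' : Def1 L (fun x => ¬ W x) := .not (hW.app (.var _))
      exact hD.exists_subset_of_lim (W := {x | ¬ W x}) hW' ha haW fun s z hz =>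
        (hW.sd_or s z).resolve_left fun h => haW (hclosed s z a hz h)
    · obtain ⟨x, h1, h2⟩ := exists_between hde
      exact ⟨x, hWlt h1 h2⟩
  -- but `W` does not contain the points of `(p, d)`
  obtain ⟨x, hpx, hxd⟩ := exists_between hpd
  have hxq : x < q := hxd.trans (hde.trans heq)
  have hx : x ∈ {x | W x} := hWE ▸ (hI x hpx hxq).1.1
  rcases hx.2 with h | ⟨_, s, c, hc, hxc⟩
  · exact absurd (hTle h).1 hxd.not_ge
  · have hc' := hTle hc
    rcases hIr hpx hxq hxc with ⟨_, rfl⟩ | ⟨_, _, h⟩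
    · exact absurd hc'.1 hxd.not_ge
    · exact h (hIc hc'.1 hc'.2)

/-- All but finitely many points of `E` are the limits of both their germs: the topology is the
affine one away from a finite set. -/
theorem DefBasis.finite_not_lim_self (hD : DefBasis L E B) :
    {c | c ∈ E ∧ ¬ ∀ s, Lim E B s c c}.Finite := by
  by_contra hinf
  obtain ⟨f, hf, hfl⟩ := hD.exists_limFun
  obtain ⟨F, hF, hG, hFl⟩ := hD.exists_genericOff hf hfl
  obtain ⟨r, p0, q0, hpq0, hI0⟩ := hD.exists_interval hfl hF hG hFl hinf
  -- shrink the interval so that no germ at a point of it converges to another point of it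
  obtain ⟨p, q, hpq, hI⟩ : ∃ p q, p < q ∧ ∀ c, p < c → c < q → Lim E B r c c ∧ ¬ Lim E B (!r) c c ∧
      ∀ x, Lim E B (!r) c x → (∃ s, Lim E B s x c) ∧ ¬ (p < x ∧ x < q) := by
    have hex : Def1 L (fun c => ∃ x, Lim E B (!r) c x) :=
      .ex ((hD.def2_lim _).app (.var _) (.var _))
    obtain ⟨p1, q1, h1, h2, h3, h4⟩ := hex.decide hpq0
    rcases h4 with h4 | h4
    · obtain ⟨c, hc, hcF⟩ := ((Ioo_infinite h2).sdiff hF).nonempty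
      obtain ⟨x, hx⟩ := h4 c hc.1 hc.2
      obtain ⟨hfx, _, ρ, hρ⟩ := hG.of_lim hfl hcF hx
      have hne : x ≠ c := fun h => (hI0 c (h1.trans_lt hc.1) (hc.2.trans_le h3)).2.1 (h ▸ hx)
      obtain ⟨U, V, hU, hV, hxU, hcV, hUV⟩ := t2_separation hne
      have hev : ∀ᶠ w in 𝓝 c, (p1 < w ∧ w < q1) ∧ w ∈ V ∧ f (!r) w ∈ U :=
        (show ∀ᶠ w in 𝓝 c, p1 < w ∧ w < q1 from Ioo_mem_nhds hc.1 hc.2).and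
          ((show ∀ᶠ w in 𝓝 c, w ∈ V from hV.mem_nhds hcV).and
            (hρ.continuousAt.eventually (hU.mem_nhds (show f (!r) c ∈ U by rwa [hfx]))))
      obtain ⟨p, q, hp, hq, hpq⟩ := mem_nhds_iff_Ioo.1 hev
      refine ⟨p, q, hp.trans hq, fun w hw hw' => ?_⟩
      obtain ⟨h5, h6, h7⟩ := hpq w hw hw'
      obtain ⟨h8, h9, h10⟩ := hI0 w (h1.trans_lt h5.1) (h5.2.trans_le h3)
      refine ⟨h8, h9, fun y hy => ⟨h10 y hy, fun hyI => ?_⟩⟩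
      rw [hfl _ _ _ hy] at h7
      exact disjoint_left.1 hUV h7 (hpq y hyI.1 hyI.2).2.1
    · refine ⟨p1, q1, h2, fun c hc hc' => ?_⟩
      obtain ⟨h5, h6, _⟩ := hI0 c (h1.trans_lt hc) (hc'.trans_le h3)
      exact ⟨h5, h6, fun x hx => absurd ⟨x, hx⟩ (h4 c hc hc')⟩
  -- avoid the limits of germs at the points of `F`, and the limits of germs at these limits
  let F1 : Set M := ⋃ s, f s '' (F ∪ ⋃ s', f s' '' F)
  have hF1 : F1.Finite :=
    finite_iUnion fun s => (hF.union (finite_iUnion fun s' => hF.image _)).image _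
  obtain ⟨c, hc, hcF1⟩ := ((Ioo_infinite hpq).sdiff hF1).nonempty
  have hev : ∀ᶠ w in 𝓝 c, (p < w ∧ w < q) ∧ w ∉ F1 :=
    (show ∀ᶠ w in 𝓝 c, p < w ∧ w < q from Ioo_mem_nhds hc.1 hc.2).and
      (hF1.isClosed.isOpen_compl.mem_nhds hcF1)
  obtain ⟨p', q', hp', hq', hpq'⟩ := mem_nhds_iff_Ioo.1 hev
  let T : Set (Filter M × (M → M)) := ⋃ s, ⋃ s', (fun z => (sd s z, f s')) '' F
  have hT : T.Finite := finite_iUnion fun s => finite_iUnion fun s' => hF.image _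
  obtain ⟨d, e, h1, h2, h3, h4⟩ := exists_Icc_avoiding (T := T) hT (by
    intro t ht
    obtain ⟨s, ht⟩ := mem_iUnion.1 ht
    obtain ⟨s', z, hz, rfl⟩ := mem_iUnion.1 ht
    exact sd_neBot s z) (hp'.trans hq')
  have hmem : ∀ x, d ≤ x → x ≤ e → (p < x ∧ x < q) ∧ x ∉ F1 := fun x hx hx' =>
    hpq' x (h1.trans_le hx) (hx'.trans_lt h3)
  refine hD.false_of_interval hfl hG hFl (hmem d le_rfl h2.le).1.1 h2 (hmem e h2.le le_rfl).1.2 hI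
    (fun x hx hx' s w hw => ⟨fun hwF => ?_, fun s' v hv hvF => ?_⟩) fun z hz s s' => ?_
  · exact (hmem x hx hx').2 (mem_iUnion.2 ⟨s, w, .inl hwF, hfl _ _ _ hw⟩)
  · exact (hmem x hx hx').2 (mem_iUnion.2 ⟨s, w, .inr (mem_iUnion.2
      ⟨s', v, hvF, hfl _ _ _ hv⟩), hfl _ _ _ hw⟩)
  · exact h4 (sd s z, f s') (mem_iUnion.2 ⟨s, mem_iUnion.2 ⟨s', z, hz, rfl⟩⟩)

end clopen

/-! ### Separating families of functions -/

/-- The function with a peak between `p` and `q` and zero elsewhere; the slope on the right hand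
side of the peak depends on `r`, so that the two functions together separate points. -/
def tent {M : Type*} [AddCommGroup M] [LinearOrder M] (p q : M) (r : Bool) (x : M) : M :=
  max 0 (min (x - p) (if r then q - x else q - x + (q - x)))

open scoped Classical in
/-- The function which is zero except within distance `c` of `f` on the side `s` of `f`, where it
increases to `c` as its argument approaches `f`. -/
noncomputable def spike {M : Type*} [AddCommGroup M] [LinearOrder M] (c f : M) (s : Bool) (x : M) :
    M :=
  if (if s then f < x else x < f) then max 0 (c - |x - f|) else 0

section separate

variable {L : FirstOrder.Language} {M : Type*} [L.Structure M] [AddCommGroup M] [LinearOrder M]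
  [IsOrderedAddMonoid M] [hM : Fact (IsOMinimalExpansion L M)] [DenselyOrdered M] [Nontrivial M]
  [TopologicalSpace M] [OrderTopology M]

theorem continuous_tent (p q : M) (r : Bool) : Continuous (tent p q r) := by
  unfold tent
  cases r <;> simp only [if_true, if_false, Bool.false_eq_true] <;> fun_prop

theorem tent_pos {p q x : M} (hp : p < x) (hq : x < q) (r : Bool) : 0 < tent p q r x := by
  have h1 : 0 < q - x := sub_pos.2 hq
  refine lt_max_of_lt_right (lt_min (sub_pos.2 hp) ?_)
  cases r
  · exact add_pos h1 h1
  · exact h1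

theorem lt_and_lt_of_tent_pos {p q x : M} (h : 0 < tent p q true x) : p < x ∧ x < q := by
  rcases lt_max_iff.1 h with h | h
  · exact absurd h (lt_irrefl _)
  · exact ⟨sub_pos.1 (lt_min_iff.1 h).1, sub_pos.1 (lt_min_iff.1 h).2⟩

theorem not_lt_of_tent_eq {p q x y : M} (hx : p < x) (hy : y < q)
    (h : ∀ r, tent p q r x = tent p q r y) : ¬ x < y := by
  intro hxy
  have h1 := h true
  have h2 := h false
  simp only [tent, if_true, if_false, Bool.false_eq_true] at h1 h2
  grind

theorem DF1.tent (p q : M) (r : Bool) : DF1 L (tent p q r) := by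
  unfold DF1 _root_.tent
  cases r
  · exact .max (.const _) (.min (.sub (.var _) (.const _))
      (.add (.sub (.const _) (.var _)) (.sub (.const _) (.var _))))
  · exact .max (.const _) (.min (.sub (.var _) (.const _)) (.sub (.const _) (.var _)))

theorem DF1.spike (c f : M) (s : Bool) : DF1 L (spike c f s) := by
  unfold DF1 _root_.spike
  refine DF.ite ?_ (.max (.const _) (.sub (.const _) (.abs (.sub (.var _) (.const _))))) (.const _)
  cases s
  · simp
  · simp

theorem spike_self (c f : M) (s : Bool) : spike c f s f = 0 := by
  unfold spike
  cases s <;> simp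

theorem spike_of_le {c f x : M} (h : c ≤ |x - f|) (s : Bool) : spike c f s x = 0 := by
  unfold spike
  rw [max_eq_left (sub_nonpos.2 h), ite_self]

theorem continuousAt_spike {c f x : M} (s : Bool) (h : x ≠ f) : ContinuousAt (spike c f s) x := by
  have hc : Continuous fun y : M => max 0 (c - |y - f|) := by fun_prop
  by_cases hs : if s then f < x else x < f
  · refine hc.continuousAt.congr ?_
    have : ∀ᶠ y in 𝓝 x, if s then f < y else y < f := by
      cases s
      · exact (show ∀ᶠ y in 𝓝 x, y < f from Iio_mem_nhds (by simpa using hs)).mono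
          fun y hy => by simpa using hy
      · exact (show ∀ᶠ y in 𝓝 x, f < y from Ioi_mem_nhds (by simpa using hs)).mono
          fun y hy => by simpa using hy
    exact this.mono fun y hy => (if_pos hy).symm
  · refine (continuousAt_const (y := 0)).congr ?_
    have : ∀ᶠ y in 𝓝 x, ¬ if s then f < y else y < f := by
      cases s
      · have h' : f < x := lt_of_le_of_ne (by simpa using hs) h.symm
        exact (show ∀ᶠ y in 𝓝 x, f < y from Ioi_mem_nhds h').mono fun y hy => by simpa using hy.le
      · have h' : x < f := lt_of_le_of_ne (by simpa using hs) h
        exact (show ∀ᶠ y in 𝓝 x, y < f from Iio_mem_nhds h').mono fun y hy => by simpa using hy.le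
    exact this.mono fun y hy => (if_neg hy).symm

theorem tendsto_spike_self {c : M} (hc : 0 < c) (f : M) (s : Bool) :
    Tendsto (spike c f s) (sd s f) (𝓝 c) := by
  have h1 : Tendsto (fun y : M => max 0 (c - |y - f|)) (sd s f) (𝓝 c) := by
    have h2 : Continuous fun y : M => max 0 (c - |y - f|) := by fun_prop
    have h3 := h2.tendsto f
    simp only [sub_self, abs_zero, sub_zero, max_eq_right hc.le] at h3
    exact h3.mono_left (sd_le_nhds s f)
  refine h1.congr' ?_
  have : ∀ᶠ y in sd s f, if s then f < y else y < f := by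
    cases s
    · exact eventually_mem_nhdsWithin
    · exact eventually_mem_nhdsWithin
  exact this.mono fun y hy => (if_pos hy).symm

theorem tendsto_spike_not (c f : M) (s : Bool) :
    Tendsto (spike c f s) (sd (!s) f) (𝓝 0) := by
  refine tendsto_const_nhds.congr' ?_
  have : ∀ᶠ y in sd (!s) f, ¬ if s then f < y else y < f := by
    cases s
    · filter_upwards [show ∀ᶠ y in sd true f, f < y from eventually_mem_nhdsWithin] with y hy
      simpa using hy.le
    · filter_upwards [show ∀ᶠ y in sd false f, y < f from eventually_mem_nhdsWithin] with y hy
      simpa using hy.le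
  exact this.mono fun y hy => (if_neg hy).symm

variable {β : Type*} [Finite β] {E : Set M} {B : (β → M) → Set M}

/-- A finite family of definable functions which detects the convergence of germs induces the
topology with basis `B`. -/
theorem DefBasis.inducing_of_lim_iff (hD : DefBasis L E B) {ι : Type*} [Finite ι] {φ : ι → M → M}
    (hφ : ∀ i, DF1 L (φ i))
    (hcont : ∀ s z a, Lim E B s z a → ∀ i, Tendsto (φ i) (sd s z) (𝓝 (φ i a)))
    (hinj : ∀ x ∈ E, ∀ a ∈ E, (∀ i, φ i x = φ i a) → x = a)
    (hsep : ∀ s z, ∀ a ∈ E, (∀ᶠ x in sd s z, x ∈ E) →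
      (∀ i, Tendsto (φ i) (sd s z) (𝓝 (φ i a))) → Lim E B s z a) :
    ∀ a ∈ E, (∀ b, a ∈ B b → ∃ ε, 0 < ε ∧ ∀ x ∈ E, (∀ i, |φ i x - φ i a| < ε) → x ∈ B b) ∧
      ∀ ε, 0 < ε → ∃ b, a ∈ B b ∧ ∀ x ∈ B b, ∀ i, |φ i x - φ i a| < ε := by
  have hnear : ∀ {y ε : M}, 0 < ε → ∀ᶠ x in 𝓝 y, |x - y| < ε := fun {y ε} hε =>
    eventually_abs_sub_lt y hε
  intro a ha
  refine ⟨fun b hb => ?_, fun ε hε => ?_⟩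
  · -- otherwise definable compactness gives a point or a germ outside `B b` at which all the
    -- functions agree with their values at `a`
    by_contra! hcon
    obtain ⟨lo, hi, hlh⟩ := hD.bdd
    obtain ⟨ε0, hε0⟩ := exists_gt (0 : M)
    have hdef : Dfp L (fun w : Option (Fin 1) → M => (w none ∈ E ∧ w none ∉ B b) ∧
        ∀ i, |φ i (w none) - φ i a| < w (some 0)) :=
      .and (.and (hD.def_E.app (.var _)) (.not ((hD.def1_B b).app (.var _))))
        (.allFin fun i => .lt (.abs (.sub ((hφ i).app (.var _)) (.const _))) (.var _))
    obtain ⟨z, _, _, hz⟩ := exists_cluster (L := L) (Λ := fun w : Fin 1 → M => 0 < w 0)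
      (S := fun w x => (x ∈ E ∧ x ∉ B b) ∧ ∀ i, |φ i x - φ i a| < w 0) (lo := lo) (hi := hi)
      (.lt (.const _) (.var _)) hdef (fun _ _ x hx => hlh x hx.1.1) ⟨fun _ => ε0, hε0⟩
      (fun w hw => by
        obtain ⟨x, h1, h2, h3⟩ := hcon _ hw
        exact ⟨x, ⟨h1, h3⟩, h2⟩)
      (fun w w' hw hw' => ⟨fun _ => min (w 0) (w' 0), lt_min hw hw', fun x hx =>
        ⟨⟨hx.1, fun i => (hx.2 i).trans_le (min_le_left _ _)⟩,
          ⟨hx.1, fun i => (hx.2 i).trans_le (min_le_right _ _)⟩⟩⟩)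
    rcases hz with hz | ⟨s, hz⟩
    · have h0 := (hz (fun _ => ε0) hε0).1
      refine h0.2 (?_ : z ∈ B b)
      rwa [hinj z h0.1 a ha fun i => ?_]
      by_contra hne
      exact lt_irrefl _ ((hz (fun _ => |φ i z - φ i a|) (abs_pos.2 (sub_ne_zero.2 hne))).2 i)
    · have hE := (hz (fun _ => ε0) hε0).mono fun x hx => hx.1
      have hlim := hsep s z a ha (hE.mono fun x hx => hx.1) fun i => by
        intro U hU
        obtain ⟨ε, hε, h⟩ := eventually_nhds_iff_abs.1 (show ∀ᶠ x in 𝓝 (φ i a), x ∈ U from hU)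
        exact (hz (fun _ => ε) hε).mono fun x hx => h _ (hx.2 i)
      obtain ⟨x, hx, hx'⟩ := (hE.and (hlim.2 b hb)).exists
      exact hx.2 hx'
  · obtain ⟨b, hb, hsub⟩ := hD.exists_subset_of_lim (W := {x | x ∈ E ∧ ∀ i, |φ i x - φ i a| < ε})
      (.and (hD.def_E.app (.var _))
        (.allFin fun i => .lt (.abs (.sub ((hφ i).app (.var _)) (.const _))) (.const _)))
      ha ⟨ha, fun i => by simpa using hε⟩ (fun s z h => by
        obtain ⟨b, hb⟩ := hD.cover a ha
        exact ((h.2 b hb).mono fun x hx => hD.sub b hx).and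
          (eventually_all.2 fun i => (hcont s z a h i).eventually (hnear hε)))
    exact ⟨b, hb, fun x hx => (hsub hx).2⟩

open scoped Classical in
/-- The coordinate function of the vertex `w`: it takes the value `c` at `w` and tends to `c`
exactly along those germs at the points of the finite set `K` which converge to `w`. -/
noncomputable def vertexFun (E : Set M) (B : (β → M) → Set M) (c : M) (K : Finset M) (w x : M) :
    M :=
  (if x = w then c else 0) +
    ∑ t ∈ K ×ˢ (Finset.univ : Finset Bool), if Lim E B t.2 t.1 w then spike c t.1 t.2 x else 0

theorem DF.finset_sum {α ι : Type*} {g : ι → (α → M) → M} (hg : ∀ i, DF L (g i)) (s : Finset ι) :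
    DF L (fun v => ∑ i ∈ s, g i v) := by
  classical
  induction s using Finset.induction_on with
  | empty => simp
  | insert i s hi ih => simpa [Finset.sum_insert hi] using (hg i).add ih

theorem DF1.vertexFun (c : M) (K : Finset M) (w : M) : DF1 L (vertexFun E B c K w) := by
  refine .add (.ite (.eq (.var _) (.const _)) (.const _) (.const _)) (.finset_sum (fun t => ?_) _)
  by_cases h : Lim E B t.2 t.1 w
  · simp only [h, if_true]
    exact DF1.spike _ _ _
  · simp only [h, if_false]
    exact .const _

open scoped Classical in
theorem vertexFun_of_mem {c : M} {K : Finset M} (hc : ∀ x ∈ K, ∀ y ∈ K, x ≠ y → c ≤ |x - y|)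
    (w : M) {x : M} (hx : x ∈ K) : vertexFun E B c K w x = if x = w then c else 0 := by
  unfold vertexFun
  rw [Finset.sum_eq_zero, add_zero]
  rintro ⟨f, s⟩ ht
  split_ifs
  · by_cases h : x = f
    · subst h; exact spike_self _ _ _
    · exact spike_of_le (hc x hx f (Finset.mem_product.1 ht).1 h) s
  · rfl

theorem continuousAt_vertexFun {c : M} {K : Finset M} {w x : M} (hw : w ∈ K) (hx : x ∉ K) :
    ContinuousAt (vertexFun E B c K w) x := by
  refine ContinuousAt.add ?_ (tendsto_finsetSum _ fun t ht => ?_)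
  · refine (continuousAt_const (y := 0)).congr ?_
    have hne : x ≠ w := fun h => hx (h ▸ hw)
    filter_upwards [isOpen_ne.mem_nhds hne] with y hy using (if_neg hy).symm
  · split_ifs
    · exact continuousAt_spike _ fun h => hx (h ▸ (Finset.mem_product.1 ht).1)
    · exact tendsto_const_nhds

open scoped Classical in
theorem tendsto_vertexFun {c : M} (h0 : 0 < c) {K : Finset M}
    (hc : ∀ x ∈ K, ∀ y ∈ K, x ≠ y → c ≤ |x - y|) (w : M) {z : M} (hz : z ∈ K) (s : Bool) :
    Tendsto (vertexFun E B c K w) (sd s z) (𝓝 (if Lim E B s z w then c else 0)) := by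
  have key : (if Lim E B s z w then c else 0) = 0 +
      ∑ t ∈ K ×ˢ (Finset.univ : Finset Bool), if Lim E B t.2 t.1 w then
        (if t = (z, s) then c else 0) else 0 := by
    rw [zero_add, Finset.sum_eq_single (z, s)]
    · simp
    · intro t _ ht; simp [ht]
    · intro h; simp [hz] at h
  rw [key]
  refine Tendsto.add ?_ (tendsto_finsetSum _ fun t ht => ?_)
  · refine tendsto_const_nhds.congr' ?_
    have := eventually_sd_notMem (finite_singleton w) s z
    exact this.mono fun y hy => (if_neg hy).symm
  obtain ⟨f, s'⟩ := t
  split_ifs with h1 h2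
  · obtain ⟨rfl, rfl⟩ := Prod.mk.inj h2
    exact tendsto_spike_self h0 _ _
  · by_cases hf : z = f
    · subst hf
      have hs : s = !s' := by
        cases s <;> cases s' <;> simp_all
      rw [hs]
      exact tendsto_spike_not _ _ _
    · have h3 := (continuousAt_spike (c := c) s' hf).tendsto
      rw [spike_of_le (hc z hz f (Finset.mem_product.1 ht).1 hf) s'] at h3
      exact h3.mono_left (sd_le_nhds s z)
  · exact tendsto_const_nhds

/-- The topology with basis `B` is induced by finitely many definable functions, which separate
points. -/
theorem DefBasis.exists_inducing (hD : DefBasis L E B) : ∃ (k : ℕ) (φ : Fin k → M → M),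
    (∀ i, DF1 L (φ i)) ∧ (∀ x ∈ E, ∀ a ∈ E, (∀ i, φ i x = φ i a) → x = a) ∧
    ∀ a ∈ E, (∀ b, a ∈ B b → ∃ ε, 0 < ε ∧ ∀ x ∈ E, (∀ i, |φ i x - φ i a| < ε) → x ∈ B b) ∧
      ∀ ε, 0 < ε → ∃ b, a ∈ B b ∧ ∀ x ∈ B b, ∀ i, |φ i x - φ i a| < ε := by
  classical
  suffices h : ∃ (ι : Type _) (_ : Finite ι) (φ : ι → M → M), (∀ i, DF1 L (φ i)) ∧
      (∀ x ∈ E, ∀ a ∈ E, (∀ i, φ i x = φ i a) → x = a) ∧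
      (∀ s z a, Lim E B s z a → ∀ i, Tendsto (φ i) (sd s z) (𝓝 (φ i a))) ∧
      ∀ s z, ∀ a ∈ E, (∀ᶠ x in sd s z, x ∈ E) →
        (∀ i, Tendsto (φ i) (sd s z) (𝓝 (φ i a))) → Lim E B s z a by
    obtain ⟨ι, _, φ, h1, h2, h3, h4⟩ := h
    obtain ⟨k, ⟨g⟩⟩ := Finite.exists_equiv_fin ι
    have h2' : ∀ x ∈ E, ∀ a ∈ E, (∀ i, φ (g.symm i) x = φ (g.symm i) a) → x = a :=
      fun x hx a ha h => h2 x hx a ha (g.symm.forall_congr_right.1 h)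
    exact ⟨k, fun i => φ (g.symm i), fun i => h1 _, h2',
      hD.inducing_of_lim_iff (fun i => h1 _) (fun s z a h i => h3 s z a h _) h2'
        fun s z a ha hE h => h4 s z a ha hE (g.symm.forall_congr_right.1 h)⟩
  have hLimE : ∀ {s z a}, Lim E B s z a → ∀ᶠ x in sd s z, x ∈ E := fun {s z a} h => by
    obtain ⟨b, hb⟩ := hD.cover a h.1
    exact (h.2 b hb).mono fun x hx => hD.sub b hx
  obtain ⟨f, _, hfl⟩ := hD.exists_limFun
  obtain ⟨lo, hi, hlh⟩ := hD.bdd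
  -- off `F0` the topology on `E` is the order topology, and `E` is open and closed
  let F0 : Set M := {c | c ∈ E ∧ ¬ ∀ s, Lim E B s c c} ∪
    {z | ¬ ((∀ᶠ w in 𝓝 z, w ∈ E) ∨ ∀ᶠ w in 𝓝 z, w ∉ E)} ∪ {lo, hi}
  have hF0 : F0.Finite := (hD.finite_not_lim_self.union hD.def_E.finite_not_locally).union
    (toFinite _)
  have hnot : ∀ z, z ∉ F0 → z ∉ E → ∀ s, ¬ ∃ᶠ x in sd s z, x ∈ E := by
    intro z hz hzE s hs
    have h : ∀ᶠ w in 𝓝 z, w ∉ E := by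
      by_contra h
      exact hz (.inl (.inr fun h' => h'.elim (fun h' => hzE h'.self_of_nhds) h))
    exact hs (h.filter_mono (sd_le_nhds s z))
  have hself : ∀ z, z ∉ F0 → z ∈ E → ∀ s, Lim E B s z z := by
    intro z hz hzE
    by_contra h
    exact hz (.inl (.inl ⟨hzE, h⟩))
  have hlimF0 : ∀ z, z ∉ F0 → ∀ s a, Lim E B s z a → z = a := by
    intro z hz s a h
    by_cases hzE : z ∈ E
    · exact hD.lim_unique (hself z hz hzE s) h
    · exact absurd (hLimE h).frequently (hnot z hz hzE s)
  -- the vertices: the points of `F0` and the limits of the germs at these points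
  let F : Set M := F0 ∪ ⋃ s, f s '' F0
  have hF : F.Finite := hF0.union (finite_iUnion fun s => hF0.image _)
  have hFlim : ∀ z ∈ F, ∀ s a, Lim E B s z a → a ∈ F := by
    intro z hz s a h
    by_cases hz0 : z ∈ F0
    · exact .inr (mem_iUnion.2 ⟨s, z, hz0, hfl _ _ _ h⟩)
    · rwa [← hlimF0 z hz0 s a h]
  have hloF : lo ∈ F := .inl (.inr (by simp))
  have hhiF : hi ∈ F := .inl (.inr (by simp))
  obtain ⟨K, hK⟩ : ∃ K : Finset M, ∀ x, x ∈ K ↔ x ∈ F := ⟨hF.toFinset, by simp⟩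
  -- `c` is at most the distance between any two vertices
  obtain ⟨c, hc0, hc⟩ : ∃ c : M, 0 < c ∧ ∀ x ∈ K, ∀ y ∈ K, x ≠ y → c ≤ |x - y| := by
    obtain ⟨c, hc0, hc⟩ := exists_isolating_radius
      (s := (fun t : M × M => t.1 - t.2) '' (F ×ˢ F)) ((hF.prod hF).image _) 0
    refine ⟨c, hc0, fun x hx y hy hxy => ?_⟩
    by_contra! h
    exact hxy (sub_eq_zero.1 (hc _ ⟨(x, y), ⟨(hK x).1 hx, (hK y).1 hy⟩, rfl⟩ (by simpa using h)))
  -- every other point of `E` lies on an edge between two neighbouring vertices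
  have hedge : ∀ x ∈ E, x ∉ F → ∃ p ∈ F, ∃ q ∈ F,
      (∀ z ∈ F, ¬ (p < z ∧ z < q)) ∧ p < x ∧ x < q := by
    intro x hx hxF
    have hne : ∀ y ∈ F, y ≠ x := fun y hy h => hxF (h ▸ hy)
    obtain ⟨p, ⟨hp, hpx⟩, hpm⟩ := (hF.subset (sep_subset F (· < x))).exists_maximal
      ⟨lo, hloF, lt_of_le_of_ne (hlh x hx).1 (hne lo hloF)⟩
    obtain ⟨q, ⟨hq, hqx⟩, hqm⟩ := (hF.subset (sep_subset F (x < ·))).exists_minimal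
      ⟨hi, hhiF, lt_of_le_of_ne (hlh x hx).2 (hne hi hhiF).symm⟩
    refine ⟨p, hp, q, hq, fun z hz hpz => ?_, hpx, hqx⟩
    rcases lt_or_gt_of_ne (hne z hz) with h | h
    · exact absurd (hpm ⟨hz, h⟩ hpz.1.le) (not_le.2 hpz.1)
    · exact absurd (hqm ⟨hz, h⟩ hpz.2.le) (not_le.2 hpz.2)
  -- two tents on each edge, and one function for each vertex
  let ι := ({t : M × M // t ∈ F ×ˢ F ∧ ∀ z ∈ F, ¬ (t.1 < z ∧ z < t.2)} × Bool) ⊕ F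
  have : Finite F := hF
  have : Finite {t : M × M // t ∈ F ×ˢ F ∧ ∀ z ∈ F, ¬ (t.1 < z ∧ z < t.2)} :=
    (hF.prod hF).subset (sep_subset (F ×ˢ F) fun t => ∀ z ∈ F, ¬ (t.1 < z ∧ z < t.2))
  let φ : ι → M → M := Sum.elim (fun i => tent i.1.1.1 i.1.1.2 i.2) fun w => vertexFun E B c K w
  have htent : ∀ i : {t : M × M // t ∈ F ×ˢ F ∧ ∀ z ∈ F, ¬ (t.1 < z ∧ z < t.2)},
      ∀ r, ∀ x ∈ F, tent i.1.1 i.1.2 r x = 0 := by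
    intro i r x hx
    refine max_eq_left (le_of_not_gt fun h => i.2.2 x hx ?_)
    obtain ⟨h1, h2⟩ := lt_min_iff.1 h
    refine ⟨sub_pos.1 h1, sub_pos.1 (lt_of_not_ge fun h3 => ?_)⟩
    cases r
    · exact absurd h2 (not_lt.2 (add_nonpos h3 h3))
    · exact absurd h2 (not_lt.2 h3)
  have htF : ∀ a ∈ E, (∀ i r, tent (i : {t : M × M // t ∈ F ×ˢ F ∧
      ∀ z ∈ F, ¬ (t.1 < z ∧ z < t.2)}).1.1 i.1.2 r a = 0) → a ∈ F := by
    intro a ha h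
    by_contra haF
    obtain ⟨p, hp, q, hq, hpq, h1, h2⟩ := hedge a ha haF
    exact (tent_pos h1 h2 true).ne' (h ⟨(p, q), ⟨hp, hq⟩, hpq⟩ true)
  have hinj : ∀ x ∈ E, ∀ a ∈ E, (∀ i, φ i x = φ i a) → x = a := by
    intro x hx a ha h
    by_cases hxF : x ∈ F
    · have haF : a ∈ F := htF a ha fun i r => by
        rw [← htent i r x hxF]; exact (h (.inl (i, r))).symm
      have h1 : vertexFun E B c K x x = vertexFun E B c K x a := h (.inr ⟨x, hxF⟩)
      rw [vertexFun_of_mem hc _ ((hK x).2 hxF), vertexFun_of_mem hc _ ((hK a).2 haF),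
        if_pos rfl] at h1
      by_contra hne
      rw [if_neg fun h => hne h.symm] at h1
      exact hc0.ne' h1
    · obtain ⟨p, hp, q, hq, hpq, h1, h2⟩ := hedge x hx hxF
      have h3 : ∀ r, tent p q r x = tent p q r a := fun r =>
        h (.inl (⟨(p, q), ⟨hp, hq⟩, hpq⟩, r))
      obtain ⟨h4, h5⟩ := lt_and_lt_of_tent_pos ((h3 true) ▸ tent_pos h1 h2 true)
      exact le_antisymm (not_lt.1 (not_lt_of_tent_eq h4 h2 fun r => (h3 r).symm))
        (not_lt.1 (not_lt_of_tent_eq h1 h5 h3))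
  have hcont : ∀ s z a, Lim E B s z a → ∀ i, Tendsto (φ i) (sd s z) (𝓝 (φ i a)) := by
    intro s z a h i
    by_cases hz : z ∈ F
    · have ha := hFlim z hz s a h
      rcases i with ⟨i, r⟩ | ⟨w, hw⟩
      · have h1 := ((continuous_tent i.1.1 i.1.2 r).tendsto z).mono_left (sd_le_nhds s z)
        rwa [htent i r z hz, ← htent i r a ha] at h1
      · have h1 := tendsto_vertexFun (E := E) (B := B) hc0 hc w ((hK z).2 hz) s
        have h2 : Lim E B s z w ↔ a = w := ⟨fun h' => hD.lim_unique h h', fun h' => h' ▸ h⟩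
        simp only [h2] at h1
        rwa [← vertexFun_of_mem (E := E) (B := B) hc w ((hK a).2 ha)] at h1
    · obtain rfl := hlimF0 z (fun h => hz (.inl h)) s a h
      refine Tendsto.mono_left ?_ (sd_le_nhds s z)
      rcases i with ⟨i, r⟩ | ⟨w, hw⟩
      · exact (continuous_tent i.1.1 i.1.2 r).tendsto z
      · exact continuousAt_vertexFun ((hK w).2 hw) fun h => hz ((hK z).1 h)
  refine ⟨ι, inferInstance, φ, ?_, hinj, hcont, ?_⟩
  · rintro (⟨i, r⟩ | w)
    · exact DF1.tent _ _ _
    · exact DF1.vertexFun _ _ _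
  · intro s z a ha hE h
    by_cases hz : z ∈ F
    · have haF : a ∈ F := htF a ha fun i r => by
        have h1 := ((continuous_tent i.1.1 i.1.2 r).tendsto z).mono_left (sd_le_nhds s z)
        rw [htent i r z hz] at h1
        exact tendsto_nhds_unique (h (.inl (i, r))) h1
      have h1 := tendsto_vertexFun (E := E) (B := B) hc0 hc a ((hK z).2 hz) s
      have h2 : Tendsto (vertexFun E B c K a) (sd s z) (𝓝 (vertexFun E B c K a a)) :=
        h (.inr ⟨a, haF⟩)
      rw [vertexFun_of_mem hc _ ((hK a).2 haF), if_pos rfl] at h2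
      by_contra hn
      rw [if_neg hn] at h1
      exact hc0.ne' (tendsto_nhds_unique h2 h1)
    · have hz0 : z ∉ F0 := fun h => hz (.inl h)
      have hzE : z ∈ E := by
        by_contra hzE
        exact hnot z hz0 hzE s hE.frequently
      have h1 := hself z hz0 hzE s
      rwa [hinj a ha z hzE fun i => tendsto_nhds_unique (h i) (hcont s z z h1 i)]

end separate

/-! ### Definable topologies on one-dimensional sets -/

section transfer

variable {L : FirstOrder.Language} {M : Type*} [L.Structure M] [AddCommGroup M] [LinearOrder M]
  [IsOrderedAddMonoid M] [hM : Fact (IsOMinimalExpansion L M)] [DenselyOrdered M] [Nontrivial M]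
  [TopologicalSpace M] [OrderTopology M]

/-- A definable injection into `M` carries a definable topology to a definable basis on its
image. -/
theorem defBasis_image {n m : ℕ} {X : Set (Fin n → M)} (hX : IsDef L X) (hinf : X.Infinite)
    [TopologicalSpace X] [T2Space X] [RegularSpace X]
    (hconn : IsDefinablyConnected L X inferInstance)
    {D : Set (Fin n ⊕ Fin m → M)} (hD : IsDef L D)
    (hbasis : TopologicalSpace.IsTopologicalBasis
      {U : Set X | ∃ b : Fin m → M, U = {x : X | Sum.elim x.1 b ∈ D}})
    {e : (Fin n → M) → M} (he : DF L e) (hinj : InjOn e X)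
    (hbdd : ∃ lo hi, ∀ v ∈ X, lo ≤ e v ∧ e v ≤ hi) :
    DefBasis L (e '' X) (fun b : Fin m → M => e '' {v | v ∈ X ∧ Sum.elim v b ∈ D}) := by
  have hmem : ∀ (x : X) (b : Fin m → M), e x ∈ e '' {v | v ∈ X ∧ Sum.elim v b ∈ D} ↔
      x ∈ {x : X | Sum.elim x.1 b ∈ D} := by
    rintro x b
    refine ⟨fun ⟨v, hv, h⟩ => ?_, fun h => ⟨x, ⟨x.2, h⟩, rfl⟩⟩
    obtain rfl : v = x := hinj hv.1 x.2 h
    exact hv.2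
  have hnhds : ∀ {x : X} {s : Set X}, s ∈ 𝓝 x ↔ ∃ b : Fin m → M,
      e x ∈ e '' {v | v ∈ X ∧ Sum.elim v b ∈ D} ∧
      ∀ y : X, e y ∈ e '' {v | v ∈ X ∧ Sum.elim v b ∈ D} → y ∈ s := by
    intro x s
    simp only [hmem]
    rw [hbasis.mem_nhds_iff]
    constructor
    · rintro ⟨_, ⟨b, rfl⟩, h1, h2⟩
      exact ⟨b, h1, h2⟩
    · rintro ⟨b, h1, h2⟩
      exact ⟨_, ⟨b, rfl⟩, h1, h2⟩
  have hopen : ∀ b : Fin m → M, IsOpen {x : X | Sum.elim x.1 b ∈ D} := fun b =>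
    hbasis.isOpen ⟨b, rfl⟩
  have hself : ∀ (x : X) (b : Fin m → M), e x ∈ e '' {v | v ∈ X ∧ Sum.elim v b ∈ D} →
      {x : X | Sum.elim x.1 b ∈ D} ∈ 𝓝 x := fun x b h => (hopen b).mem_nhds ((hmem x b).1 h)
  constructor
  · refine Dfp.exTuple (.and ?_ (.eq ?_ (.var _)))
    · exact Dfp.subst (t := fun i (w : Fin 1 ⊕ Fin n → M) => w (.inr i)) hX fun i => .var _
    · exact DF.subst (t := fun i (w : Fin 1 ⊕ Fin n → M) => w (.inr i)) he fun i => .var _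
  · refine Dfp.exTuple (.and (.and ?_ ?_) (.eq ?_ (.var _)))
    · exact Dfp.subst (t := fun i (w : Option (Fin m) ⊕ Fin n → M) => w (.inr i)) hX
        fun i => .var _
    · refine (Dfp.subst (t := Sum.elim (fun i (w : Option (Fin m) ⊕ Fin n → M) => w (.inr i))
        fun i w => w (.inl (some i))) hD (by rintro (_ | _) <;> exact .var _)).congr fun w => ?_
      refine iff_of_eq (congrArg (· ∈ D) (funext ?_))
      rintro (_ | _) <;> rfl
    · exact DF.subst (t := fun i (w : Option (Fin m) ⊕ Fin n → M) => w (.inr i)) he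
        fun i => .var _
  · simpa using hbdd
  · exact hinf.image hinj
  · exact fun b => image_mono fun v hv => hv.1
  · rintro _ ⟨v, hv, rfl⟩
    obtain ⟨b, hb, -⟩ := hnhds.1 (univ_mem : univ ∈ 𝓝 (⟨v, hv⟩ : X))
    exact ⟨b, hb⟩
  · rintro a b b' ⟨v, hv, rfl⟩ hb'
    obtain ⟨b'', h1, h2⟩ := hnhds.1 (inter_mem (hself ⟨v, hv.1⟩ b ⟨v, hv, rfl⟩)
      (hself ⟨v, hv.1⟩ b' hb'))
    refine ⟨b'', h1, ?_⟩
    rintro _ ⟨w, hw, rfl⟩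
    have h3 := h2 ⟨w, hw.1⟩ ⟨w, hw, rfl⟩
    exact ⟨(hmem ⟨w, hw.1⟩ b).2 h3.1, (hmem ⟨w, hw.1⟩ b').2 h3.2⟩
  · rintro _ ⟨v, hv, rfl⟩ _ ⟨w, hw, rfl⟩ hne
    obtain ⟨U, V, hU, hV, hvU, hwV, hUV⟩ := t2_separation
      (show (⟨v, hv⟩ : X) ≠ ⟨w, hw⟩ from fun h => hne (congrArg (fun x : X => e x) h))
    obtain ⟨b, h1, h2⟩ := hnhds.1 (hU.mem_nhds hvU)
    obtain ⟨b', h3, h4⟩ := hnhds.1 (hV.mem_nhds hwV)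
    refine ⟨b, b', h1, h3, ?_⟩
    rintro _ ⟨x, hx, rfl⟩ hx'
    exact disjoint_left.1 hUV (h2 ⟨x, hx.1⟩ ⟨x, hx, rfl⟩) (h4 ⟨x, hx.1⟩ hx')
  · rintro _ b ⟨v, hv, rfl⟩
    obtain ⟨V, hV, hVc, hVU⟩ := exists_mem_nhds_isClosed_subset
      (hself ⟨v, hv.1⟩ b ⟨v, hv, rfl⟩)
    obtain ⟨b', h1, h2⟩ := hnhds.1 hV
    refine ⟨b', h1, ?_⟩
    rintro _ ⟨w, hw, rfl⟩ hwb
    obtain ⟨b'', h3, h4⟩ := hnhds.1 (hVc.isOpen_compl.mem_nhds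
      (show (⟨w, hw⟩ : X) ∈ Vᶜ from fun h => hwb ((hmem ⟨w, hw⟩ b).2 (hVU h))))
    refine ⟨b'', h3, ?_⟩
    rintro _ ⟨x, hx, rfl⟩ hx'
    exact h4 ⟨x, hx.1⟩ ⟨x, hx, rfl⟩ (h2 ⟨x, hx.1⟩ hx')
  · rintro W hW hWE h1 h2 ⟨_, hw⟩
    obtain ⟨v, hv, rfl⟩ := hWE hw
    by_contra hne
    obtain ⟨_, ⟨u, hu, rfl⟩, huW⟩ := not_subset.1 fun h => hne (hWE.antisymm h)
    have hd : ∀ P : M → Prop, Def1 L P → IsDef L (Subtype.val '' {x : X | P (e x)}) := by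
      intro P hP
      refine (Dfp.and (P := (· ∈ X)) hX (hP.app he)).congr fun v => ?_
      exact ⟨fun ⟨x, hx, h⟩ => h ▸ ⟨x.2, hx⟩, fun h => ⟨⟨v, h.1⟩, h.2, rfl⟩⟩
    refine hconn ⟨{x | e x ∈ W}, {x | e x ∉ W}, hd (· ∈ W) hW, hd (· ∉ W) (Dfp.not hW), ?_, ?_,
      ⟨⟨v, hv⟩, hw⟩,
      ⟨⟨u, hu⟩, huW⟩, ?_, ?_⟩
    · refine isOpen_iff_mem_nhds.2 fun x hx => hnhds.2 ?_
      obtain ⟨b, h3, h4⟩ := h1 _ hx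
      exact ⟨b, h3, fun y hy => h4 hy⟩
    · refine isOpen_iff_mem_nhds.2 fun x hx => hnhds.2 ?_
      obtain ⟨b, h3, h4⟩ := h2 _ ⟨x, x.2, rfl⟩ hx
      exact ⟨b, h3, fun y hy => h4 _ hy⟩
    · exact eq_empty_of_forall_notMem fun x hx => hx.2 hx.1
    · exact eq_univ_of_forall fun x => em _

/-- The embedding theorem over a commutative dense group carrying its order topology. -/
theorem exists_definablyHomeomorphic {n : ℕ} (hn : 0 < n) {X : Set (Fin n → M)} (hX : IsDef L X)
    (hbdd : IsBddSet X) (hdim : ¬ DimAtLeast X 2) (hinf : X.Infinite)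
    [τ : TopologicalSpace X] (hτ : IsDefinableTopology L X τ) [T2Space X] [RegularSpace X]
    (hconn : IsDefinablyConnected L X τ) :
    ∃ (k : ℕ) (Y : Set (Fin k → M)), IsDef L Y ∧
      DefinablyHomeomorphic L X τ Y instTopologicalSpaceSubtype := by
  obtain ⟨m, D, hD, hbasis⟩ := hτ
  obtain ⟨e, he, hinj, hb⟩ := exists_definable_injection hn hX hbdd hdim
  obtain ⟨k, φ, hφ, hφinj, hφind⟩ :=
    (defBasis_image hX hinf hconn hD hbasis he hinj hb).exists_inducing
  let g : X → Fin k → M := fun x i => φ i (e x)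
  have hg : IsEmbedding g := by
    refine ⟨isInducing_iff_nhds.2 fun x => ?_, fun x y h => ?_⟩
    · obtain ⟨h1, h2⟩ := hφind (e x) ⟨x, x.2, rfl⟩
      refine le_antisymm (tendsto_iff_comap.1 (tendsto_pi_nhds.2 fun i U hU => ?_))
        fun s hs => ?_
      · obtain ⟨ε, hε, h⟩ := eventually_nhds_iff_abs.1 (show ∀ᶠ y in 𝓝 (g x i), y ∈ U from hU)
        obtain ⟨b, ⟨v, hv, hvx⟩, h3⟩ := h2 ε hε
        obtain rfl : v = x := hinj hv.1 x.2 hvx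
        refine mem_map.2 (mem_of_superset ((hbasis.isOpen ⟨b, rfl⟩).mem_nhds hv.2) fun y hy => ?_)
        exact h _ (h3 (e y) ⟨y.1, ⟨y.2, hy⟩, rfl⟩ i)
      · obtain ⟨_, ⟨b, rfl⟩, h3, h4⟩ := hbasis.mem_nhds_iff.1 hs
        obtain ⟨ε, hε, h⟩ := h1 b ⟨x, ⟨x.2, h3⟩, rfl⟩
        refine mem_comap.2 ⟨{y | ∀ i, |y i - g x i| < ε}, eventually_all.2 fun i =>
          (continuousAt_apply i (g x)).eventually (eventually_abs_sub_lt (g x i) hε), ?_⟩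
        intro y hy
        obtain ⟨v, hv, hvy⟩ := h (e y) ⟨y, y.2, rfl⟩ hy
        obtain rfl : v = y := hinj hv.1 y.2 hvy
        exact h4 hv.2
    · exact Subtype.ext (hinj x.2 y.2
        (hφinj _ ⟨x, x.2, rfl⟩ _ ⟨y, y.2, rfl⟩ fun i => congrFun h i))
  refine ⟨k, range g, ?_, hg.toHomeomorph, ?_⟩
  · have hd : Dfp L (fun y : Fin k → M => ∃ v : Fin n → M, v ∈ X ∧ ∀ i, φ i (e v) = y i) := by
      refine .exTuple (.and ?_ (.allFin fun i => .eq ((hφ i).app ?_) (.var _)))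
      · exact Dfp.subst (t := fun i (w : Fin k ⊕ Fin n → M) => w (.inr i)) hX fun i => .var _
      · exact DF.subst (t := fun i (w : Fin k ⊕ Fin n → M) => w (.inr i)) he fun i => .var _
    refine hd.congr fun y => ⟨?_, ?_⟩
    · rintro ⟨x, rfl⟩
      exact ⟨x, x.2, fun i => rfl⟩
    · rintro ⟨v, hv, h⟩
      exact ⟨⟨v, hv⟩, funext h⟩
  · have hd : Dfp L (fun z : Fin n ⊕ Fin k → M => (fun i => z (.inl i)) ∈ X ∧
        ∀ i, z (.inr i) = φ i (e fun i => z (.inl i))) := by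
      refine .and ?_ (.allFin fun i => .eq (.var _) ((hφ i).app ?_))
      · exact Dfp.subst (t := fun i (w : Fin n ⊕ Fin k → M) => w (.inl i)) hX fun i => .var _
      · exact DF.subst (t := fun i (w : Fin n ⊕ Fin k → M) => w (.inl i)) he fun i => .var _
    refine hd.congr fun z => ⟨?_, ?_⟩
    · rintro ⟨x, rfl⟩
      exact ⟨x.2, fun i => rfl⟩
    · rintro ⟨h1, h2⟩
      refine ⟨⟨_, h1⟩, funext ?_⟩
      rintro (i | i)
      · rfl
      · exact h2 i

end transfer

theorem mainTheorem2 (L : FirstOrder.Language) (M : Type*) [L.Structure M]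
    [AddGroup M] [LinearOrder M] [AddLeftMono M] [AddRightMono M]
    (hM : IsOMinimalExpansion L M)
    (n : ℕ) (X : Set (Fin n → M)) (hX : IsDef L X) (hbdd : IsBddSet X) (hdim : HasDim X 1)
    (τ : TopologicalSpace X) (hτ : IsDefinableTopology L X τ)
    (hT2 : @T2Space X τ) (hreg : @RegularSpace X τ) (hconn : IsDefinablyConnected L X τ) :
    ∃ (k : ℕ) (Y : Set (Fin k → M)), IsDef L Y ∧
      DefinablyHomeomorphic L X τ Y (affineTopology Y) := by
  have hd2 : ¬ DimAtLeast X 2 := fun h => absurd (hdim.2 h) (by norm_num)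
  obtain ⟨ι, a, b, hab, hsub⟩ := hdim.1
  have hn : 0 < n := (ι 0).pos
  have : Nontrivial M := ⟨a 0, b 0, (hab 0).ne⟩
  have hFact : Fact (IsOMinimalExpansion L M) := ⟨hM⟩
  have hdense : DenselyOrdered M := denselyOrdered_of_ominimal L
  have hinf : X.Infinite := by
    intro hfin
    refine Ioo_infinite (hab 0) (((hfin.image fun x i => x (ι i)).image fun y => y 0).subset ?_)
    intro x hx
    exact ⟨fun _ => x, hsub fun i => by rwa [Subsingleton.elim i 0], rfl⟩
  let _ : TopologicalSpace M := Preorder.topology M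
  have : OrderTopology M := ⟨rfl⟩
  have hcomm : ∀ x y : M, x + y = y + x := add_comm_of_ominimal L
  -- the given `AddGroup` structure is kept, so the hypotheses apply as they stand
  let _ : AddCommGroup M := { ‹AddGroup M› with add_comm := hcomm }
  have : IsOrderedAddMonoid M := { add_le_add_left := fun a b h c => by gcongr }
  have hFact' : Fact (IsOMinimalExpansion L M) := ⟨hM⟩
  exact exists_definablyHomeomorphic hn hX hbdd hd2 hinf hτ hconn
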